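/- **Calibrated flows.** Let $T^*\in(0,\infty)$, and for $t\in[0,T^*]$ let $\Omega^*(t)\subset\mathbb R^d$ be open with boundary $\Sigma^*(t)=\partial\Omega^*(t)$ a nonempty closed (compact, embedded) hypersurface of class $C^1$ having $\Omega^*(t)$ locally on one side; $\nu^*$ denotes the exterior unit normal. $a=O(b)$ means $|a|\le C|b|$ with $C$ independent of $(x,t)\in\mathbb{R}^d\times[0,T^*]$, and $\operatorname{dist}$ stands for $\operatorname{dist}(\cdot,\Sigma^*(t))$. Let $(\xi,B,\vartheta,\lambda^*)$ be a gradient-flow calibration for volume-preserving mean curvature flow of $\Sigma^*$ (so that $\Sigma^*$ is a calibrated flow), i.e.: 1. $\xi\in C^1_c(\mathbb R^d\times[0,T^*];\mathbb R^d)$; $\vartheta\in C^{0,1}(\mathbb R^d\times[0,T^*])$ (bounded and Lipschitz); $B(\cdot,t)\in C^{1,1}(\mathbb R^d;\mathbb R^d)$ for each $t$, with $\sup_{t}\|B(\cdot,t)\|_{C^1}<\infty$ (no other dependence on $t$ is imposed, not even measurability); 2. $\nabla\cdot B=O(\operatorname{dist})$; 3. $\xi=\nu^*$ on $\Sigma^*(t)$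 and $|\xi|\le\max\{1-c\operatorname{dist}^2,0\}$ for some constant $c>0$; 4. $\partial_t\vartheta+(B\cdot\nabla)\vartheta=O(\operatorname{dist})$ (almost everywhere), $\partial_t|\xi|^2+(B\cdot\nabla)|\xi|^2=O(\operatorname{dist}^2)$, and $\partial_t\xi+(B\cdot\nabla)\xi+(\nabla B)^{\mathsf T}\xi=f\xi+O(\operatorname{dist})$ for some bounded $f:\mathbb{R}^d\times[0,T^*]\to\mathbb R$; 5. $B\cdot\xi+\nabla\cdot\xi-\lambda^*=O(\operatorname{dist})$, where $\lambda^*(t)=\frac1{\mathcal H^{d-1}(\Sigma^*(t))}\int_{\Sigma^*(t)}\nabla\cdot\xi\,d\mathcal H^{d-1}$; 6. $\vartheta(\cdot,t)<0$ in $\Omega^*(t)$, $\vartheta(\cdot,t)>0$ in $\mathbb R^d\setminus\overline{\Omega^*(t)}$, and $\min\{\operatorname{dist},c\}\le|\vartheta|$ for some constant $c>0$. **Distributional solutions.** Let $\chi:\mathbb R^d\times[0,T^*)\to\{0,1\}$ be measurable, with $\chi(\cdot,t)\in BV(\mathbb R^d)$ (finite volume and finite perimeter) for $t=0$ and for a.e.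 $t\in(0,T^*)$. Put $\nu=-\nabla\chi/|\nabla\chi|$ and $E[\chi(\cdot,t)]=\int_{\mathbb R^d}|\nabla\chi(\cdot,t)|$. Call $\chi$ a distributional solution to volume-preserving mean curvature flow if there are a $|\nabla\chi|$-measurable $V:\mathbb R^d\times(0,T^*)\to\mathbb R$ and a measurable $\lambda:(0,T^*)\to\mathbb R$ such that: 1. for all $\zeta\in C^1_c(\mathbb R^d\times[0,T^*))$ and a.e. $T'\in(0,T^*)$, $$\int\zeta(\cdot,T')\chi(\cdot,T')\,dx-\int\zeta(\cdot,0)\chi(\cdot,0)\,dx=\int_0^{T'}\!\!\int\chi\,\partial_t\zeta\,dx\,dt+\int_0^{T'}\!\!\int\zeta V\,|\nabla\chi|\,dt;$$ 2. for all $X\in C^1_c(\mathbb R^d;\mathbb R^d)$ and a.e. $t\in(0,T^*)$, $$\int(\nabla\cdot X-\nu\cdot\nabla X\,\nu)\,|\nabla\chi(\cdot,t)|=-\int(V-\lambda)\,\nu\cdot X\,|\nabla\chi(\cdot,t)|;$$ 3. for a.e. $T'\in(0,T^*)$, $E[\chi(\cdot,T')]+\int_0^{T'}\!\int V^2|\nabla\chi|\,dt\le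 E[\chi(\cdot,0)]$; 4. for a.e. $t\in(0,T^*)$, $\int\chi(\cdot,t)\,dx=\int\chi(\cdot,0)\,dx$; 5. for every $T\in(0,T^*)$ there is $C_\lambda(T)\in[0,\infty)$ with $\int_0^T\lambda^2\,dt\le C_\lambda(T)^2$. **Relative entropy and volume error.** For $t\in[0,T^*)$ set, with values in $[0,\infty]$, $$\mathcal E(t)=\int(1-\nu\cdot\xi)\,|\nabla\chi(\cdot,t)|,\qquad \mathcal F(t)=\int|\chi(x,t)-\chi_{\Omega^*(t)}(x)|\,|\vartheta(x,t)|\,dx .$$ **Theorem.** For every $\Sigma^*$ with calibration $(\xi,B,\vartheta,\lambda^*)$ as above there is a constant $C\in(0,\infty)$, depending only on $d$, $T^*$, $\Sigma^*$ and the calibration, such that for every distributional solution $\chi$ and all admissible $V$, $\lambda$ and $C_\lambda(\cdot)$ as above: * for a.e. $T\in(0,T^*)$, $$\mathcal E(T)+\mathcal F(T)\le e^{C\sqrt T(1+C_\lambda(T))}\big(\mathcal E(0)+\mathcal F(0)\big),$$ and likewise, for every $T\in(0,T^*)$, $\mathcal E(t)+\mathcal F(t)\le e^{C\sqrt T(1+C_\lambda(T))}(\mathcal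 E(0)+\mathcal F(0))$ for a.e. $t\in(0,T)$; * in particular, if $\chi(x,0)=\chi_{\Omega^*(0)}(x)$ for a.e. $x\in\mathbb R^d$, then $\chi(x,t)=\chi_{\Omega^*(t)}(x)$ for a.e. $(x,t)\in\mathbb R^d\times(0,T^*)$. -/

import Mathlib

open Set Filter Topology MeasureTheory
open scoped ENNReal NNReal

noncomputable section

namespace VPMCF

/-- Euclidean space `ℝ^d`. Time-dependent objects are curried, time first. -/
abbrev Rd (d : ℕ) := EuclideanSpace ℝ (Fin d)

variable {d : ℕ}

/-- The divergence `∇ · X`. -/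
def divergence (X : Rd d → Rd d) (x : Rd d) : ℝ :=
  ∑ i : Fin d, (fderiv ℝ X x (EuclideanSpace.single i 1)) i

/-! ### Closed hypersurfaces bounding open sets -/

/-- Near the point `x`, the set `Ω` is the sublevel set `{φ < 0}` of the `C¹` function `φ`, whose
gradient does not vanish at `x`. -/
def IsLocalDefiningFunction (Ω : Set (Rd d)) (x : Rd d) (φ : Rd d → ℝ) : Prop :=
  ContDiff ℝ 1 φ ∧ gradient φ x ≠ 0 ∧ ∀ᶠ y in 𝓝 x, (y ∈ Ω ↔ φ y < 0)

/-- `n` is the exterior unit normal of `Ω` at the boundary point `x`. -/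
def IsExteriorUnitNormal (Ω : Set (Rd d)) (x n : Rd d) : Prop :=
  ∃ φ : Rd d → ℝ, IsLocalDefiningFunction Ω x φ ∧ n = ‖gradient φ x‖⁻¹ • gradient φ x

/-- `Ω` is open and `Σ = ∂Ω` is a nonempty closed (compact, without boundary) embedded
hypersurface of class `C¹`, with `Ω` lying locally on one side of it. -/
structure BoundsClosedSurface (Ω : Set (Rd d)) : Prop where
  isOpen : IsOpen Ω
  nonempty : (frontier Ω).Nonempty
  isCompact : IsCompact (frontier Ω)
  regular : ∀ x ∈ frontier Ω, ∃ φ : Rd d → ℝ, IsLocalDefiningFunction Ω x φ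

/-! ### Gradient-flow calibrations -/

/-- `(ξ, B, ϑ, lamStar)` is a gradient-flow calibration for volume-preserving mean curvature flow
of the surfaces `Σ*(t) = ∂Ω(t)`, `t ∈ [0, Tstar]`. All constants are uniform in space and time.
Time derivatives on `[0, Tstar]` are one-sided at the end points. -/
structure IsCalibration (Tstar : ℝ) (Ω : ℝ → Set (Rd d)) (ξ B : ℝ → Rd d → Rd d)
    (ϑ : ℝ → Rd d → ℝ) (lamStar : ℝ → ℝ) : Prop where
  /-- `ξ ∈ C¹_c(ℝ^d × [0, Tstar]; ℝ^d)`. -/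
  xi_C1 : ContDiffOn ℝ 1 (Function.uncurry ξ) (Icc 0 Tstar ×ˢ univ)
  xi_compact : ∃ R : ℝ, ∀ t ∈ Icc 0 Tstar, ∀ x, R < ‖x‖ → ξ t x = 0
  /-- `ϑ ∈ C^{0,1}(ℝ^d × [0, Tstar])`. -/
  theta_lip : ∃ K : ℝ≥0, LipschitzOnWith K (Function.uncurry ϑ) (Icc 0 Tstar ×ˢ univ)
  theta_bdd : ∃ K : ℝ, ∀ t ∈ Icc 0 Tstar, ∀ x, |ϑ t x| ≤ K
  /-- `B(·, t) ∈ C^{1,1}(ℝ^d; ℝ^d)` for each `t`, with a `C¹` norm bounded uniformly in `t`.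
  Nothing is asked of the dependence on `t` otherwise, not even measurability. -/
  B_C1 : ∀ t ∈ Icc 0 Tstar, ContDiff ℝ 1 (B t)
  B_C11 : ∀ t ∈ Icc 0 Tstar, ∃ L : ℝ≥0, LipschitzWith L (fderiv ℝ (B t))
  B_bdd : ∃ K : ℝ, ∀ t ∈ Icc 0 Tstar, ∀ x, ‖B t x‖ ≤ K ∧ ‖fderiv ℝ (B t) x‖ ≤ K
  /-- `∇ · B = O(dist(·, Σ*))`. -/
  div_B : ∃ C : ℝ, ∀ t ∈ Icc 0 Tstar, ∀ x,
    |divergence (B t) x| ≤ C * Metric.infDist x (frontier (Ω t))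
  /-- `ξ` extends the exterior unit normal. -/
  xi_normal : ∀ t ∈ Icc 0 Tstar, ∀ x ∈ frontier (Ω t), IsExteriorUnitNormal (Ω t) x (ξ t x)
  /-- Quantitative shortness of `ξ`. -/
  xi_short : ∃ c : ℝ, 0 < c ∧ ∀ t ∈ Icc 0 Tstar, ∀ x,
    ‖ξ t x‖ ≤ max (1 - c * Metric.infDist x (frontier (Ω t)) ^ 2) 0
  /-- `∂ₜϑ + (B · ∇)ϑ = O(dist(·, Σ*))`; as `ϑ` is Lipschitz, its derivatives exist almost
  everywhere, and the relation is imposed almost everywhere. -/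
  transport_theta : ∃ C : ℝ, ∀ᵐ t ∂(volume.restrict (Ioo 0 Tstar)), ∀ᵐ x : Rd d,
    |deriv (fun s => ϑ s x) t + fderiv ℝ (ϑ t) x (B t x)|
      ≤ C * Metric.infDist x (frontier (Ω t))
  /-- `∂ₜ|ξ|² + (B · ∇)|ξ|² = O(dist²(·, Σ*))`. -/
  transport_norm_xi : ∃ C : ℝ, ∀ t ∈ Icc 0 Tstar, ∀ x,
    |derivWithin (fun s => ‖ξ s x‖ ^ 2) (Icc 0 Tstar) t
        + fderiv ℝ (fun y => ‖ξ t y‖ ^ 2) x (B t x)|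
      ≤ C * Metric.infDist x (frontier (Ω t)) ^ 2
  /-- `∂ₜξ + (B · ∇)ξ + (∇B)ᵀ ξ = f ξ + O(dist(·, Σ*))` with `f` bounded. -/
  transport_xi : ∃ (C : ℝ) (f : ℝ → Rd d → ℝ), ∀ t ∈ Icc 0 Tstar, ∀ x,
    |f t x| ≤ C ∧
    ‖derivWithin (fun s => ξ s x) (Icc 0 Tstar) t + fderiv ℝ (ξ t) x (B t x)
        + ContinuousLinearMap.adjoint (fderiv ℝ (B t) x) (ξ t x) - f t x • ξ t x‖
      ≤ C * Metric.infDist x (frontier (Ω t))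
  /-- `B · ξ + ∇ · ξ - λ* = O(dist(·, Σ*))`. -/
  evolution : ∃ C : ℝ, ∀ t ∈ Icc 0 Tstar, ∀ x,
    |inner ℝ (B t x) (ξ t x) + divergence (ξ t) x - lamStar t|
      ≤ C * Metric.infDist x (frontier (Ω t))
  /-- `λ*(t)` is the average of `∇ · ξ(·, t)` over `Σ*(t)` with respect to `H^{d-1}`. -/
  lamStar_eq : ∀ t ∈ Icc 0 Tstar,
    lamStar t = ⨍ x in frontier (Ω t), divergence (ξ t) x ∂(μH[(d : ℝ) - 1])
  theta_neg : ∀ t ∈ Icc 0 Tstar, ∀ x ∈ Ω t, ϑ t x < 0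
  theta_pos : ∀ t ∈ Icc 0 Tstar, ∀ x ∉ closure (Ω t), 0 < ϑ t x
  theta_coercive : ∃ c : ℝ, 0 < c ∧ ∀ t ∈ Icc 0 Tstar, ∀ x,
    min (Metric.infDist x (frontier (Ω t))) c ≤ |ϑ t x|

/-! ### Functions of bounded variation -/

/-- The finite measure `μ` and the `μ`-a.e. unit vector field `ν` are the polar decomposition of
the distributional gradient of `u`: `∇u = -ν μ`. Such a pair is unique (`ν` up to `μ`-null sets),
so `μ = |∇u|` and `ν = -∇u/|∇u|`. -/
structure IsPolarGradient (u : Rd d → ℝ) (μ : Measure (Rd d)) (ν : Rd d → Rd d) : Prop where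
  finite : IsFiniteMeasure μ
  measurable : Measurable ν
  norm_eq_one : ∀ᵐ x ∂μ, ‖ν x‖ = 1
  integral_divergence : ∀ φ : Rd d → Rd d, ContDiff ℝ 1 φ → HasCompactSupport φ →
    ∫ x, u x * divergence φ x = ∫ x, inner ℝ (ν x) (φ x) ∂μ

/-- `u ∈ BV(ℝ^d)`. -/
def IsBV (u : Rd d → ℝ) : Prop :=
  Integrable u ∧ ∃ (μ : Measure (Rd d)) (ν : Rd d → Rd d), IsPolarGradient u μ ν

open Classical in
/-- The total variation measure `|∇u|`. -/
def gradMeasure (u : Rd d → ℝ) : Measure (Rd d) :=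
  if h : ∃ (μ : Measure (Rd d)) (ν : Rd d → Rd d), IsPolarGradient u μ ν then h.choose else 0

open Classical in
/-- The measure-theoretic exterior normal `ν = -∇u/|∇u|`. -/
def extNormal (u : Rd d → ℝ) : Rd d → Rd d :=
  if h : ∃ (μ : Measure (Rd d)) (ν : Rd d → Rd d), IsPolarGradient u μ ν
  then h.choose_spec.choose else 0

theorem IsBV.isPolarGradient {u : Rd d → ℝ} (h : IsBV u) :
    IsPolarGradient u (gradMeasure u) (extNormal u) := by
  have h2 := h.2
  simp only [gradMeasure, extNormal, dif_pos h2]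
  exact h2.choose_spec.choose_spec

/-! ### Distributional solutions -/

/-- `χ`, with normal velocity `V` and Lagrange multiplier `lam`, is a distributional solution to
volume-preserving mean curvature flow on `(0, Tstar)` with initial datum `χ 0`, and `Clam T`
bounds the `L²(0, T)` norm of `lam`. -/
structure IsDistributionalSolution (Tstar : ℝ) (χ : ℝ → Rd d → ℝ) (V : ℝ → Rd d → ℝ)
    (lam : ℝ → ℝ) (Clam : ℝ → ℝ) : Prop where
  values : ∀ t ∈ Ico 0 Tstar, ∀ x, χ t x = 0 ∨ χ t x = 1
  aemeasurable : AEMeasurable (Function.uncurry χ) (volume.restrict (Ioo 0 Tstar ×ˢ univ))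
  /-- Finite volume and finite perimeter, initially and at almost every time. -/
  bv_zero : IsBV (χ 0)
  bv : ∀ᵐ t ∂(volume.restrict (Ioo 0 Tstar)), IsBV (χ t)
  V_measurable : Measurable (Function.uncurry V)
  lam_measurable : AEMeasurable lam (volume.restrict (Ioo 0 Tstar))
  /-- `V` is the normal velocity. -/
  velocity : ∀ ζ : ℝ → Rd d → ℝ, ContDiff ℝ 1 (Function.uncurry ζ) →
    HasCompactSupport (Function.uncurry ζ) →
    ∀ᵐ T' ∂(volume.restrict (Ioo 0 Tstar)),
      (∫ x, ζ T' x * χ T' x) - ∫ x, ζ 0 x * χ 0 x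
        = (∫ t in Ioo 0 T', ∫ x, χ t x * deriv (fun s => ζ s x) t)
          + ∫ t in Ioo 0 T', ∫ x, ζ t x * V t x ∂(gradMeasure (χ t))
  /-- The evolution equation `V = -H + λ` in weak form. -/
  evolution : ∀ X : Rd d → Rd d, ContDiff ℝ 1 X → HasCompactSupport X →
    ∀ᵐ t ∂(volume.restrict (Ioo 0 Tstar)),
      ∫ x, (divergence X x - inner ℝ (extNormal (χ t) x) (fderiv ℝ X x (extNormal (χ t) x)))
          ∂(gradMeasure (χ t))
        = -∫ x, (V t x - lam t) * inner ℝ (extNormal (χ t) x) (X x) ∂(gradMeasure (χ t))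
  /-- Optimal energy dissipation rate. -/
  dissipation : ∀ᵐ T' ∂(volume.restrict (Ioo 0 Tstar)),
    gradMeasure (χ T') univ
        + ∫⁻ t in Ioo 0 T', ∫⁻ x, ENNReal.ofReal (V t x ^ 2) ∂(gradMeasure (χ t))
      ≤ gradMeasure (χ 0) univ
  /-- Volume preservation. -/
  volume_eq : ∀ᵐ t ∂(volume.restrict (Ioo 0 Tstar)), ∫ x, χ t x = ∫ x, χ 0 x
  /-- Square-integrable Lagrange multiplier. -/
  Clam_nonneg : ∀ T ∈ Ioo 0 Tstar, 0 ≤ Clam T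
  lam_sq : ∀ T ∈ Ioo 0 Tstar,
    ∫⁻ t in Ioo 0 T, ENNReal.ofReal (lam t ^ 2) ≤ ENNReal.ofReal (Clam T ^ 2)

/-! ### Relative entropy and volume error -/

/-- The relative entropy `∫ (1 - ν · ξ(·, t)) |∇χ(·, t)|`. -/
def relEntropy (χ : ℝ → Rd d → ℝ) (ξ : ℝ → Rd d → Rd d) (t : ℝ) : ℝ≥0∞ :=
  ∫⁻ x, ENNReal.ofReal (1 - inner ℝ (extNormal (χ t) x) (ξ t x)) ∂(gradMeasure (χ t))

/-- The characteristic function of a set. -/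
def charFn (A : Set (Rd d)) : Rd d → ℝ := A.indicator 1

/-- The volume error `∫ |χ(·, t) - χ_{Ω(t)}| |ϑ(·, t)| dx`. -/
def volError (χ : ℝ → Rd d → ℝ) (Ω : ℝ → Set (Rd d)) (ϑ : ℝ → Rd d → ℝ) (t : ℝ) : ℝ≥0∞ :=
  ∫⁻ x, ENNReal.ofReal (|χ t x - charFn (Ω t) x| * |ϑ t x|)

end VPMCF

end

/-!
The theorem is a weak-strong uniqueness principle, proved by the relative entropy method. With
`μ_t = |∇χ(·, t)|` and `ν` its normal, the relative entropy `E = μ_t(ℝ^d) - ∫ ν · ξ dμ_t` controls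
`|ν - ξ|²` and, since `ξ` is short, the squared distance to the calibrated surface; the volume
error is linear in `χ`, `F = ∫ ϑ χ - ∫_Ω ϑ`, because `ϑ` has the sign of the exterior of `Ω`. The
three quantities that make up `E + F` evolve as follows. The perimeter decreases at least at the
rate `∫ V² dμ_t`. The derivative of `∫ ν · ξ dμ_t` is `∫ (ν · ∂ₜξ + (∇ · ξ) V) dμ_t`, which is the
velocity equation with the test function `∇ · ξ` (`velocity_normal`, `velocity_xi`). The derivative
of `F` is `∫ (χ - χ_Ω) ∂ₜϑ + ∫ ϑ V dμ_t` (`hasWeakVelocity_lipschitz`,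
`integral_charFn_mul_theta`).

To the resulting rate three vanishing quantities are added: the evolution equation tested with `B`;
the identity `IsPolarGradient.integral_commutator`, which says that the distributional gradient does
not see the divergence-free field `div (B ⊗ ξ - ξ ⊗ B)`; and `λ* ∫ V dμ_t`, which is zero because
the volume is preserved (`integral_V_eq_zero`). Completing the square in `V - ν · B`, the conditions
on the calibration make all remaining terms quadratic in `ν - ξ` and in the distance
(`entropy_pointwise`, `entropy_dissipation`), except the flux term `(λ* - λ) ∫ ν · B dμ_t`; the
volume error costs another half of the square (`volError_growth`).

The flux term is where volume preservation enters. On the surface `B · ξ = λ* - ∇ · ξ` and `λ*` is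
the average of `∇ · ξ`, so `∫_Ω ∇ · B = 0` by the divergence theorem (`integral_div_B_eq_zero`).
Hence `∫ ν · B dμ_t = ∫ (χ - χ_Ω) ∇ · B`, which is at most a multiple of `F` as `∇ · B` is of the
order of the distance (`abs_flux_le`). Altogether `e = E + F` satisfies
`e(T) ≤ e(0) + C ∫₀ᵀ (1 + |λ|) e dt` (`exists_rate`), and Gronwall's inequality
(`ae_le_mul_exp_of_integral_le`) with `∫₀ᵀ |λ| ≤ √T C_λ(T)` gives the estimate.

The divergence theorem for an open set with compact `C¹` boundary (`isPolarGradient_charFn`) is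
proved with small charts in which the normal is almost constant. For a nonnegative test function
supported in such a chart, integration along lines in the normal direction compares the volume
integral with the surface integral up to a small relative error, because the orthogonal projection
onto the tangent plane is almost isometric on the surface. A partition of unity adds these errors
up to an arbitrarily small multiple of the total area.

Four points concern measurability and null sets. The measures `μ_t` form a measurable kernel, the
perimeter of an open set being the supremum over countably many test fields (`exists_kernel`). As
nothing is known about the dependence of `B` on time, the evolution equation has to hold at almost
every time for all test fields at once; this follows from the separability of the space of `C¹`
fields (`ae_hasWeakCurvature`). The fields `ξ` and `ϑ` are extended in time and are admissible in
the velocity equation by mollification and cutoff. Finally, `Ω(t)` may have infinite volume; but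
then `F(0) = ∞` and the estimate is trivial (`exists_volume_le`).

For uniqueness, `χ(·, 0) = χ_{Ω(0)}` gives `F(0) = 0`, and `E(0) = 0` because the polar
decomposition of the gradient is unique (`IsPolarGradient.unique`). Then `F` vanishes at almost every time, and
since `ϑ` vanishes only on the null set `∂Ω(t)`, the two functions agree almost everywhere.
-/

noncomputable section

namespace VPMCF

/-! ### Mollification of Lipschitz functions -/

section Mollification

open scoped Convolution ContDiff

/-- Bump functions of radii `1 / (n + 2)` and `1 / (n + 1)`; the bounded ratio makes Lebesgue's
differentiation theorem applicable. -/
def mollifier (E : Type*) [NormedAddCommGroup E] (n : ℕ) : ContDiffBump (0 : E) where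
  rIn := 1 / (n + 2)
  rOut := 1 / (n + 1)
  rIn_pos := by positivity
  rIn_lt_rOut := by
    apply one_div_lt_one_div_of_lt <;> [positivity; linarith]

theorem tendsto_mollifier_rOut (E : Type*) [NormedAddCommGroup E] :
    Tendsto (fun n => (mollifier E n).rOut) atTop (𝓝 0) :=
  tendsto_one_div_add_atTop_nhds_zero_nat

variable {E : Type*} [NormedAddCommGroup E] [NormedSpace ℝ E] [FiniteDimensional ℝ E]
  [MeasurableSpace E] [BorelSpace E]

/-- The mollification `φₙ ⋆ f`. -/
def mollify (μ : Measure E) (f : E → ℝ) (n : ℕ) : E → ℝ :=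
  (mollifier E n).normed μ ⋆[ContinuousLinearMap.lsmul ℝ ℝ, μ] f

variable {μ : Measure E} [μ.IsAddHaarMeasure] {f : E → ℝ} {K : ℝ≥0}

theorem contDiff_mollify (hf : LipschitzWith K f) (n : ℕ) : ContDiff ℝ ∞ (mollify μ f n) :=
  ((mollifier E n).hasCompactSupport_normed (μ := μ)).contDiff_convolution_left _
    ((mollifier E n).contDiff_normed) hf.continuous.locallyIntegrable

theorem abs_mollify_sub_le (hf : LipschitzWith K f) (n : ℕ) (x : E) :
    |mollify μ f n x - f x| ≤ K * (1 / (n + 1)) := by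
  refine (mollifier E n).dist_normed_convolution_le (μ := μ) hf.continuous.aestronglyMeasurable
    fun y hy => (hf.dist_le_mul y x).trans ?_
  exact mul_le_mul_of_nonneg_left (Metric.mem_ball.1 hy).le K.2

theorem tendsto_mollify (hf : LipschitzWith K f) (x : E) :
    Tendsto (fun n => mollify μ f n x) atTop (𝓝 (f x)) :=
  ContDiffBump.convolution_tendsto_right_of_continuous (μ := μ) (tendsto_mollifier_rOut E) hf.continuous x

theorem lipschitzWith_mollify (hf : LipschitzWith K f) (n : ℕ) :
    LipschitzWith K (mollify μ f n) := by
  refine LipschitzWith.of_dist_le_mul fun x y => ?_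
  have hint : ∀ z, Integrable (fun t => (mollifier E n).normed μ t • f (z - t)) μ := fun z => by
    apply Continuous.integrable_of_hasCompactSupport
    · exact ((mollifier E n).continuous_normed).smul (hf.continuous.comp (by fun_prop))
    · exact ((mollifier E n).hasCompactSupport_normed (μ := μ)).smul_right
  have h : mollify μ f n x - mollify μ f n y
      = ∫ t, (mollifier E n).normed μ t • (f (x - t) - f (y - t)) ∂μ := by
    simp only [smul_sub]
    rw [integral_sub (hint x) (hint y)]; rfl
  rw [Real.dist_eq, h]
  calc |∫ t, (mollifier E n).normed μ t • (f (x - t) - f (y - t)) ∂μ|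
      ≤ ∫ t, (mollifier E n).normed μ t * (K * dist x y) ∂μ := by
        rw [← Real.norm_eq_abs]
        refine norm_integral_le_of_norm_le ((mollifier E n).integrable_normed.mul_const _)
          (Eventually.of_forall fun t => ?_)
        rw [norm_smul, Real.norm_of_nonneg ((mollifier E n).nonneg_normed t)]
        refine mul_le_mul_of_nonneg_left ?_ ((mollifier E n).nonneg_normed t)
        simpa [dist_sub_right, Real.dist_eq] using hf.dist_le_mul (x - t) (y - t)
    _ = K * dist x y := by
        rw [integral_mul_const, (mollifier E n).integral_normed, one_mul]

theorem norm_fderiv_mollify_le (hf : LipschitzWith K f) (n : ℕ) (x : E) :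
    ‖fderiv ℝ (mollify μ f n) x‖ ≤ K :=
  norm_fderiv_le_of_lipschitz ℝ (lipschitzWith_mollify hf n)

theorem locallyIntegrable_fderiv (hf : LipschitzWith K f) : LocallyIntegrable (fderiv ℝ f) μ := by
  refine (locallyIntegrable_const (K : ℝ)).mono ?_ (Eventually.of_forall fun x => ?_)
  · exact (measurable_fderiv ℝ f).aestronglyMeasurable
  · simpa using norm_fderiv_le_of_lipschitz ℝ hf

/-- Derivatives fall on the almost everywhere defined derivative of a Lipschitz function. -/
theorem fderiv_mollify (hf : LipschitzWith K f) (n : ℕ) (x : E) :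
    fderiv ℝ (mollify μ f n) x
      = ((mollifier E n).normed μ ⋆[ContinuousLinearMap.lsmul ℝ ℝ, μ] fderiv ℝ f) x := by
  have hint : Integrable (fun t => (mollifier E n).normed μ t • f (x - t)) μ := by
    apply Continuous.integrable_of_hasCompactSupport
    · exact ((mollifier E n).continuous_normed).smul (hf.continuous.comp (by fun_prop))
    · exact ((mollifier E n).hasCompactSupport_normed (μ := μ)).smul_right
  have hae : ∀ᵐ t ∂μ, DifferentiableAt ℝ f (x - t) :=
    (quasiMeasurePreserving_sub_left_of_right_invariant μ x).ae
      (p := fun y => DifferentiableAt ℝ f y) hf.ae_differentiableAt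
  refine HasFDerivAt.fderiv ?_
  refine (hasFDerivAt_integral_of_dominated_loc_of_lip (μ := μ) (s := univ)
    (F := fun y t => (mollifier E n).normed μ t • f (y - t))
    (F' := fun t => (mollifier E n).normed μ t • fderiv ℝ f (x - t))
    (bound := fun t => (mollifier E n).normed μ t * K) univ_mem ?_ hint ?_ ?_ ?_ ?_).2
  · refine Eventually.of_forall fun y => Continuous.aestronglyMeasurable ?_
    exact ((mollifier E n).continuous_normed).smul (hf.continuous.comp (by fun_prop))
  · refine (mollifier E n).continuous_normed.aestronglyMeasurable.smul ?_
    exact ((measurable_fderiv ℝ f).comp (measurable_const.sub measurable_id)).aestronglyMeasurable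
  · refine Eventually.of_forall fun t => LipschitzWith.lipschitzOnWith ?_
    refine LipschitzWith.of_dist_le_mul fun y z => ?_
    have h0 := (mollifier E n).nonneg_normed (μ := μ) t
    rw [dist_eq_norm, ← smul_sub, norm_smul, Real.norm_of_nonneg h0, Real.coe_nnabs,
      abs_of_nonneg (mul_nonneg h0 K.coe_nonneg), mul_assoc]
    refine mul_le_mul_of_nonneg_left ?_ h0
    simpa [dist_sub_right, Real.dist_eq] using hf.dist_le_mul (y - t) (z - t)
  · exact (mollifier E n).integrable_normed.mul_const _
  · filter_upwards [hae] with t ht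
    have := (ht.hasFDerivAt.comp x ((hasFDerivAt_id x).sub_const t)).const_smul
      ((mollifier E n).normed μ t)
    rw [ContinuousLinearMap.comp_id] at this
    exact this

theorem ae_tendsto_fderiv_mollify (hf : LipschitzWith K f) :
    ∀ᵐ x ∂μ, Tendsto (fun n => fderiv ℝ (mollify μ f n) x) atTop (𝓝 (fderiv ℝ f x)) := by
  filter_upwards [ContDiffBump.ae_convolution_tendsto_right_of_locallyIntegrable (μ := μ)
    (φ := mollifier E) (l := atTop) (K := 2) (tendsto_mollifier_rOut E)
    (Eventually.of_forall fun n => by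
      simp only [mollifier]
      rw [mul_one_div, div_le_div_iff₀ (by positivity) (by positivity)]
      linarith [(Nat.cast_nonneg n : (0 : ℝ) ≤ n)])
    (locallyIntegrable_fderiv hf)] with x hx
  simpa only [fderiv_mollify hf] using hx

theorem tendsto_fderiv_mollify (hf : LipschitzWith K f) {x : E}
    (hx : ContinuousAt (fderiv ℝ f) x) :
    Tendsto (fun n => fderiv ℝ (mollify μ f n) x) atTop (𝓝 (fderiv ℝ f x)) := by
  simp only [fderiv_mollify hf]
  exact ContDiffBump.convolution_tendsto_right (g := fun _ => fderiv ℝ f) (k := fun _ => x)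
    (tendsto_mollifier_rOut E)
    (Eventually.of_forall fun _ => (measurable_fderiv ℝ f).aestronglyMeasurable)
    (hx.tendsto.comp tendsto_snd) tendsto_const_nhds

theorem hasCompactSupport_mollify (hc : HasCompactSupport f) (n : ℕ) :
    HasCompactSupport (mollify μ f n) :=
  ((mollifier E n).hasCompactSupport_normed (μ := μ)).convolution _ hc

end Mollification

/-! ### Cutoff functions -/

section Cutoff

open scoped ContDiff

variable (E : Type*) [NormedAddCommGroup E] [NormedSpace ℝ E] [FiniteDimensional ℝ E]

/-- A smooth function which is `1` on the unit ball and vanishes outside the ball of radius `2`. -/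
def unitBump : ContDiffBump (0 : E) := ⟨1, 2, one_pos, one_lt_two⟩

/-- Smooth compactly supported functions increasing to `1`, with gradients tending to `0`. -/
def cutoff (n : ℕ) (x : E) : ℝ := unitBump E ((1 / (n + 1 : ℝ)) • x)

theorem exists_norm_fderiv_unitBump_le : ∃ K : ℝ≥0, ∀ x, ‖fderiv ℝ (unitBump E) x‖ ≤ K := by
  obtain ⟨K, hK⟩ := ((unitBump E).contDiff (n := 1)).lipschitzWith_of_hasCompactSupport
    (unitBump E).hasCompactSupport one_ne_zero
  exact ⟨K, fun x => norm_fderiv_le_of_lipschitz ℝ hK⟩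

/-- A Lipschitz constant of the functions `cutoff E n`. -/
def cutoffConst : ℝ≥0 := (exists_norm_fderiv_unitBump_le E).choose

variable {E}

theorem cutoff_nonneg (n : ℕ) (x : E) : 0 ≤ cutoff E n x := (unitBump E).nonneg
theorem cutoff_le_one (n : ℕ) (x : E) : cutoff E n x ≤ 1 := (unitBump E).le_one

theorem abs_cutoff_le_one (n : ℕ) (x : E) : |cutoff E n x| ≤ 1 := by
  rw [abs_of_nonneg (cutoff_nonneg n x)]; exact cutoff_le_one n x

theorem contDiff_cutoff (n : ℕ) : ContDiff ℝ ∞ (cutoff E n) :=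
  (unitBump E).contDiff.comp (contDiff_const_smul _)

theorem hasCompactSupport_cutoff (n : ℕ) : HasCompactSupport (cutoff E n) :=
  (unitBump E).hasCompactSupport.comp_smul (by positivity)

theorem eventually_cutoff_eq_one (x : E) : ∀ᶠ n in atTop, cutoff E n =ᶠ[𝓝 x] 1 := by
  obtain ⟨N, hN⟩ := exists_nat_gt ‖x‖
  filter_upwards [eventually_ge_atTop N] with n hn
  have hopen : IsOpen {y : E | ‖y‖ < n + 1} := isOpen_lt continuous_norm continuous_const
  filter_upwards [hopen.mem_nhds (show ‖x‖ < n + 1 by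
    have : (N : ℝ) ≤ n := by exact_mod_cast hn
    linarith)] with y hy
  have hy' : ‖y‖ < n + 1 := hy
  refine (unitBump E).one_of_mem_closedBall ?_
  rw [mem_closedBall_zero_iff, norm_smul, Real.norm_of_nonneg (by positivity)]
  change 1 / (n + 1 : ℝ) * ‖y‖ ≤ 1
  rw [one_div_mul_eq_div, div_le_one (by positivity)]
  exact hy'.le

theorem tendsto_cutoff (x : E) : Tendsto (fun n => cutoff E n x) atTop (𝓝 1) :=
  tendsto_const_nhds.congr' ((eventually_cutoff_eq_one x).mono fun _ h => h.eq_of_nhds.symm)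

theorem tendsto_fderiv_cutoff (x : E) :
    Tendsto (fun n => fderiv ℝ (cutoff E n) x) atTop (𝓝 0) := by
  refine tendsto_const_nhds.congr' ((eventually_cutoff_eq_one x).mono fun n h => ?_)
  change 0 = fderiv ℝ (cutoff E n) x
  rw [h.fderiv_eq]
  exact (fderiv_const_apply (1 : ℝ)).symm

theorem norm_fderiv_cutoff_le (n : ℕ) (x : E) : ‖fderiv ℝ (cutoff E n) x‖ ≤ cutoffConst E := by
  have h1 : HasFDerivAt (cutoff E n)
      ((fderiv ℝ (unitBump E) ((1 / (n + 1 : ℝ)) • x)).comp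
        ((1 / (n + 1 : ℝ)) • ContinuousLinearMap.id ℝ E)) x := by
    have h0 : HasFDerivAt (fun x : E => (1 / (n + 1 : ℝ)) • x)
        ((1 / (n + 1 : ℝ)) • ContinuousLinearMap.id ℝ E) x := (hasFDerivAt_id x).const_smul _
    exact (((unitBump E).contDiff (n := 1)).differentiable one_ne_zero _).hasFDerivAt.comp x h0
  rw [h1.fderiv, ContinuousLinearMap.comp_smul, ContinuousLinearMap.comp_id, norm_smul,
    Real.norm_of_nonneg (by positivity)]
  refine (mul_le_of_le_one_left (norm_nonneg _) ?_).trans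
    ((exists_norm_fderiv_unitBump_le E).choose_spec _)
  rw [div_le_one (by positivity)]
  linarith [(Nat.cast_nonneg n : (0 : ℝ) ≤ n)]

theorem lipschitzWith_cutoff (n : ℕ) : LipschitzWith (cutoffConst E) (cutoff E n) :=
  lipschitzWith_of_nnnorm_fderiv_le ((contDiff_cutoff n).differentiable (by simp))
    (norm_fderiv_cutoff_le n)

end Cutoff

/-! ### The divergence -/

section Divergence

variable {d : ℕ}

theorem divergence_smul {g : Rd d → ℝ} {X : Rd d → Rd d} {x : Rd d}
    (hg : DifferentiableAt ℝ g x) (hX : DifferentiableAt ℝ X x) :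
    divergence (fun y => g y • X y) x = fderiv ℝ g x (X x) + g x * divergence X x := by
  simp only [divergence]
  rw [fderiv_fun_smul hg hX]
  simp only [_root_.add_apply, _root_.smul_apply,
    ContinuousLinearMap.smulRight_apply, PiLp.add_apply, PiLp.smul_apply, smul_eq_mul,
    Finset.sum_add_distrib, ← Finset.mul_sum]
  rw [add_comm]
  congr 1
  have hx : X x = ∑ i, X x i • EuclideanSpace.single i (1 : ℝ) := by
    conv_lhs => rw [← (EuclideanSpace.basisFun (Fin d) ℝ).sum_repr (X x)]
    simp
  conv_rhs => rw [hx, map_sum]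
  simp [mul_comm]

theorem abs_divergence_le (X : Rd d → Rd d) (x : Rd d) :
    |divergence X x| ≤ d * ‖fderiv ℝ X x‖ := by
  refine (Finset.abs_sum_le_sum_abs _ _).trans ?_
  refine (Finset.sum_le_card_nsmul _ _ ‖fderiv ℝ X x‖ fun i _ => ?_).trans (by simp)
  refine ((Real.norm_eq_abs _).symm.le.trans (PiLp.norm_apply_le _ i)).trans ?_
  simpa using (fderiv ℝ X x).le_opNorm (EuclideanSpace.single i 1)

theorem continuous_divergence {X : Rd d → Rd d} (hX : ContDiff ℝ 1 X) :
    Continuous (divergence X) := by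
  have := hX.continuous_fderiv one_ne_zero
  unfold divergence
  fun_prop

theorem fderiv_coord_apply {X : Rd d → Rd d} {x : Rd d} (hX : DifferentiableAt ℝ X x)
    (i : Fin d) (v : Rd d) : fderiv ℝ (fun y => X y i) x v = (fderiv ℝ X x v) i := by
  have := ((EuclideanSpace.proj i : Rd d →L[ℝ] ℝ).hasFDerivAt).comp x hX.hasFDerivAt
  exact congrArg (fun L => L v) this.fderiv

theorem divergence_eq_sum_coord {X : Rd d → Rd d} {x : Rd d} (hX : DifferentiableAt ℝ X x) :
    divergence X x
      = ∑ i, fderiv ℝ (fun y => X y i) x (EuclideanSpace.single i 1) := by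
  simp only [divergence, fderiv_coord_apply hX]

end Divergence

/-! ### Functions of bounded variation -/

section BV

variable {d : ℕ} {u : Rd d → ℝ} {μ : Measure (Rd d)} {ν : Rd d → Rd d}

theorem IsPolarGradient.integrable_inner (h : IsPolarGradient u μ ν) {X : Rd d → Rd d}
    (hX : AEStronglyMeasurable X μ) {M : ℝ} (hM : ∀ x, ‖X x‖ ≤ M) :
    Integrable (fun x => inner ℝ (ν x) (X x)) μ := by
  have := h.finite
  refine Integrable.of_bound (C := M) (h.measurable.aestronglyMeasurable.inner hX) ?_
  filter_upwards [h.norm_eq_one] with x hx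
  refine (norm_inner_le_norm _ _).trans ?_
  rw [hx, one_mul]; exact hM x

/-- The defining identity of the distributional gradient holds for bounded test fields with
bounded derivatives. -/
theorem IsPolarGradient.integral_divergence_of_bounded (h : IsPolarGradient u μ ν)
    (hu : Integrable u) {X : Rd d → Rd d} (hX : ContDiff ℝ 1 X) {M : ℝ}
    (hM : ∀ x, ‖X x‖ ≤ M) (hM' : ∀ x, ‖fderiv ℝ X x‖ ≤ M) :
    ∫ x, u x * divergence X x = ∫ x, inner ℝ (ν x) (X x) ∂μ := by
  have := h.finite
  have hM0 : 0 ≤ M := (norm_nonneg _).trans (hM 0)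
  have hη : ∀ n, ContDiff ℝ 1 (cutoff (Rd d) n) := fun n => (contDiff_cutoff n).of_le (by simp)
  have key : ∀ n, ∫ x, u x * divergence (fun y => cutoff (Rd d) n y • X y) x
      = ∫ x, inner ℝ (ν x) (cutoff (Rd d) n x • X x) ∂μ := fun n =>
    h.integral_divergence _ ((hη n).smul hX) (hasCompactSupport_cutoff n).smul_right
  have hdiv : ∀ n x, divergence (fun y => cutoff (Rd d) n y • X y) x
      = fderiv ℝ (cutoff (Rd d) n) x (X x) + cutoff (Rd d) n x * divergence X x := fun n x =>
    divergence_smul ((hη n).differentiable one_ne_zero x) (hX.differentiable one_ne_zero x)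
  have hcη : ∀ n, Continuous (fun x => fderiv ℝ (cutoff (Rd d) n) x (X x)) := fun n =>
    ((hη n).continuous_fderiv one_ne_zero).clm_apply hX.continuous
  have hlim1 : Tendsto (fun n => ∫ x, u x * divergence (fun y => cutoff (Rd d) n y • X y) x) atTop
      (𝓝 (∫ x, u x * divergence X x)) := by
    refine tendsto_integral_of_dominated_convergence
      (fun x => |u x| * (cutoffConst (Rd d) * M + d * M)) (fun n => ?_)
      (hu.abs.mul_const _) (fun n => ?_) ?_
    · refine hu.aestronglyMeasurable.mul (Continuous.aestronglyMeasurable ?_)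
      exact continuous_divergence ((hη n).smul hX)
    · refine Eventually.of_forall fun x => ?_
      rw [hdiv, norm_mul, Real.norm_eq_abs]
      refine mul_le_mul_of_nonneg_left ((norm_add_le _ _).trans (add_le_add ?_ ?_)) (abs_nonneg _)
      · refine ((fderiv ℝ (cutoff (Rd d) n) x).le_opNorm _).trans ?_
        exact mul_le_mul (norm_fderiv_cutoff_le n x) (hM x) (norm_nonneg _) NNReal.zero_le_coe
      · rw [norm_mul, Real.norm_eq_abs, Real.norm_eq_abs]
        refine (mul_le_of_le_one_left (abs_nonneg _) (abs_cutoff_le_one n x)).trans ?_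
        refine (abs_divergence_le X x).trans ?_
        exact mul_le_mul_of_nonneg_left (hM' x) (Nat.cast_nonneg d)
    · refine Eventually.of_forall fun x => ?_
      simp only [hdiv]
      have h1 : Tendsto (fun n => fderiv ℝ (cutoff (Rd d) n) x (X x)) atTop (𝓝 0) := by
        simpa [Function.comp_def] using
          ((ContinuousLinearMap.apply ℝ ℝ (X x)).continuous.tendsto _).comp
            (tendsto_fderiv_cutoff x)
      simpa using (h1.add ((tendsto_cutoff x).mul_const (divergence X x))).const_mul (u x)
  have hlim2 : Tendsto (fun n => ∫ x, inner ℝ (ν x) (cutoff (Rd d) n x • X x) ∂μ) atTop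
      (𝓝 (∫ x, inner ℝ (ν x) (X x) ∂μ)) := by
    refine tendsto_integral_of_dominated_convergence (fun _ => M) (fun n => ?_)
      (integrable_const _) (fun n => ?_) ?_
    · exact h.measurable.aestronglyMeasurable.inner
        ((hη n).continuous.smul hX.continuous).aestronglyMeasurable
    · filter_upwards [h.norm_eq_one] with x hx
      refine (norm_inner_le_norm _ _).trans ?_
      rw [hx, one_mul, norm_smul, Real.norm_eq_abs]
      exact (mul_le_of_le_one_left (norm_nonneg _) (abs_cutoff_le_one n x)).trans (hM x)
    · refine Eventually.of_forall fun x => ?_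
      simp only [inner_smul_right]
      simpa using (tendsto_cutoff x).mul_const (inner ℝ (ν x) (X x))
  simp only [key] at hlim1
  exact tendsto_nhds_unique hlim1 hlim2

/-- The product of a Lipschitz function and a `C¹` field is an admissible test field. -/
theorem IsPolarGradient.integral_lipschitz_smul (h : IsPolarGradient u μ ν)
    (hu : Integrable u) {g : Rd d → ℝ} {K : ℝ≥0} (hg : LipschitzWith K g) {Mg : ℝ}
    (hMg : ∀ x, |g x| ≤ Mg) {X : Rd d → Rd d} (hX : ContDiff ℝ 1 X) {M : ℝ}
    (hM : ∀ x, ‖X x‖ ≤ M) (hM' : ∀ x, ‖fderiv ℝ X x‖ ≤ M) :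
    ∫ x, u x * (fderiv ℝ g x (X x) + g x * divergence X x)
      = ∫ x, g x * inner ℝ (ν x) (X x) ∂μ := by
  have := h.finite
  have hM0 : 0 ≤ M := (norm_nonneg _).trans (hM 0)
  have hMg0 : 0 ≤ Mg := (abs_nonneg _).trans (hMg 0)
  set G := mollify (volume : Measure (Rd d)) g with hG
  have hGc : ∀ n, ContDiff ℝ 1 (G n) := fun n => (contDiff_mollify hg n).of_le (by simp)
  have hGb : ∀ n x, |G n x| ≤ Mg + K := fun n x => by
    have h1 := abs_mollify_sub_le (μ := volume) hg n x
    have h2 : (K : ℝ) * (1 / (n + 1)) ≤ K := by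
      refine mul_le_of_le_one_right K.2 ?_
      rw [div_le_one (by positivity)]; linarith [(Nat.cast_nonneg n : (0 : ℝ) ≤ n)]
    calc |G n x| = |(G n x - g x) + g x| := by ring_nf
      _ ≤ |G n x - g x| + |g x| := abs_add_le _ _
      _ ≤ Mg + K := by linarith [hMg x]
  have hG' : ∀ n x, ‖fderiv ℝ (G n) x‖ ≤ K := fun n x => norm_fderiv_mollify_le hg n x
  have hdiv : ∀ n x, divergence (fun y => G n y • X y) x
      = fderiv ℝ (G n) x (X x) + G n x * divergence X x := fun n x =>
    divergence_smul ((hGc n).differentiable one_ne_zero x) (hX.differentiable one_ne_zero x)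
  have hB1 : ∀ n x, ‖G n x • X x‖ ≤ (Mg + K) * M := fun n x => by
    rw [norm_smul]
    exact mul_le_mul (hGb n x) (hM x) (norm_nonneg _) (by positivity)
  have hB2 : ∀ n x, ‖fderiv ℝ (fun y => G n y • X y) x‖ ≤ (Mg + K) * M + K * M := fun n x => by
    rw [fderiv_fun_smul ((hGc n).differentiable one_ne_zero x)
      (hX.differentiable one_ne_zero x)]
    refine (norm_add_le _ _).trans (add_le_add ?_ ?_)
    · rw [norm_smul]
      exact mul_le_mul (hGb n x) (hM' x) (norm_nonneg _) (by positivity)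
    · rw [ContinuousLinearMap.norm_smulRight_apply]
      exact mul_le_mul (hG' n x) (hM x) (norm_nonneg _) K.2
  have key : ∀ n, ∫ x, u x * divergence (fun y => G n y • X y) x
      = ∫ x, inner ℝ (ν x) (G n x • X x) ∂μ := fun n =>
    h.integral_divergence_of_bounded hu ((hGc n).smul hX) (M := (Mg + K) * M + K * M)
      (fun x => (hB1 n x).trans (le_add_of_nonneg_right (by positivity))) (hB2 n)
  have hlim1 : Tendsto (fun n => ∫ x, u x * divergence (fun y => G n y • X y) x) atTop
      (𝓝 (∫ x, u x * (fderiv ℝ g x (X x) + g x * divergence X x))) := by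
    refine tendsto_integral_of_dominated_convergence
      (fun x => |u x| * (K * M + (Mg + K) * (d * M))) (fun n => ?_)
      (hu.abs.mul_const _) (fun n => ?_) ?_
    · refine hu.aestronglyMeasurable.mul (Continuous.aestronglyMeasurable ?_)
      exact continuous_divergence ((hGc n).smul hX)
    · refine Eventually.of_forall fun x => ?_
      rw [hdiv, norm_mul, Real.norm_eq_abs]
      refine mul_le_mul_of_nonneg_left ((norm_add_le _ _).trans (add_le_add ?_ ?_)) (abs_nonneg _)
      · refine ((fderiv ℝ (G n) x).le_opNorm _).trans ?_
        exact mul_le_mul (hG' n x) (hM x) (norm_nonneg _) K.2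
      · rw [norm_mul, Real.norm_eq_abs, Real.norm_eq_abs]
        refine mul_le_mul (hGb n x) ((abs_divergence_le X x).trans ?_) (abs_nonneg _)
          (by positivity)
        exact mul_le_mul_of_nonneg_left (hM' x) (Nat.cast_nonneg d)
    · filter_upwards [ae_tendsto_fderiv_mollify (μ := volume) hg] with x hx
      simp only [hdiv]
      have h1 : Tendsto (fun n => fderiv ℝ (G n) x (X x)) atTop (𝓝 (fderiv ℝ g x (X x))) :=
        ((ContinuousLinearMap.apply ℝ ℝ (X x)).continuous.tendsto _).comp hx
      exact (h1.add ((tendsto_mollify hg x).mul_const (divergence X x))).const_mul (u x)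
  have hlim2 : Tendsto (fun n => ∫ x, inner ℝ (ν x) (G n x • X x) ∂μ) atTop
      (𝓝 (∫ x, g x * inner ℝ (ν x) (X x) ∂μ)) := by
    refine tendsto_integral_of_dominated_convergence (fun _ => (Mg + K) * M) (fun n => ?_)
      (integrable_const _) (fun n => ?_) ?_
    · exact h.measurable.aestronglyMeasurable.inner
        ((hGc n).continuous.smul hX.continuous).aestronglyMeasurable
    · filter_upwards [h.norm_eq_one] with x hx
      refine (norm_inner_le_norm _ _).trans ?_
      rw [hx, one_mul]
      exact hB1 n x
    · refine Eventually.of_forall fun x => ?_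
      simp only [inner_smul_right]
      exact (tendsto_mollify hg x).mul_const (inner ℝ (ν x) (X x))
  simp only [key] at hlim1
  exact tendsto_nhds_unique hlim1 hlim2

open scoped ContDiff

/-- The field `∂ⱼA eᵢ - ∂ᵢA eⱼ` is divergence free, so the distributional gradient does not
see it. -/
theorem IsPolarGradient.integral_mul_fderiv_comm (h : IsPolarGradient u μ ν)
    {A : Rd d → ℝ} (hA : ContDiff ℝ 1 A) (hc : HasCompactSupport A) (i j : Fin d) :
    ∫ x, ν x i * fderiv ℝ A x (EuclideanSpace.single j 1) ∂μ
      = ∫ x, ν x j * fderiv ℝ A x (EuclideanSpace.single i 1) ∂μ := by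
  have := h.finite
  obtain ⟨K, hK⟩ := hA.lipschitzWith_of_hasCompactSupport hc one_ne_zero
  set e : Fin d → Rd d := fun k => EuclideanSpace.single k 1 with he
  set G := mollify (volume : Measure (Rd d)) A with hG
  have hG2 : ∀ n, ContDiff ℝ 2 (G n) := fun n => (contDiff_mollify hK n).of_le
    (WithTop.coe_le_coe.2 le_top)
  have hGd : ∀ n, ContDiff ℝ 1 (fderiv ℝ (G n)) := fun n => (hG2 n).fderiv_right (by norm_num)
  have hGk : ∀ n k, ContDiff ℝ 1 (fun x => fderiv ℝ (G n) x (e k)) := fun n k =>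
    (hGd n).clm_apply contDiff_const
  have hGs : ∀ n k, HasCompactSupport (fun x => fderiv ℝ (G n) x (e k)) := fun n k =>
    ((hasCompactSupport_mollify hc n).fderiv (𝕜 := ℝ)).comp_left
      (g := fun L : Rd d →L[ℝ] ℝ => L (e k)) rfl
  have hdivk : ∀ n k l x, divergence (fun y => fderiv ℝ (G n) y (e k) • e l) x
      = fderiv ℝ (fderiv ℝ (G n)) x (e l) (e k) := fun n k l x => by
    rw [divergence_smul ((hGk n k).differentiable one_ne_zero x) (differentiableAt_const _)]
    have h0 : divergence (fun _ : Rd d => e l) x = 0 := by simp [divergence]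
    rw [h0, mul_zero, add_zero,
      fderiv_clm_apply ((hGd n).differentiable one_ne_zero x) (differentiableAt_const _)]
    simp
  have hint : ∀ n k l, Integrable
      (fun x => inner ℝ (ν x) (fderiv ℝ (G n) x (e k) • e l)) μ := fun n k l => by
    refine h.integrable_inner (M := K * 1 * 1)
      (((hGk n k).continuous.smul continuous_const).aestronglyMeasurable) fun x => ?_
    rw [norm_smul]
    have h1 : ‖e k‖ = 1 := by simp [he]
    have h2 : ‖e l‖ = 1 := by simp [he]
    rw [h2, mul_one, mul_one, mul_one]
    refine ((fderiv ℝ (G n) x).le_opNorm _).trans ?_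
    rw [h1, mul_one]
    exact norm_fderiv_mollify_le hK n x
  have hinn : ∀ n k l x, inner ℝ (ν x) (fderiv ℝ (G n) x (e k) • e l)
      = ν x l * fderiv ℝ (G n) x (e k) := fun n k l x => by
    rw [inner_smul_right, mul_comm]
    congr 1
    simp [he, EuclideanSpace.inner_single_right]
  have key : ∀ n, ∫ x, ν x i * fderiv ℝ (G n) x (e j) ∂μ
      = ∫ x, ν x j * fderiv ℝ (G n) x (e i) ∂μ := fun n => by
    have h1 := h.integral_divergence (fun x => fderiv ℝ (G n) x (e j) • e i)
      ((hGk n j).smul contDiff_const)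
      (hGs n j).smul_right
    have h2 := h.integral_divergence (fun x => fderiv ℝ (G n) x (e i) • e j)
      ((hGk n i).smul contDiff_const)
      (hGs n i).smul_right
    simp only [hdivk, hinn] at h1 h2
    rw [← h1, ← h2]
    congr 1; ext x; congr 1
    exact ((hG2 n).contDiffAt.isSymmSndFDerivAt (by simp)) (e i) (e j)
  have hlim : ∀ k l, Tendsto (fun n => ∫ x, ν x l * fderiv ℝ (G n) x (e k) ∂μ) atTop
      (𝓝 (∫ x, ν x l * fderiv ℝ A x (e k) ∂μ)) := fun k l => by
    refine tendsto_integral_of_dominated_convergence (fun _ => (K : ℝ)) (fun n => ?_)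
      (integrable_const _) (fun n => ?_) (Eventually.of_forall fun x => ?_)
    · simpa only [hinn] using (hint n k l).aestronglyMeasurable
    · filter_upwards [h.norm_eq_one] with x hx
      rw [norm_mul]
      have h1 : ‖ν x l‖ ≤ 1 := hx ▸ PiLp.norm_apply_le (ν x) l
      have h2 : ‖fderiv ℝ (G n) x (e k)‖ ≤ K := by
        refine ((fderiv ℝ (G n) x).le_opNorm _).trans ?_
        have h1 : ‖e k‖ = 1 := by simp [he]
        rw [h1, mul_one]
        exact norm_fderiv_mollify_le hK n x
      exact (mul_le_mul h1 h2 (norm_nonneg _) zero_le_one).trans_eq (one_mul _)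
    · have h1 := tendsto_fderiv_mollify (μ := volume) hK
        ((hA.continuous_fderiv one_ne_zero).continuousAt (x := x))
      exact (((ContinuousLinearMap.apply ℝ ℝ (e k)).continuous.tendsto _).comp h1).const_mul _
  have h1 := hlim j i
  simp only [key] at h1
  exact tendsto_nhds_unique h1 (hlim i j)

/-- The field `div (X ⊗ Y - Y ⊗ X)` is divergence free; tested against the distributional
gradient this exchanges the two commutator terms for divergences. -/
theorem IsPolarGradient.integral_commutator (h : IsPolarGradient u μ ν)
    {X Y : Rd d → Rd d} (hX : ContDiff ℝ 1 X) (hY : ContDiff ℝ 1 Y) (hc : HasCompactSupport Y) :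
    ∫ x, (inner ℝ (ν x) (fderiv ℝ Y x (X x)) - inner ℝ (ν x) (fderiv ℝ X x (Y x))) ∂μ
      = ∫ x, (inner ℝ (ν x) (X x) * divergence Y x
          - inner ℝ (ν x) (Y x) * divergence X x) ∂μ := by
  have := h.finite
  set e : Fin d → Rd d := fun k => EuclideanSpace.single k 1 with he
  have hXi : ∀ i, ContDiff ℝ 1 (fun x => X x i) := fun i => by fun_prop
  have hYi : ∀ i, ContDiff ℝ 1 (fun x => Y x i) := fun i => by fun_prop
  have hYc : ∀ i, HasCompactSupport (fun x => Y x i) := fun i =>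
    hc.comp_left (g := fun v : Rd d => v i) rfl
  have hA : ∀ i j, ContDiff ℝ 1 (fun x => X x i * Y x j) := fun i j => (hXi i).mul (hYi j)
  have hAc : ∀ i j, HasCompactSupport (fun x => X x i * Y x j) := fun i j => (hYc j).mul_left
  have hint : ∀ i j k l, Integrable
      (fun x => ν x l * fderiv ℝ (fun x => X x i * Y x j) x (e k)) μ := fun i j k l => by
    have hcont : Continuous (fun x => fderiv ℝ (fun x => X x i * Y x j) x (e k)) :=
      ((hA i j).continuous_fderiv one_ne_zero).clm_apply continuous_const
    have hcs : HasCompactSupport (fun x => fderiv ℝ (fun x => X x i * Y x j) x (e k)) :=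
      ((hAc i j).fderiv (𝕜 := ℝ)).comp_left (g := fun L : Rd d →L[ℝ] ℝ => L (e k)) rfl
    refine (hcont.integrable_of_hasCompactSupport hcs).bdd_mul (c := 1) ?_ ?_
    · have := h.measurable
      exact (show Measurable (fun x => ν x l) by fun_prop).aestronglyMeasurable
    · filter_upwards [h.norm_eq_one] with x hx
      exact hx ▸ PiLp.norm_apply_le (ν x) l
  have hexp : ∀ i j k x, fderiv ℝ (fun x => X x i * Y x j) x (e k)
      = X x i * (fderiv ℝ Y x (e k)) j + Y x j * (fderiv ℝ X x (e k)) i := fun i j k x => by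
    rw [fderiv_fun_mul ((hXi i).differentiable one_ne_zero x) ((hYi j).differentiable one_ne_zero x)]
    simp [fderiv_coord_apply (hX.differentiable one_ne_zero x),
      fderiv_coord_apply (hY.differentiable one_ne_zero x)]
  have hsum : ∑ i, ∑ j, ∫ x, ν x i * fderiv ℝ (fun x => X x i * Y x j) x (e j) ∂μ
      = ∑ i, ∑ j, ∫ x, ν x j * fderiv ℝ (fun x => X x i * Y x j) x (e i) ∂μ :=
    Finset.sum_congr rfl fun i _ => Finset.sum_congr rfl fun j _ =>
      h.integral_mul_fderiv_comm (hA i j) (hAc i j) i j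
  have hvec : ∀ v : Rd d, v = ∑ i, v i • e i := fun v => by
    conv_lhs => rw [← (EuclideanSpace.basisFun (Fin d) ℝ).sum_repr v]
    simp [he]
  have hD : ∀ (L : Rd d →L[ℝ] Rd d) (v w : Rd d),
      inner ℝ w (L v) = ∑ i, ∑ j, w i * (v j * (L (e j)) i) := fun L v w => by
    conv_lhs => rw [hvec v, map_sum]
    simp only [PiLp.inner_apply, map_smul, WithLp.ofLp_sum, WithLp.ofLp_smul, Finset.sum_apply,
      Pi.smul_apply, smul_eq_mul, RCLike.inner_apply, conj_trivial, Finset.sum_mul]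
    refine Finset.sum_congr rfl fun i _ => Finset.sum_congr rfl fun j _ => by ring
  have hinn : ∀ v w : Rd d, inner ℝ w v = ∑ i, w i * v i := fun v w => by
    simp [PiLp.inner_apply, mul_comm]
  have hL : ∀ x, ∑ i, ∑ j, ν x i * fderiv ℝ (fun x => X x i * Y x j) x (e j)
      = inner ℝ (ν x) (fderiv ℝ X x (Y x)) + inner ℝ (ν x) (X x) * divergence Y x := fun x => by
    rw [hD, hinn, divergence, Finset.sum_mul_sum, ← Finset.sum_add_distrib]
    refine Finset.sum_congr rfl fun i _ => ?_
    rw [← Finset.sum_add_distrib]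
    refine Finset.sum_congr rfl fun j _ => ?_
    rw [hexp]; ring
  have hR : ∀ x, ∑ i, ∑ j, ν x j * fderiv ℝ (fun x => X x i * Y x j) x (e i)
      = inner ℝ (ν x) (fderiv ℝ Y x (X x)) + inner ℝ (ν x) (Y x) * divergence X x := fun x => by
    rw [hD, hinn, divergence, Finset.sum_mul_sum, ← Finset.sum_add_distrib, Finset.sum_comm]
    refine Finset.sum_congr rfl fun i _ => ?_
    rw [← Finset.sum_add_distrib]
    refine Finset.sum_congr rfl fun j _ => ?_
    rw [hexp]; ring
  have hI : ∀ (k l : Fin d → Fin d → Fin d), Integrable (fun x => ∑ i, ∑ j,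
      ν x (l i j) * fderiv ℝ (fun x => X x i * Y x j) x (e (k i j))) μ := fun k l =>
    integrable_finsetSum _ fun i _ => integrable_finsetSum _ fun j _ => hint i j _ _
  have hIL := hI (fun i j => j) (fun i j => i)
  have hIR := hI (fun i j => i) (fun i j => j)
  have hIS : ∀ (k l : Fin d → Fin d → Fin d), ∫ x, (∑ i, ∑ j,
      ν x (l i j) * fderiv ℝ (fun x => X x i * Y x j) x (e (k i j))) ∂μ
      = ∑ i, ∑ j, ∫ x, ν x (l i j) * fderiv ℝ (fun x => X x i * Y x j) x (e (k i j)) ∂μ := by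
    intro k l
    rw [integral_finsetSum _ fun i _ => integrable_finsetSum _ fun j _ =>
      hint i j (k i j) (l i j)]
    exact Finset.sum_congr rfl fun i _ => integral_finsetSum _ fun j _ => hint i j _ _
  have hzero : ∫ x, (∑ i, ∑ j, ν x j * fderiv ℝ (fun x => X x i * Y x j) x (e i)
      - ∑ i, ∑ j, ν x i * fderiv ℝ (fun x => X x i * Y x j) x (e j)) ∂μ = 0 := by
    rw [integral_sub hIR hIL, hIS (fun i j => i) (fun i j => j), hIS (fun i j => j) (fun i j => i),
      hsum, sub_self]
  simp only [hL, hR] at hzero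
  have hbd : ∀ Z : Rd d → Rd d, Continuous Z → HasCompactSupport Z →
      Integrable (fun x => inner ℝ (ν x) (Z x)) μ := fun Z hZ hZc => by
    obtain ⟨M, hM⟩ := hZc.exists_bound_of_continuous hZ
    exact h.integrable_inner hZ.aestronglyMeasurable hM
  have hI1 : Integrable (fun x => inner ℝ (ν x) (fderiv ℝ Y x (X x))
      - inner ℝ (ν x) (fderiv ℝ X x (Y x))) μ := by
    refine (hbd _ ((hY.continuous_fderiv one_ne_zero).clm_apply hX.continuous) ?_).sub
      (hbd _ ((hX.continuous_fderiv one_ne_zero).clm_apply hY.continuous) ?_)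
    · refine (hc.fderiv (𝕜 := ℝ)).mono' fun x hx => subset_tsupport _ ?_
      rw [Function.mem_support] at hx ⊢
      rintro h0; exact hx (by rw [h0]; rfl)
    · refine hc.mono' fun x hx => subset_tsupport _ ?_
      rw [Function.mem_support] at hx ⊢
      rintro h0; exact hx (by rw [h0, map_zero])
  have hI2 : Integrable (fun x => inner ℝ (ν x) (X x) * divergence Y x
      - inner ℝ (ν x) (Y x) * divergence X x) μ := by
    have h1 := hbd (fun x => divergence Y x • X x)
      ((continuous_divergence hY).smul hX.continuous) (by
        refine (hc.fderiv (𝕜 := ℝ)).mono' fun x hx => subset_tsupport _ ?_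
        rw [Function.mem_support] at hx ⊢
        rintro h0; exact hx (by simp [divergence, h0]))
    have h2 := hbd (fun x => divergence X x • Y x)
      ((continuous_divergence hX).smul hY.continuous) (hc.smul_left (f := divergence X))
    refine (h1.sub h2).congr (Eventually.of_forall fun x => ?_)
    simp only [Pi.sub_apply, inner_smul_right]
    ring
  rw [← sub_eq_zero, ← integral_sub hI1 hI2, ← hzero]
  congr 1; ext x; ring

end BV

/-! ### Countable families of test fields and the total variation -/

section TestFields

open scoped ContDiff Manifold

variable {d : ℕ} {u : Rd d → ℝ} {μ μ' : Measure (Rd d)} {ν ν' : Rd d → Rd d}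

/-- Any set of `C¹` fields is separable for local uniform convergence of the fields and of their
derivatives. -/
theorem exists_countable_dense_C1 (S : Set (Rd d → Rd d)) (hS : ∀ X ∈ S, ContDiff ℝ 1 X) :
    ∃ D ⊆ S, D.Countable ∧ ∀ X ∈ S, ∃ Y : ℕ → Rd d → Rd d, (∀ n, Y n ∈ D) ∧
      TendstoLocallyUniformly Y X atTop ∧
      TendstoLocallyUniformly (fun n => fderiv ℝ (Y n)) (fderiv ℝ X) atTop := by
  have : ProperSpace (Rd d →L[ℝ] Rd d) := FiniteDimensional.proper ℝ _
  let J : S → C(Rd d, Rd d × (Rd d →L[ℝ] Rd d)) := fun X =>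
    ⟨fun x => (X.1 x, fderiv ℝ X.1 x),
      (hS X.1 X.2).continuous.prodMk ((hS X.1 X.2).continuous_fderiv one_ne_zero)⟩
  let τ : TopologicalSpace S := TopologicalSpace.induced J inferInstance
  have : SecondCountableTopology S := TopologicalSpace.secondCountableTopology_induced _ _ J
  obtain ⟨c, hc, hcd⟩ := TopologicalSpace.exists_countable_dense S
  refine ⟨Subtype.val '' c, ?_, hc.image _, fun X hX => ?_⟩
  · rintro _ ⟨X, -, rfl⟩; exact X.2
  · obtain ⟨y, hyc, hy⟩ := mem_closure_iff_seq_limit.1 (hcd ⟨X, hX⟩)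
    have hJ := ContinuousMap.tendsto_iff_tendstoLocallyUniformly.1
      ((continuous_induced_dom.tendsto _).comp hy)
    exact ⟨fun n => (y n).1, fun n => mem_image_of_mem _ (hyc n),
      uniformContinuous_fst.comp_tendstoLocallyUniformly hJ,
      uniformContinuous_snd.comp_tendstoLocallyUniformly hJ⟩

/-- A smooth function with values in `[0, 1]`, compactly supported in the open set `U`, which is
`1` on the compact set `K`. -/
theorem exists_smooth_one_on_compact {K U : Set (Rd d)} (hK : IsCompact K) (hU : IsOpen U)
    (hKU : K ⊆ U) : ∃ η : Rd d → ℝ, ContDiff ℝ ∞ η ∧ HasCompactSupport η ∧ tsupport η ⊆ U ∧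
      (∀ x ∈ K, η x = 1) ∧ ∀ x, η x ∈ Icc (0 : ℝ) 1 := by
  obtain ⟨V, hV, hKV, hVU, hVc⟩ := exists_open_between_and_isCompact_closure hK hU hKU
  obtain ⟨f, hf0, hf1, hf⟩ := exists_contMDiffMap_zero_one_of_isClosed (𝓘(ℝ, Rd d)) (n := ⊤)
    hV.isClosed_compl hK.isClosed (disjoint_left.2 fun x hx hxK => hx (hKV hxK))
  have hsupp : tsupport f ⊆ closure V := closure_mono fun x hx => by
    by_contra hxV
    exact hx (hf0 hxV)
  exact ⟨f, f.contMDiff.contDiff, hVc.of_isClosed_subset (isClosed_tsupport _) hsupp,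
    hsupp.trans hVU, fun x hx => hf1 hx, hf⟩

/-- The admissible fields in the variational characterization of the total variation. -/
def testFields (U : Set (Rd d)) : Set (Rd d → Rd d) :=
  {φ | ContDiff ℝ 1 φ ∧ HasCompactSupport φ ∧ tsupport φ ⊆ U ∧ ∀ x, ‖φ x‖ ≤ 1}

/-- The total variation of an open set is almost attained by an admissible field: approximate `ν`
in `L¹(μ)` by a continuous field, project it to the unit ball, smooth it, and cut it off. -/
theorem IsPolarGradient.exists_testField (h : IsPolarGradient u μ ν) {U : Set (Rd d)}
    (hU : IsOpen U) {ε : ℝ} (hε : 0 < ε) :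
    ∃ φ ∈ testFields U, μ.real U - ε ≤ ∫ x, inner ℝ (ν x) (φ x) ∂μ := by
  have := h.finite
  set δ : ℝ := ε / (3 + 2 * μ.real univ) with hδdef
  have hμ0 : 0 ≤ μ.real univ := measureReal_nonneg
  have hδ : 0 < δ := by positivity
  obtain ⟨K, hKU, hK, hμK⟩ : ∃ K ⊆ U, IsCompact K ∧ μ.real U - δ ≤ μ.real K := by
    by_cases h0 : μ U = 0
    · refine ⟨∅, empty_subset _, isCompact_empty, ?_⟩
      simp [measureReal_def, h0, hδ.le]
    · have hlt : μ U - ENNReal.ofReal δ < μ U :=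
        ENNReal.sub_lt_self (measure_ne_top _ _) h0 (by simpa using hδ)
      obtain ⟨K, hKU, hK, hlt'⟩ := hU.exists_lt_isCompact hlt
      refine ⟨K, hKU, hK, ?_⟩
      have h1 : μ U ≤ μ K + ENNReal.ofReal δ := tsub_le_iff_right.1 hlt'.le
      have h2 := ENNReal.toReal_mono (by finiteness) h1
      rw [ENNReal.toReal_add (measure_ne_top _ _) (by finiteness),
        ENNReal.toReal_ofReal hδ.le] at h2
      simp only [measureReal_def]; linarith
  obtain ⟨η, hη, hηc, hηU, hη1, hη01⟩ := exists_smooth_one_on_compact hK hU hKU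
  have hν : Integrable ν μ := Integrable.of_bound h.measurable.aestronglyMeasurable 1
    (h.norm_eq_one.mono fun x hx => hx.le)
  obtain ⟨g, hgc, hgν, hg, hgi⟩ := hν.exists_hasCompactSupport_integral_sub_le hδ
  -- the radial projection of `g` to the unit ball
  set p : Rd d → Rd d := fun x => (max 1 ‖g x‖)⁻¹ • g x with hp
  have hmax : ∀ x, 0 < max 1 ‖g x‖ := fun x => lt_max_of_lt_left one_pos
  have hpc : Continuous p := ((continuous_const.max hg.norm).inv₀ fun x => (hmax x).ne').smul hg
  have hp1 : ∀ x, ‖p x‖ ≤ 1 := fun x => by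
    rw [hp, norm_smul, norm_inv, Real.norm_of_nonneg (hmax x).le, inv_mul_le_iff₀ (hmax x), mul_one]
    exact le_max_right _ _
  have hpu : UniformContinuous p :=
    (hgc.smul_left (f := fun x => (max 1 ‖g x‖)⁻¹)).uniformContinuous_of_continuous hpc
  obtain ⟨s, hs, hsp⟩ := hpu.exists_contDiff_dist_le hδ
  have hs1 : ∀ x, ‖s x‖ ≤ 1 + δ := fun x => by
    have h1 := hsp x
    rw [dist_eq_norm] at h1
    linarith [norm_le_norm_add_norm_sub' (s x) (p x), hp1 x]
  have hη' : ContDiff ℝ 1 η := hη.of_le (by simp)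
  have hs' : ContDiff ℝ 1 s := hs.of_le (by simp)
  have hφc : ContDiff ℝ 1 (fun x => η x • (1 + δ)⁻¹ • s x) := by fun_prop
  have hφs : HasCompactSupport (fun x => η x • (1 + δ)⁻¹ • s x) :=
    hηc.smul_right (f' := fun x => (1 + δ)⁻¹ • s x)
  have hφ1 : ∀ x, ‖η x • (1 + δ)⁻¹ • s x‖ ≤ 1 := fun x => by
    rw [norm_smul, norm_smul, Real.norm_of_nonneg (hη01 x).1, norm_inv,
      Real.norm_of_nonneg (by positivity : (0:ℝ) ≤ 1 + δ)]
    have : (1 + δ)⁻¹ * ‖s x‖ ≤ 1 := by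
      rw [inv_mul_le_iff₀ (by positivity), mul_one]; exact hs1 x
    exact mul_le_one₀ (hη01 x).2 (by positivity) this
  refine ⟨_, ⟨hφc, hφs, (tsupport_smul_subset_left η _).trans hηU, hφ1⟩, ?_⟩
  have hlow : ∀ᵐ x ∂μ, η x - 2 * ‖ν x - g x‖ - 2 * δ
      ≤ inner ℝ (ν x) (η x • (1 + δ)⁻¹ • s x) := by
    filter_upwards [h.norm_eq_one] with x hx
    have h1 : ‖p x - g x‖ ≤ ‖ν x - g x‖ := by
      have e1 : p x - g x = ((max 1 ‖g x‖)⁻¹ - 1) • g x := by rw [hp, sub_smul, one_smul]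
      have e2 : 1 - ‖g x‖ ≥ -‖ν x - g x‖ := by
        have := norm_le_norm_add_norm_sub' (g x) (ν x)
        rw [hx, norm_sub_rev] at this; linarith
      rw [e1, norm_smul, Real.norm_eq_abs]
      rcases le_total ‖g x‖ 1 with hle | hle
      · rw [max_eq_left hle]; simp
      · rw [max_eq_right hle, abs_sub_comm, abs_of_nonneg (sub_nonneg.2 (inv_le_one_of_one_le₀ hle)),
          sub_mul, one_mul, inv_mul_cancel₀ (by positivity)]
        linarith
    have h2 : ‖ν x - s x‖ ≤ 2 * ‖ν x - g x‖ + δ := by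
      have e1 : ν x - s x = (ν x - g x) - (p x - g x) - (s x - p x) := by abel
      have e2 := hsp x
      rw [dist_eq_norm] at e2
      rw [e1]
      refine (norm_sub_le _ _).trans ?_
      linarith [norm_sub_le (ν x - g x) (p x - g x)]
    have h3 : 1 - ‖ν x - s x‖ ≤ inner ℝ (ν x) (s x) := by
      have e1 : inner ℝ (ν x) (s x) = 1 - inner ℝ (ν x) (ν x - s x) := by
        rw [inner_sub_right, real_inner_self_eq_norm_sq, hx]; ring
      have e2 := real_inner_le_norm (ν x) (ν x - s x)
      rw [hx, one_mul] at e2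
      linarith
    rw [inner_smul_right, inner_smul_right]
    have h4 : 1 - δ ≤ (1 + δ)⁻¹ := by
      rw [← one_div, le_div_iff₀ (by positivity)]; nlinarith
    have h5 : (1 + δ)⁻¹ ≤ 1 := inv_le_one_of_one_le₀ (by linarith)
    have h6 : 0 ≤ (1 + δ)⁻¹ := by positivity
    obtain ⟨h7, h8⟩ := hη01 x
    set r := 2 * ‖ν x - g x‖ + δ with hr
    have hr0 : 0 ≤ r := by positivity
    have h9 : 1 - δ - r ≤ (1 + δ)⁻¹ * inner ℝ (ν x) (s x) := by
      have : (1 + δ)⁻¹ * (1 - r) ≤ (1 + δ)⁻¹ * inner ℝ (ν x) (s x) :=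
        mul_le_mul_of_nonneg_left (by linarith) h6
      have : (1 + δ)⁻¹ * r ≤ r := mul_le_of_le_one_left hr0 h5
      linarith
    have h10 : η x * (1 - δ - r) ≤ η x * ((1 + δ)⁻¹ * inner ℝ (ν x) (s x)) :=
      mul_le_mul_of_nonneg_left h9 h7
    have h11 : η x * (δ + r) ≤ δ + r := mul_le_of_le_one_left (by positivity) h8
    linarith
  have hηi : Integrable η μ := hη.continuous.integrable_of_hasCompactSupport hηc
  have hνg : Integrable (fun x => ‖ν x - g x‖) μ := (hν.sub hgi).norm
  have hi1 : Integrable (fun x => η x - 2 * ‖ν x - g x‖) μ := hηi.sub (hνg.const_mul 2)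
  have hi2 : Integrable (fun x => η x - 2 * ‖ν x - g x‖ - 2 * δ) μ :=
    hi1.sub (integrable_const (2 * δ))
  have hle := integral_mono_ae hi2
    (h.integrable_inner hφc.continuous.aestronglyMeasurable hφ1) hlow
  rw [integral_sub hi1 (integrable_const _), integral_sub hηi (hνg.const_mul 2),
    integral_const_mul, integral_const, smul_eq_mul] at hle
  have hηK : μ.real K ≤ ∫ x, η x ∂μ := by
    rw [← integral_indicator_one hK.measurableSet]
    refine integral_mono ((integrable_const (1 : ℝ)).indicator hK.measurableSet) hηi fun x => ?_
    by_cases hx : x ∈ K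
    · simp [hx, hη1 x hx]
    · simpa [hx] using (hη01 x).1
  have hδε : δ * (3 + 2 * μ.real univ) = ε := div_mul_cancel₀ _ (by positivity)
  linarith

/-- The total variation of an open set is a countable supremum of integrals of `u` itself. -/
theorem exists_countable_testFields {U : Set (Rd d)} (hU : IsOpen U) :
    ∃ D ⊆ testFields U, D.Countable ∧ ∀ (u : Rd d → ℝ) (μ : Measure (Rd d)) (ν : Rd d → Rd d),
      IsPolarGradient u μ ν →
        μ U = ⨆ φ ∈ D, ENNReal.ofReal (∫ x, u x * divergence φ x) := by
  obtain ⟨D, hDS, hD, hDd⟩ := exists_countable_dense_C1 (testFields U) fun X hX => hX.1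
  refine ⟨D, hDS, hD, fun u μ ν h => le_antisymm ?_ (iSup₂_le fun φ hφ => ?_)⟩
  · have := h.finite
    refine ENNReal.le_of_forall_pos_le_add fun ε hε _ => ?_
    obtain ⟨φ, hφ, hle⟩ := h.exists_testField hU (half_pos (NNReal.coe_pos.2 hε))
    obtain ⟨Y, hY, hYφ, -⟩ := hDd φ hφ
    have hlim : Tendsto (fun n => ∫ x, inner ℝ (ν x) (Y n x) ∂μ) atTop
        (𝓝 (∫ x, inner ℝ (ν x) (φ x) ∂μ)) := by
      refine tendsto_integral_of_dominated_convergence (fun _ => 1) (fun n => ?_)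
        (integrable_const _) (fun n => ?_) (Eventually.of_forall fun x => ?_)
      · exact h.measurable.aestronglyMeasurable.inner
          (hDS (hY n)).1.continuous.aestronglyMeasurable
      · filter_upwards [h.norm_eq_one] with x hx
        refine (norm_inner_le_norm _ _).trans ?_
        rw [hx, one_mul]; exact (hDS (hY n)).2.2.2 x
      · exact (continuous_const.inner continuous_id).continuousAt.tendsto.comp
          ((tendstoLocallyUniformlyOn_univ.2 hYφ).tendsto_at (mem_univ x))
    obtain ⟨n, hn⟩ := (hlim.eventually (lt_mem_nhds (sub_lt_self _
      (half_pos (NNReal.coe_pos.2 hε))))).exists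
    have h1 : μ.real U ≤ (∫ x, u x * divergence (Y n) x) + ε := by
      rw [h.integral_divergence _ (hDS (hY n)).1 (hDS (hY n)).2.1]
      linarith
    calc μ U = ENNReal.ofReal (μ.real U) := (ofReal_measureReal).symm
      _ ≤ ENNReal.ofReal ((∫ x, u x * divergence (Y n) x) + ε) := ENNReal.ofReal_le_ofReal h1
      _ ≤ ENNReal.ofReal (∫ x, u x * divergence (Y n) x) + ε := by
        refine ENNReal.ofReal_add_le.trans ?_
        rw [ENNReal.ofReal_coe_nnreal]
      _ ≤ _ := by gcongr; exact le_iSup₂_of_le (Y n) (hY n) le_rfl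
  · have := h.finite
    obtain ⟨hφ1, hφc, hφU, hφb⟩ := hDS hφ
    rw [h.integral_divergence _ hφ1 hφc, ← ofReal_measureReal (μ := μ) (s := U)]
    refine ENNReal.ofReal_le_ofReal ?_
    rw [← integral_indicator_one hU.measurableSet]
    refine integral_mono_ae (h.integrable_inner hφ1.continuous.aestronglyMeasurable hφb)
      ((integrable_const (1 : ℝ)).indicator hU.measurableSet) ?_
    filter_upwards [h.norm_eq_one] with x hx
    by_cases hxU : x ∈ U
    · simp only [indicator_of_mem hxU]
      refine (real_inner_le_norm _ _).trans ?_
      rw [hx, one_mul]; exact hφb x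
    · have : φ x = 0 := image_eq_zero_of_notMem_tsupport fun hx' => hxU (hφU hx')
      simp [hxU, this]

/-- The polar decomposition of the distributional gradient is unique. -/
theorem IsPolarGradient.unique (h : IsPolarGradient u μ ν) (h' : IsPolarGradient u μ' ν') :
    μ = μ' ∧ ν =ᵐ[μ] ν' := by
  have := h.finite
  have := h'.finite
  have hμ : μ = μ' := by
    refine Measure.OuterRegular.ext_isOpen fun U hU => ?_
    obtain ⟨D, -, -, hD⟩ := exists_countable_testFields hU
    rw [hD u μ ν h, hD u μ' ν' h']
  subst hμ
  refine ⟨rfl, ?_⟩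
  have hν : Integrable ν μ := Integrable.of_bound h.measurable.aestronglyMeasurable 1
    (h.norm_eq_one.mono fun x hx => hx.le)
  have hν' : Integrable ν' μ := Integrable.of_bound h'.measurable.aestronglyMeasurable 1
    (h'.norm_eq_one.mono fun x hx => hx.le)
  refine ae_eq_of_integral_contDiff_smul_eq hν.locallyIntegrable hν'.locallyIntegrable
    fun g hg hgc => ext_inner_left ℝ fun v => ?_
  have hgb := hgc.exists_bound_of_continuous hg.continuous
  obtain ⟨M, hM⟩ := hgb
  have hi : ∀ w : Rd d → Rd d, Integrable w μ → Integrable (fun x => g x • w x) μ := fun w hw =>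
    hw.bdd_smul M hg.continuous.aestronglyMeasurable (Eventually.of_forall hM)
  have e1 := h.integral_divergence (fun x => g x • v)
    ((hg.of_le (by simp)).smul contDiff_const) hgc.smul_right
  have e2 := h'.integral_divergence (fun x => g x • v)
    ((hg.of_le (by simp)).smul contDiff_const) hgc.smul_right
  rw [← integral_inner (hi _ hν), ← integral_inner (hi _ hν')]
  rw [e1] at e2
  simpa only [inner_smul_right, real_inner_comm] using e2

end TestFields

/-! ### Flat charts of a hypersurface -/

section FlatCharts

variable {d : ℕ} {Ω U : Set (Rd d)} {φ : Rd d → ℝ} {e : Rd d} {ε : ℝ}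

/-- In the convex open set `U` the set `Ω` is the sublevel set `{φ < 0}`, and the gradient of `φ`
is, up to the relative error `ε`, a positive multiple of the unit vector `e`. -/
structure IsFlatChart (Ω U : Set (Rd d)) (φ : Rd d → ℝ) (e : Rd d) (ε : ℝ) : Prop where
  isOpen : IsOpen U
  convex : Convex ℝ U
  contDiff : ContDiff ℝ 1 φ
  norm_eq_one : ‖e‖ = 1
  mem_iff : ∀ y ∈ U, (y ∈ Ω ↔ φ y < 0)
  deriv_pos : ∀ y ∈ U, 0 < fderiv ℝ φ y e
  slope : ∀ y ∈ U, ∀ τ, |fderiv ℝ φ y τ - inner ℝ e τ * fderiv ℝ φ y e|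
    ≤ ε * ‖τ‖ * fderiv ℝ φ y e

theorem IsExteriorUnitNormal.norm_eq_one {x n : Rd d} (h : IsExteriorUnitNormal Ω x n) :
    ‖n‖ = 1 := by
  obtain ⟨φ, ⟨-, hφ, -⟩, rfl⟩ := h
  rw [norm_smul, norm_inv, norm_norm, inv_mul_cancel₀ (norm_ne_zero_iff.2 hφ)]

/-- By continuity of the gradient of a defining function, all small balls around a boundary point
are flat charts. -/
theorem IsExteriorUnitNormal.exists_flatChart {x n : Rd d} (h : IsExteriorUnitNormal Ω x n)
    (hε : 0 < ε) (hε1 : ε ≤ 1) :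
    ∃ φ, ∀ᶠ r in 𝓝[>] (0 : ℝ), IsFlatChart Ω (Metric.ball x r) φ n ε := by
  have hn := h.norm_eq_one
  obtain ⟨φ, ⟨hφ, hφ0, hφΩ⟩, rfl⟩ := h
  set a := ‖gradient φ x‖ with ha
  have ha0 : 0 < a := norm_pos_iff.2 hφ0
  set e := a⁻¹ • gradient φ x with he
  have hx : ∀ τ, fderiv ℝ φ x τ = a * inner ℝ e τ := fun τ => by
    rw [he, real_inner_smul_left, mul_inv_cancel_left₀ ha0.ne', gradient,
      InnerProductSpace.toDual_symm_apply]
  have hclose : ∀ᶠ y in 𝓝 x, ‖fderiv ℝ φ y - fderiv ℝ φ x‖ < ε / 4 * a := by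
    have := (hφ.continuous_fderiv one_ne_zero).continuousAt (x := x)
    filter_upwards [Metric.tendsto_nhds.1 this.tendsto (ε / 4 * a) (by positivity)] with y hy
    rwa [dist_eq_norm] at hy
  obtain ⟨r, hr, hball⟩ := Metric.eventually_nhds_iff_ball.1 (hφΩ.and hclose)
  refine ⟨φ, ?_⟩
  filter_upwards [Ioc_mem_nhdsGT hr] with s hs
  have hd : ∀ y ∈ Metric.ball x s, ∀ τ, |fderiv ℝ φ y τ - a * inner ℝ e τ| ≤ ε / 4 * a * ‖τ‖ :=
    fun y hy τ => by
      have h1 := (hball y (Metric.ball_subset_ball hs.2 hy)).2.le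
      rw [← hx, ← Real.norm_eq_abs]
      exact ((fderiv ℝ φ y - fderiv ℝ φ x).le_opNorm τ).trans
        (mul_le_mul_of_nonneg_right h1 (norm_nonneg _))
  have hde : ∀ y ∈ Metric.ball x s, |fderiv ℝ φ y e - a| ≤ ε / 4 * a := fun y hy => by
    have := hd y hy e
    rwa [real_inner_self_eq_norm_sq, hn, one_pow, mul_one, mul_one] at this
  refine ⟨Metric.isOpen_ball, convex_ball x s, hφ, hn,
    fun y hy => (hball y (Metric.ball_subset_ball hs.2 hy)).1, fun y hy => ?_, fun y hy τ => ?_⟩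
  · have := (abs_le.1 (hde y hy)).1
    nlinarith
  · have h1 := hd y hy τ
    have h2 := hde y hy
    have h3 : |inner ℝ e τ| ≤ ‖τ‖ := (abs_real_inner_le_norm e τ).trans (by rw [hn, one_mul])
    have h4 : a * (1 - ε / 4) ≤ fderiv ℝ φ y e := by linarith [(abs_le.1 h2).1]
    have h5 : |fderiv ℝ φ y τ - inner ℝ e τ * fderiv ℝ φ y e| ≤ ε / 2 * a * ‖τ‖ := by
      have e1 : fderiv ℝ φ y τ - inner ℝ e τ * fderiv ℝ φ y e
          = (fderiv ℝ φ y τ - a * inner ℝ e τ) - inner ℝ e τ * (fderiv ℝ φ y e - a) := by ring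
      rw [e1]
      refine (abs_sub _ _).trans ?_
      rw [abs_mul]
      have := mul_le_mul h3 h2 (abs_nonneg _) (norm_nonneg τ)
      linarith
    refine h5.trans ?_
    have h6 : a / 2 ≤ fderiv ℝ φ y e := by nlinarith
    have : ε * ‖τ‖ * (a / 2) ≤ ε * ‖τ‖ * fderiv ℝ φ y e :=
      mul_le_mul_of_nonneg_left h6 (by positivity)
    linarith

namespace IsFlatChart

variable (h : IsFlatChart Ω U φ e ε)
include h

theorem hasDerivAt_line (w : Rd d) (s : ℝ) :
    HasDerivAt (fun s : ℝ => φ (s • e + w)) (fderiv ℝ φ (s • e + w) e) s := by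
  have h1 : HasDerivAt (fun s : ℝ => s • e + w) e s := by
    simpa using ((hasDerivAt_id s).smul_const e).add_const w
  exact ((h.contDiff.differentiable one_ne_zero _).hasFDerivAt).comp_hasDerivAt s h1

theorem convex_line (w : Rd d) : Convex ℝ {s : ℝ | s • e + w ∈ U} := by
  intro s hs t ht a b ha hb hab
  have := h.convex hs ht ha hb hab
  have e1 : a • (s • e + w) + b • (t • e + w) = (a • s + b • t) • e + w := by
    rw [smul_add, smul_add, add_smul, smul_assoc, smul_assoc]
    have : w = a • w + b • w := by rw [← add_smul, hab, one_smul]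
    nth_rewrite 3 [this]; abel
  rwa [e1] at this

theorem strictMonoOn_line (w : Rd d) :
    StrictMonoOn (fun s : ℝ => φ (s • e + w)) {s | s • e + w ∈ U} := by
  refine strictMonoOn_of_deriv_pos (h.convex_line w)
    (fun s _ => (h.hasDerivAt_line w s).continuousAt.continuousWithinAt) fun s hs => ?_
  rw [(h.hasDerivAt_line w s).deriv]
  exact h.deriv_pos _ (interior_subset (s := {s : ℝ | s • e + w ∈ U}) hs)

theorem mem_frontier_iff {y : Rd d} (hy : y ∈ U) : y ∈ frontier Ω ↔ φ y = 0 := by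
  have hU : ∀ᶠ z in 𝓝 y, z ∈ U := h.isOpen.mem_nhds hy
  have hφc := h.contDiff.continuous.continuousAt (x := y)
  constructor
  · intro hf
    by_contra hne
    rcases lt_or_gt_of_ne hne with hlt | hgt
    · refine hf.2 (mem_interior_iff_mem_nhds.2 ?_)
      filter_upwards [hU, hφc.eventually (gt_mem_nhds hlt)] with z hz hz'
      exact (h.mem_iff z hz).2 hz'
    · refine (mem_closure_iff_frequently.1 hf.1) ?_
      filter_upwards [hU, hφc.eventually (lt_mem_nhds hgt)] with z hz hz' hzΩ
      exact lt_asymm hz' ((h.mem_iff z hz).1 hzΩ)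
  · intro h0
    have hyΩ : y ∉ Ω := fun hyΩ => by
      have := (h.mem_iff y hy).1 hyΩ
      linarith
    refine ⟨mem_closure_iff_frequently.2 ?_, fun hi => hyΩ (interior_subset hi)⟩
    have hcont : Tendsto (fun s : ℝ => s • e + y) (𝓝[<] 0) (𝓝 y) := by
      have : Continuous (fun s : ℝ => s • e + y) := by fun_prop
      have := this.tendsto 0
      rw [zero_smul, zero_add] at this
      exact this.mono_left nhdsWithin_le_nhds
    refine hcont.frequently (Eventually.frequently ?_)
    filter_upwards [hcont.eventually hU, self_mem_nhdsWithin] with s hs hs0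
    refine (h.mem_iff _ hs).2 ?_
    have := h.strictMonoOn_line y hs (show (0 : ℝ) • e + y ∈ U by simpa using hy) hs0
    simpa [h0] using this

/-- The surface is a Lipschitz graph over `e^⊥`: the distance of two of its points is controlled by
the component `p` of their difference that is orthogonal to `e`. -/
theorem norm_sub_le_of_zero (hε1 : ε < 1) {y z : Rd d} (hy : y ∈ U) (hz : z ∈ U)
    (hy0 : φ y = 0) (hz0 : φ z = 0) {p : Rd d} (hp : y - z = inner ℝ e (y - z) • e + p) :
    ‖y - z‖ ≤ (1 - ε)⁻¹ * ‖p‖ := by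
  obtain ⟨w, hw, hw'⟩ := domain_mvt (f := φ) (s := U)
    (f' := fun x => fderiv ℝ φ x)
    (fun x _ => (h.contDiff.differentiable one_ne_zero x).hasFDerivAt.hasFDerivWithinAt)
    h.convex hz hy
  rw [hy0, hz0, sub_self] at hw'
  have hwU : w ∈ U := h.convex.segment_subset hz hy hw
  have h1 := h.slope w hwU (y - z)
  rw [← hw', zero_sub, abs_neg, abs_mul, abs_of_pos (h.deriv_pos w hwU)] at h1
  have h2 : |inner ℝ e (y - z)| ≤ ε * ‖y - z‖ := le_of_mul_le_mul_right h1 (h.deriv_pos w hwU)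
  have h3 : ‖y - z‖ ≤ |inner ℝ e (y - z)| + ‖p‖ := by
    conv_lhs => rw [hp]
    refine (norm_add_le _ _).trans ?_
    rw [norm_smul, h.norm_eq_one, mul_one, Real.norm_eq_abs]
  rw [inv_mul_eq_div, le_div_iff₀ (by linarith)]
  linarith

end IsFlatChart

end FlatCharts

/-! ### The divergence theorem in a flat chart -/

section LocalDivergence

open scoped ContDiff

variable {d : ℕ} {Ω U : Set (Rd d)} {φ : Rd d → ℝ} {e : Rd d} {ε : ℝ} {f : Rd d → ℝ}

theorem integrable_fderiv_apply (hf : ContDiff ℝ 1 f) (hc : HasCompactSupport f) (v : Rd d) :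
    Integrable (fun y => fderiv ℝ f y v) :=
  ((hf.continuous_fderiv one_ne_zero).clm_apply continuous_const).integrable_of_hasCompactSupport
    ((hc.fderiv (𝕜 := ℝ)).comp_left (g := fun L : Rd d →L[ℝ] ℝ => L v) rfl)

theorem fderiv_eq_zero_of_notMem (hfU : tsupport f ⊆ U) {y : Rd d} (hy : y ∉ U) :
    fderiv ℝ f y = 0 :=
  image_eq_zero_of_notMem_tsupport fun h => hy (hfU (tsupport_fderiv_subset ℝ h))

/-- Testing the boundary of `Ω` with a nonnegative function in an arbitrary direction `v` is
governed by the direction `e`, since the gradient of a smooth cutoff `H(-m φ)` of `Ω` is nearly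
parallel to `e`. -/
theorem IsFlatChart.abs_integral_fderiv_sub_le (h : IsFlatChart Ω U φ e ε) (hΩ : IsOpen Ω)
    (hf : ContDiff ℝ 1 f) (hc : HasCompactSupport f) (hfU : tsupport f ⊆ U) (hf0 : ∀ y, 0 ≤ f y)
    (v : Rd d) :
    |(∫ y in Ω, fderiv ℝ f y v) - inner ℝ e v * ∫ y in Ω, fderiv ℝ f y e|
      ≤ ε * ‖v‖ * ∫ y in Ω, fderiv ℝ f y e := by
  set H : ℕ → Rd d → ℝ := fun m y => Real.smoothTransition (-(m * φ y)) with hH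
  have hHc : ∀ m, ContDiff ℝ 1 (H m) := fun m =>
    Real.smoothTransition.contDiff.comp ((contDiff_const.mul h.contDiff).neg)
  set w : ℕ → Rd d → ℝ := fun m y => f y * (m * deriv Real.smoothTransition (-(m * φ y))) with hw
  have hst : Continuous (deriv Real.smoothTransition) :=
    (Real.smoothTransition.contDiff (n := 1)).continuous_deriv le_rfl
  have hwc : ∀ m, Continuous (w m) := fun m => by
    have := hf.continuous
    have := h.contDiff.continuous
    exact hf.continuous.mul (continuous_const.mul (hst.comp (by fun_prop)))
  have hwcs : ∀ m, HasCompactSupport (w m) := fun m => hc.mul_right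
  have hw0 : ∀ m y, 0 ≤ w m y := fun m y =>
    mul_nonneg (hf0 y) (mul_nonneg (Nat.cast_nonneg m) (Real.smoothTransition.monotone.deriv_nonneg))
  have hHd : ∀ m y v, f y * fderiv ℝ (H m) y v = -(w m y * fderiv ℝ φ y v) := fun m y v => by
    have h1 : HasFDerivAt (fun y => -(m * φ y)) (-((m : ℝ) • fderiv ℝ φ y)) y :=
      ((h.contDiff.differentiable one_ne_zero y).hasFDerivAt.const_mul (m : ℝ)).neg
    have h2 := (((Real.smoothTransition.contDiff (n := 1)).differentiable one_ne_zero
      (-(m * φ y))).hasDerivAt).comp_hasFDerivAt y h1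
    have h3 : fderiv ℝ (H m) y = _ := h2.fderiv
    rw [h3]
    simp [hw]; ring
  have hwi : ∀ m v, Integrable (fun y => w m y * fderiv ℝ φ y v) := fun m v =>
    ((hwc m).mul ((h.contDiff.continuous_fderiv one_ne_zero).clm_apply
      continuous_const)).integrable_of_hasCompactSupport (hwcs m).mul_right
  have hparts : ∀ m v, ∫ y, H m y * fderiv ℝ f y v = ∫ y, w m y * fderiv ℝ φ y v := fun m v => by
    have h1 := integral_mul_fderiv_eq_neg_fderiv_mul_of_integrable (μ := volume)
      (f := f) (g := H m) (v := v) ?_ ?_ ?_ (fun x _ => hf.differentiable one_ne_zero x)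
      (fun x _ => (hHc m).differentiable one_ne_zero x)
    · simp only [hHd, integral_neg, neg_inj] at h1
      rw [h1]; congr 1; ext y; ring
    · exact (((hf.continuous_fderiv one_ne_zero).clm_apply continuous_const).mul
        (hHc m).continuous).integrable_of_hasCompactSupport
        ((hc.fderiv (𝕜 := ℝ)).comp_left (g := fun L : Rd d →L[ℝ] ℝ => L v) rfl).mul_right
    · simp only [hHd]; exact (hwi m v).neg
    · exact (hf.continuous.mul (hHc m).continuous).integrable_of_hasCompactSupport hc.mul_right
  have hlim : ∀ v, Tendsto (fun m => ∫ y, w m y * fderiv ℝ φ y v) atTop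
      (𝓝 (∫ y in Ω, fderiv ℝ f y v)) := fun v => by
    simp only [← hparts]
    rw [← integral_indicator hΩ.measurableSet]
    refine tendsto_integral_of_dominated_convergence (fun y => |fderiv ℝ f y v|) (fun m => ?_)
      (integrable_fderiv_apply hf hc v).abs (fun m => Eventually.of_forall fun y => ?_)
      (Eventually.of_forall fun y => ?_)
    · exact ((hHc m).continuous.mul ((hf.continuous_fderiv one_ne_zero).clm_apply
        continuous_const)).aestronglyMeasurable
    · rw [norm_mul, Real.norm_of_nonneg (Real.smoothTransition.nonneg _), Real.norm_eq_abs]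
      exact mul_le_of_le_one_left (abs_nonneg _) (Real.smoothTransition.le_one _)
    · by_cases hyU : y ∈ U
      · by_cases hyΩ : y ∈ Ω
        · have hneg := (h.mem_iff y hyU).1 hyΩ
          rw [indicator_of_mem hyΩ]
          refine tendsto_const_nhds.congr' ?_
          obtain ⟨N, hN⟩ := exists_nat_gt (-φ y)⁻¹
          filter_upwards [eventually_ge_atTop N] with m hm
          have hm' : (-φ y)⁻¹ ≤ m := hN.le.trans (by exact_mod_cast hm)
          have : 1 ≤ -(m * φ y) := by
            rw [inv_le_iff_one_le_mul₀ (by linarith)] at hm'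
            linarith
          simp only [hH]
          rw [Real.smoothTransition.one_of_one_le this, one_mul]
        · have hpos : 0 ≤ φ y := not_lt.1 fun hlt => hyΩ ((h.mem_iff y hyU).2 hlt)
          rw [indicator_of_notMem hyΩ]
          refine tendsto_const_nhds.congr fun m => ?_
          have : -(m * φ y) ≤ 0 := neg_nonpos.2 (mul_nonneg (Nat.cast_nonneg m) hpos)
          simp only [hH]
          rw [Real.smoothTransition.zero_of_nonpos this, zero_mul]
      · have h0 : fderiv ℝ f y v = 0 := by rw [fderiv_eq_zero_of_notMem hfU hyU]; rfl
        have : Ω.indicator (fun y => fderiv ℝ f y v) y = 0 := by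
          by_cases hyΩ : y ∈ Ω <;> simp [hyΩ, h0]
        rw [this]; simp [h0]
  have hbound : ∀ m, |(∫ y, w m y * fderiv ℝ φ y v) - inner ℝ e v * ∫ y, w m y * fderiv ℝ φ y e|
      ≤ ε * ‖v‖ * ∫ y, w m y * fderiv ℝ φ y e := fun m => by
    rw [← integral_const_mul, ← integral_const_mul, ← integral_sub (hwi m v)
      ((hwi m e).const_mul _), ← Real.norm_eq_abs]
    refine norm_integral_le_of_norm_le ((hwi m e).const_mul _) (Eventually.of_forall fun y => ?_)
    have e1 : w m y * fderiv ℝ φ y v - inner ℝ e v * (w m y * fderiv ℝ φ y e)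
        = w m y * (fderiv ℝ φ y v - inner ℝ e v * fderiv ℝ φ y e) := by ring
    by_cases hyU : y ∈ U
    · rw [e1, norm_mul, Real.norm_of_nonneg (hw0 m y), Real.norm_eq_abs]
      calc w m y * |fderiv ℝ φ y v - inner ℝ e v * fderiv ℝ φ y e|
          ≤ w m y * (ε * ‖v‖ * fderiv ℝ φ y e) :=
            mul_le_mul_of_nonneg_left (h.slope y hyU v) (hw0 m y)
        _ = ε * ‖v‖ * (w m y * fderiv ℝ φ y e) := by ring
    · have hfy : f y = 0 := image_eq_zero_of_notMem_tsupport fun hy => hyU (hfU hy)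
      simp [hw, hfy]
  exact le_of_tendsto_of_tendsto' ((hlim v).sub ((hlim e).const_mul _)).abs
    ((hlim e).const_mul _) hbound

/-- The coordinates `(s, w) ↦ s e + w` on `ℝ × e^⊥`. -/
def lineCoord (e : Rd d) (p : ℝ × (ℝ ∙ e)ᗮ) : Rd d := p.1 • e + (p.2 : Rd d)

theorem measurePreserving_lineCoord (he : ‖e‖ = 1) : MeasurePreserving (lineCoord e) := by
  have h1 := ((LinearIsometryEquiv.toSpanUnitSingleton (𝕜 := ℝ) e he).measurePreserving).prod
    (MeasurePreserving.id (volume : Measure (ℝ ∙ e)ᗮ))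
  have h2 := WithLp.volume_preserving_toLp (ℝ ∙ e) (ℝ ∙ e)ᗮ
  have h3 := ((ℝ ∙ e).orthogonalDecomposition.symm).measurePreserving
  have h4 := h3.comp (h2.comp h1)
  have e1 : lineCoord e = (ℝ ∙ e).orthogonalDecomposition.symm ∘
      WithLp.toLp 2 ∘ Prod.map (LinearIsometryEquiv.toSpanUnitSingleton e he) id := by
    ext p : 1
    simp [lineCoord]
  rw [e1]
  exact h4

/-- The integral along the line `ℝ e + w` of the directional derivative of `f` inside `Ω`. -/
def lineIntegral (Ω : Set (Rd d)) (f : Rd d → ℝ) (e : Rd d) (w : (ℝ ∙ e)ᗮ) : ℝ :=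
  ∫ s : ℝ, Ω.indicator (fun y => fderiv ℝ f y e) (lineCoord e (s, w))

theorem stronglyMeasurable_lineIntegral (hΩ : IsOpen Ω) (hf : ContDiff ℝ 1 f) :
    StronglyMeasurable (lineIntegral Ω f e) := by
  have h1 : Measurable (Ω.indicator (fun y => fderiv ℝ f y e)) :=
    ((hf.continuous_fderiv one_ne_zero).clm_apply continuous_const).measurable.indicator
      hΩ.measurableSet
  have h2 : Continuous (lineCoord e) := by unfold lineCoord; fun_prop
  exact (h1.comp h2.measurable).stronglyMeasurable.integral_prod_left'

/-- Fubini's theorem in the coordinates `lineCoord e`. -/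
theorem integral_lineIntegral (he : ‖e‖ = 1) (hΩ : IsOpen Ω) (hf : ContDiff ℝ 1 f)
    (hc : HasCompactSupport f) :
    Integrable (lineIntegral Ω f e) ∧ ∫ w, lineIntegral Ω f e w = ∫ y in Ω, fderiv ℝ f y e := by
  have hmp := measurePreserving_lineCoord he
  have hint : Integrable (Ω.indicator (fun y => fderiv ℝ f y e)) :=
    (integrable_fderiv_apply hf hc e).indicator hΩ.measurableSet
  have hint' := hmp.integrable_comp_of_integrable hint
  refine ⟨hint'.integral_prod_right, ?_⟩
  rw [← integral_indicator hΩ.measurableSet, ← hmp.map_eq,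
    integral_map hmp.measurable.aemeasurable (by rw [hmp.map_eq]; exact hint.aestronglyMeasurable)]
  exact (integral_prod_symm _ hint').symm

/-- The fundamental theorem of calculus on a line which crosses the boundary of `Ω` once, upwards,
or not at all. -/
theorem integral_deriv_sublevel {h ψ : ℝ → ℝ} {J A : Set ℝ} (hh : ContDiff ℝ 1 h)
    (hc : HasCompactSupport h) (hJ : Convex ℝ J) (hhJ : ∀ s ∉ J, h s = 0 ∧ deriv h s = 0)
    (hψ : StrictMonoOn ψ J) (hψc : ContinuousOn ψ J) (hA : ∀ s ∈ J, (s ∈ A ↔ ψ s < 0)) :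
    (∀ s ∈ J, ψ s = 0 → ∫ s, A.indicator (deriv h) s = h s) ∧
      ((∀ s ∈ J, ψ s ≠ 0) → ∫ s, A.indicator (deriv h) s = 0) := by
  refine ⟨fun s₀ hs₀ h0 => ?_, fun hne => ?_⟩
  · rw [← hc.integral_Iic_deriv_eq hh s₀, integral_Iic_eq_integral_Iio,
      ← integral_indicator measurableSet_Iio]
    congr 1; ext s
    by_cases hs : s ∈ J
    · have : s ∈ A ↔ s < s₀ := by
        rw [hA s hs, ← h0]; exact hψ.lt_iff_lt hs hs₀
      by_cases hsA : s ∈ A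
      · rw [indicator_of_mem hsA, indicator_of_mem (show s ∈ Iio s₀ from this.1 hsA)]
      · rw [indicator_of_notMem hsA, indicator_of_notMem fun hlt : s ∈ Iio s₀ => hsA (this.2 hlt)]
    · simp [indicator_apply, (hhJ s hs).2]
  · by_cases hneg : ∃ s ∈ J, ψ s < 0
    · obtain ⟨a, ha, ha0⟩ := hneg
      have hall : ∀ s ∈ J, ψ s < 0 := fun s hs => by
        by_contra hs0
        obtain ⟨c, hc, hc0⟩ := hJ.isPreconnected.intermediate_value ha hs hψc
          ⟨ha0.le, not_lt.1 hs0⟩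
        exact hne c hc hc0
      have : A.indicator (deriv h) = deriv h := by
        ext s
        by_cases hs : s ∈ J
        · rw [indicator_of_mem ((hA s hs).2 (hall s hs))]
        · simp [(hhJ s hs).2]
      rw [this]
      exact integral_eq_zero_of_hasDerivAt_of_integrable
        (fun s => (hh.differentiable one_ne_zero s).hasDerivAt)
        ((hh.continuous_deriv le_rfl).integrable_of_hasCompactSupport hc.deriv)
        (hh.continuous.integrable_of_hasCompactSupport hc)
    · push Not at hneg
      have : A.indicator (deriv h) = 0 := by
        ext s
        by_cases hs : s ∈ J
        · rw [indicator_of_notMem fun hsA => absurd ((hA s hs).1 hsA) (hneg s hs).not_gt]; rfl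
        · simp [(hhJ s hs).2]
      rw [this]; simp

/-- The line integral is the value of `f` where the line crosses the surface, and `0` if it does
not. -/
theorem IsFlatChart.lineIntegral_eq (h : IsFlatChart Ω U φ e ε)
    (hf : ContDiff ℝ 1 f) (hc : HasCompactSupport f) (hfU : tsupport f ⊆ U) (w : (ℝ ∙ e)ᗮ) :
    (∀ s, lineCoord e (s, w) ∈ U → φ (lineCoord e (s, w)) = 0 →
        lineIntegral Ω f e w = f (lineCoord e (s, w))) ∧
      ((∀ s, lineCoord e (s, w) ∈ U → φ (lineCoord e (s, w)) ≠ 0) →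
        lineIntegral Ω f e w = 0) := by
  have hline : ContDiff ℝ 1 (fun s : ℝ => lineCoord e (s, w)) :=
    (contDiff_id.smul contDiff_const).add (contDiff_const (c := (w : Rd d)))
  have hfl : ContDiff ℝ 1 (fun s : ℝ => f (lineCoord e (s, w))) := hf.comp hline
  have hder : ∀ s, deriv (fun s : ℝ => f (lineCoord e (s, w))) s
      = fderiv ℝ f (lineCoord e (s, w)) e := fun s => by
    have h1 : HasDerivAt (fun s : ℝ => lineCoord e (s, w)) e s := by
      simpa [lineCoord] using ((hasDerivAt_id s).smul_const e).add_const (w : Rd d)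
    exact (((hf.differentiable one_ne_zero _).hasFDerivAt).comp_hasDerivAt s h1).deriv
  have hiso : Isometry (fun s : ℝ => lineCoord e (s, w)) := Isometry.of_dist_eq fun s t => by
    simp only [lineCoord, dist_add_right]
    rw [dist_eq_norm, ← sub_smul, norm_smul, h.norm_eq_one, mul_one, Real.dist_eq,
      Real.norm_eq_abs]
  have hcl : HasCompactSupport (fun s : ℝ => f (lineCoord e (s, w))) :=
    hc.comp_isClosedEmbedding hiso.isClosedEmbedding
  have key := integral_deriv_sublevel (h := fun s : ℝ => f (lineCoord e (s, w)))
    (ψ := fun s : ℝ => φ (lineCoord e (s, w))) (J := {s | lineCoord e (s, w) ∈ U})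
    (A := {s | lineCoord e (s, w) ∈ Ω}) hfl hcl (h.convex_line w) (fun s hs => ⟨?_, ?_⟩)
    (h.strictMonoOn_line w) (h.contDiff.continuous.comp hline.continuous).continuousOn
    (fun s hs => h.mem_iff _ hs)
  · have e1 : ∫ s, {s | lineCoord e (s, w) ∈ Ω}.indicator
        (deriv fun s : ℝ => f (lineCoord e (s, w))) s = lineIntegral Ω f e w := by
      unfold lineIntegral
      congr 1; ext s
      by_cases hs : lineCoord e (s, w) ∈ Ω
      · rw [indicator_of_mem (show s ∈ {s | lineCoord e (s, w) ∈ Ω} from hs),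
          indicator_of_mem hs, hder]
      · rw [indicator_of_notMem (show s ∉ {s | lineCoord e (s, w) ∈ Ω} from hs),
          indicator_of_notMem hs]
    rw [e1] at key
    exact key
  · exact image_eq_zero_of_notMem_tsupport fun hy => hs (hfU hy)
  · rw [hder, fderiv_eq_zero_of_notMem hfU hs]; rfl

/-- Along the normal direction `e` the boundary integral is, up to a factor close to `1`, the
integral with respect to the Hausdorff measure: the orthogonal projection to `e^⊥` is nearly
isometric on the boundary. -/
theorem IsFlatChart.lintegral_frontier_bounds (h : IsFlatChart Ω U φ e ε) {n : ℕ}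
    (hn : d = n + 1) (hε1 : ε < 1) (hΩ : IsOpen Ω) (hf : ContDiff ℝ 1 f)
    (hc : HasCompactSupport f) (hfU : tsupport f ⊆ U) (hf0 : ∀ y, 0 ≤ f y) :
    ENNReal.ofReal (∫ y in Ω, fderiv ℝ f y e)
        ≤ ∫⁻ y in frontier Ω, ENNReal.ofReal (f y) ∂μHE[n] ∧
      ∫⁻ y in frontier Ω, ENNReal.ofReal (f y) ∂μHE[n]
        ≤ ENNReal.ofReal ((1 - ε)⁻¹ ^ n) * ENNReal.ofReal (∫ y in Ω, fderiv ℝ f y e) := by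
  have hfin : Module.finrank ℝ (ℝ ∙ e)ᗮ = n := by
    have : Fact (Module.finrank ℝ (Rd d) = n + 1) := ⟨by simp [hn]⟩
    exact Submodule.finrank_orthogonal_span_singleton (norm_ne_zero_iff.1 (by simp [h.norm_eq_one]))
  have hvol : (μHE[n] : Measure (ℝ ∙ e)ᗮ) = volume := by
    rw [← hfin]; exact InnerProductSpace.euclideanHausdorffMeasure_eq_volume
  set P : Rd d → (ℝ ∙ e)ᗮ := (ℝ ∙ e)ᗮ.orthogonalProjectionOnto with hP
  have hPc : Continuous P := ContinuousLinearMap.continuous _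
  have hdecomp : ∀ y, lineCoord e (inner ℝ e y, P y) = y := fun y => by
    have h1 := (ℝ ∙ e).starProjection_add_starProjection_orthogonal y
    rw [Submodule.starProjection_unit_singleton ℝ h.norm_eq_one] at h1
    exact h1
  have hPline : ∀ s (w : (ℝ ∙ e)ᗮ), P (lineCoord e (s, w)) = w := fun s w => by
    simp only [hP, lineCoord, map_add, map_smul,
      Submodule.orthogonalProjectionOnto_mem_subspace_eq_self]
    rw [Submodule.orthogonalProjectionOnto_orthogonalComplement_singleton_eq_zero, smul_zero, zero_add]
  set S := frontier Ω ∩ U with hS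
  have hSm : MeasurableSet S := isClosed_frontier.measurableSet.inter h.isOpen.measurableSet
  set k := lineIntegral Ω f e with hk
  have hkS : ∀ y ∈ S, k (P y) = f y := fun y hy => by
    have := (h.lineIntegral_eq hf hc hfU (P y)).1 (inner ℝ e y) (by rw [hdecomp]; exact hy.2)
      (by rw [hdecomp]; exact (h.mem_frontier_iff hy.2).1 hy.1)
    rwa [hdecomp] at this
  have hk0 : ∀ w ∉ P '' S, k w = 0 := fun w hw => by
    refine (h.lineIntegral_eq hf hc hfU w).2 fun s hs h0 => hw ?_
    exact ⟨_, ⟨(h.mem_frontier_iff hs).2 h0, hs⟩, hPline s w⟩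
  have hkm : Measurable k := (stronglyMeasurable_lineIntegral hΩ hf).measurable
  have hknn : ∀ w, 0 ≤ k w := fun w => by
    by_cases hw : w ∈ P '' S
    · obtain ⟨y, hy, rfl⟩ := hw
      rw [hkS y hy]; exact hf0 y
    · rw [hk0 w hw]
  obtain ⟨hki, hkint⟩ := integral_lineIntegral h.norm_eq_one hΩ hf hc
  have hI : ENNReal.ofReal (∫ y in Ω, fderiv ℝ f y e) = ∫⁻ w, ENNReal.ofReal (k w) := by
    rw [← hkint]
    exact ofReal_integral_eq_lintegral_ofReal hki (Eventually.of_forall hknn)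
  have hF : ∫⁻ y in frontier Ω, ENNReal.ofReal (f y) ∂μHE[n]
      = ∫⁻ w, ENNReal.ofReal (k w) ∂((μHE[n].restrict S).map P) := by
    rw [lintegral_map hkm.ennreal_ofReal hPc.measurable,
      setLIntegral_congr_fun hSm fun y hy => by rw [hkS y hy],
      ← lintegral_indicator hSm, ← lintegral_indicator isClosed_frontier.measurableSet]
    congr 1; ext y
    by_cases hyU : y ∈ U
    · by_cases hyf : y ∈ frontier Ω
      · rw [indicator_of_mem hyf, indicator_of_mem (show y ∈ S from ⟨hyf, hyU⟩)]
      · rw [indicator_of_notMem hyf, indicator_of_notMem fun hy : y ∈ S => hyf hy.1]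
    · have : f y = 0 := image_eq_zero_of_notMem_tsupport fun hy => hyU (hfU hy)
      by_cases hyf : y ∈ frontier Ω <;> by_cases hyS : y ∈ S <;> simp [hyf, hyS, this]
  have hlow : volume.restrict (P '' S) ≤ (μHE[n].restrict S).map P := by
    refine Measure.le_iff.2 fun A hA => ?_
    rw [Measure.restrict_apply hA, Measure.map_apply hPc.measurable hA,
      Measure.restrict_apply (hPc.measurable hA), ← hvol]
    have e1 : A ∩ P '' S = P '' (P ⁻¹' A ∩ S) := by
      rw [image_preimage_inter]
    have hlip : LipschitzWith 1 P :=
      LipschitzWith.of_dist_le_mul fun x y => by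
        rw [NNReal.coe_one, one_mul, dist_eq_norm, dist_eq_norm, hP, ← map_sub]
        exact Submodule.norm_orthogonalProjectionOnto_apply_le _ _
    rw [e1]
    have h1 := hlip.hausdorffMeasure_image_le (Nat.cast_nonneg n) (P ⁻¹' A ∩ S)
    simp only [Measure.euclideanHausdorffMeasure_def, Measure.smul_apply]
    rw [ENNReal.coe_one, ENNReal.one_rpow, one_mul] at h1
    gcongr
  have hup : (μHE[n].restrict S).map P
      ≤ ENNReal.ofReal ((1 - ε)⁻¹ ^ n) • volume.restrict (P '' S) := by
    refine Measure.le_iff.2 fun A hA => ?_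
    rw [Measure.smul_apply, Measure.restrict_apply hA, Measure.map_apply hPc.measurable hA,
      Measure.restrict_apply (hPc.measurable hA), ← hvol]
    have e1 : A ∩ P '' S = P '' (P ⁻¹' A ∩ S) := by
      rw [image_preimage_inter]
    rw [e1]
    set K : ℝ≥0 := ⟨(1 - ε)⁻¹, inv_nonneg.2 (by linarith)⟩ with hK
    have hanti : AntilipschitzWith K (fun y : S => P y) := by
      refine AntilipschitzWith.of_le_mul_dist fun y z => ?_
      rw [Subtype.dist_eq, dist_eq_norm, dist_eq_norm, hP, ← map_sub]
      refine h.norm_sub_le_of_zero hε1 y.2.2 z.2.2 ((h.mem_frontier_iff y.2.2).1 y.2.1)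
        ((h.mem_frontier_iff z.2.2).1 z.2.1) (hdecomp _).symm
    have h1 := hanti.le_hausdorffMeasure_image (Nat.cast_nonneg (α := ℝ) n)
      (Subtype.val ⁻¹' (P ⁻¹' A))
    rw [← isometry_subtype_coe.hausdorffMeasure_image (Or.inl (Nat.cast_nonneg n)),
      Subtype.image_preimage_coe] at h1
    have e2 : (fun y : S => P y) '' (Subtype.val ⁻¹' (P ⁻¹' A)) = P '' (P ⁻¹' A ∩ S) := by
      rw [← image_image P Subtype.val, Subtype.image_preimage_coe, inter_comm]
    rw [e2, inter_comm S] at h1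
    have e3 : ENNReal.ofReal ((1 - ε)⁻¹ ^ n) = (K : ℝ≥0∞) ^ (n : ℝ) := by
      rw [ENNReal.rpow_natCast, ENNReal.ofReal_pow (inv_nonneg.2 (by linarith))]
      congr 1
      rw [← ENNReal.ofReal_coe_nnreal]; rfl
    rw [e3]
    simp only [Measure.euclideanHausdorffMeasure_def, Measure.smul_apply, smul_eq_mul]
    rw [mul_smul_comm]
    gcongr
  have hkT : ∫⁻ w, ENNReal.ofReal (k w) = ∫⁻ w in P '' S, ENNReal.ofReal (k w) := by
    refine le_antisymm ?_ (setLIntegral_le_lintegral _ _)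
    have hT : MeasurableSet (Function.support k) := hkm (measurableSet_singleton 0).compl
    have hsub : Function.support k ⊆ P '' S := fun w hw => by
      by_contra hw'; exact hw (hk0 w hw')
    calc ∫⁻ w, ENNReal.ofReal (k w) = ∫⁻ w in Function.support k, ENNReal.ofReal (k w) := by
          rw [← lintegral_indicator hT]
          congr 1; ext w
          by_cases hw : k w = 0
          · simp [hw]
          · rw [indicator_of_mem (show w ∈ Function.support k from hw)]
      _ ≤ _ := lintegral_mono_set hsub
  rw [hI, hF, hkT]
  refine ⟨lintegral_mono' hlow le_rfl, (lintegral_mono' hup le_rfl).trans_eq ?_⟩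
  rw [lintegral_smul_measure, smul_eq_mul]

end LocalDivergence

/-! ### The divergence theorem for regular open sets -/

section Divergence

open scoped ContDiff Manifold

variable {d n : ℕ} {Ω : Set (Rd d)} {N : Rd d → Rd d}

/-- The surface measure of `∂Ω`: the Euclidean Hausdorff measure of codimension one. -/
def surfaceMeasure (n : ℕ) (Ω : Set (Rd d)) : Measure (Rd d) :=
  (μHE[n] : Measure (Rd d)).restrict (frontier Ω)

/-- By compactness it suffices to bound the area in small balls, and there the surface integral of
a bump function is bounded by a volume integral. -/
theorem surfaceMeasure_univ_lt_top (hn : d = n + 1) (hΩ : IsOpen Ω) (hc : IsCompact (frontier Ω))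
    (hN : ∀ x ∈ frontier Ω, IsExteriorUnitNormal Ω x (N x)) :
    surfaceMeasure n Ω univ < ⊤ := by
  rw [surfaceMeasure, Measure.restrict_apply_univ]
  refine hc.measure_lt_top_of_nhdsWithin fun x hx => ?_
  obtain ⟨φ, hφ⟩ := (hN x hx).exists_flatChart (ε := 1 / 2) (by norm_num) (by norm_num)
  obtain ⟨r, hr, hr0⟩ := (hφ.and self_mem_nhdsWithin).exists
  have hr0 : 0 < r := hr0
  let f : ContDiffBump x := ⟨r / 3, r / 2, by positivity, by linarith⟩
  have hfU : tsupport f ⊆ Metric.ball x r := by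
    rw [f.tsupport_eq]; exact Metric.closedBall_subset_ball (by simp only [f]; linarith)
  have hb := (hr.lintegral_frontier_bounds hn (by norm_num) hΩ f.contDiff f.hasCompactSupport hfU
    fun y => f.nonneg).2
  refine ⟨frontier Ω ∩ Metric.ball x (r / 3), ?_, ?_⟩
  · exact inter_mem self_mem_nhdsWithin
      (mem_nhdsWithin_of_mem_nhds (Metric.ball_mem_nhds x (by positivity)))
  · have hlt := hb.trans_lt (ENNReal.mul_lt_top ENNReal.ofReal_lt_top ENNReal.ofReal_lt_top)
    refine lt_of_le_of_lt ?_ hlt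
    rw [inter_comm, ← Measure.restrict_apply Metric.isOpen_ball.measurableSet,
      ← lintegral_indicator_one Metric.isOpen_ball.measurableSet]
    refine lintegral_mono fun y => ?_
    by_cases hy : y ∈ Metric.ball x (r / 3)
    · rw [indicator_of_mem hy, f.one_of_mem_closedBall (Metric.ball_subset_closedBall hy)]; simp
    · simp [hy]

/-- The error in the divergence theorem for the field `f v`, with `v` a constant vector. -/
def divergenceDefect (n : ℕ) (Ω : Set (Rd d)) (N : Rd d → Rd d) (v : Rd d) (f : Rd d → ℝ) : ℝ :=
  (∫ y in Ω, fderiv ℝ f y v) - ∫ y, f y * inner ℝ (N y) v ∂(surfaceMeasure n Ω)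

/-- Near any point the divergence theorem holds for nonnegative functions up to a small relative
error. -/
theorem exists_ball_abs_divergenceDefect_le (hn : d = n + 1) (hΩ : IsOpen Ω)
    (hc : IsCompact (frontier Ω)) (hNc : Continuous N)
    (hN : ∀ x ∈ frontier Ω, IsExteriorUnitNormal Ω x (N x)) {η : ℝ} (hη : 0 < η) (x : Rd d) :
    ∃ r > 0, ∀ f : Rd d → ℝ, ContDiff ℝ 1 f → HasCompactSupport f →
      tsupport f ⊆ Metric.ball x r → (∀ y, 0 ≤ f y) → ∀ v,
      |divergenceDefect n Ω N v f| ≤ η * ‖v‖ * ∫ y, f y ∂(surfaceMeasure n Ω) := by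
  have hfin : IsFiniteMeasure (surfaceMeasure n Ω) := ⟨surfaceMeasure_univ_lt_top hn hΩ hc hN⟩
  have hbdry : ∀ r, (∀ y ∈ frontier Ω, y ∉ Metric.ball x r) → ∀ f : Rd d → ℝ,
      tsupport f ⊆ Metric.ball x r → ∀ g : Rd d → ℝ,
      ∫ y, f y * g y ∂(surfaceMeasure n Ω) = 0 := fun r hr f hf g => by
    refine integral_eq_zero_of_ae ?_
    filter_upwards [ae_restrict_mem isClosed_frontier.measurableSet] with y hy
    have : f y = 0 := image_eq_zero_of_notMem_tsupport fun h => hr y hy (hf h)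
    simp [this]
  by_cases hx : x ∈ frontier Ω
  -- the relative errors come from the direction `v`, the area factor `(1 - ε)⁻¹ ^ n`, and the
  -- oscillation of `N`
  · obtain ⟨ε, ⟨hε1, hε⟩, hε0⟩ : ∃ ε : ℝ, (ε < 1 ∧ ε + ((1 - ε)⁻¹ ^ n - 1) + ε < η) ∧ 0 < ε := by
      have hcont : ContinuousAt (fun ε : ℝ => ε + ((1 - ε)⁻¹ ^ n - 1) + ε) 0 := by
        have : ContinuousAt (fun ε : ℝ => (1 - ε)⁻¹) 0 :=
          ContinuousAt.inv₀ (by fun_prop) (by norm_num)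
        fun_prop
      have h1 : ∀ᶠ ε in 𝓝 (0 : ℝ), ε + ((1 - ε)⁻¹ ^ n - 1) + ε < η :=
        hcont.eventually (gt_mem_nhds (by simpa using hη))
      have h2 : ∀ᶠ ε in 𝓝 (0 : ℝ), ε < 1 := gt_mem_nhds one_pos
      have h3 : ∀ᶠ ε in 𝓝[>] (0 : ℝ), 0 < ε := self_mem_nhdsWithin
      exact (((h2.and h1).filter_mono nhdsWithin_le_nhds).and h3).exists
    obtain ⟨φ, hφ⟩ := (hN x hx).exists_flatChart hε0 hε1.le
    have hclose : ∀ᶠ y in 𝓝 x, ‖N y - N x‖ < ε := by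
      filter_upwards [Metric.tendsto_nhds.1 (hNc.tendsto x) ε hε0] with y hy
      rwa [dist_eq_norm] at hy
    obtain ⟨r₁, hr₁, hball⟩ := Metric.eventually_nhds_iff_ball.1 hclose
    obtain ⟨r, hr, hr0, hrr₁⟩ := (hφ.and (Ioc_mem_nhdsGT hr₁)).exists
    refine ⟨r, hr0, fun f hf hfc hfU hf0 v => ?_⟩
    set I := ∫ y in Ω, fderiv ℝ f y (N x) with hI
    set J := ∫ y, f y ∂(surfaceMeasure n Ω) with hJ
    have hfi : Integrable f (surfaceMeasure n Ω) :=
      hf.continuous.integrable_of_hasCompactSupport hfc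
    have hJ0 : 0 ≤ J := integral_nonneg hf0
    have hJl : ENNReal.ofReal J = ∫⁻ y in frontier Ω, ENNReal.ofReal (f y) ∂μHE[n] :=
      ofReal_integral_eq_lintegral_ofReal hfi (Eventually.of_forall hf0)
    obtain ⟨hlow, hup⟩ := hr.lintegral_frontier_bounds hn hε1 hΩ hf hfc hfU hf0
    rw [← hJl] at hlow hup
    have hκ : 0 ≤ (1 - ε)⁻¹ ^ n := pow_nonneg (inv_nonneg.2 (by linarith)) n
    have hIJ : I ≤ J := (ENNReal.ofReal_le_ofReal_iff hJ0).1 hlow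
    have hI0 : 0 ≤ I := by
      by_contra hneg
      rw [ENNReal.ofReal_of_nonpos (not_le.1 hneg).le, mul_zero] at hup
      have hJ00 : J = 0 := le_antisymm (ENNReal.ofReal_eq_zero.1 (nonpos_iff_eq_zero.1 hup)) hJ0
      have h2 := hr.abs_integral_fderiv_sub_le hΩ hf hfc hfU hf0 0
      have h3 := hr.abs_integral_fderiv_sub_le hΩ hf hfc hfU hf0 (N x)
      rw [real_inner_self_eq_norm_sq, hr.norm_eq_one] at h3
      simp only [one_pow, one_mul, sub_self, abs_zero, mul_one] at h3
      exact hneg (nonneg_of_mul_nonneg_right h3 hε0)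
    have hJI : J ≤ (1 - ε)⁻¹ ^ n * I := by
      rw [← ENNReal.ofReal_mul hκ] at hup
      exact (ENNReal.ofReal_le_ofReal_iff (mul_nonneg hκ hI0)).1 hup
    have hκ1 : 1 ≤ (1 - ε)⁻¹ ^ n :=
      one_le_pow₀ ((one_le_inv₀ (by linarith)).2 (by linarith))
    have h1 : |(∫ y in Ω, fderiv ℝ f y v) - inner ℝ (N x) v * I| ≤ ε * ‖v‖ * J :=
      (hr.abs_integral_fderiv_sub_le hΩ hf hfc hfU hf0 v).trans
        (mul_le_mul_of_nonneg_left hIJ (by positivity))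
    have hxv : |inner ℝ (N x) v| ≤ ‖v‖ :=
      (abs_real_inner_le_norm _ _).trans (by rw [hr.norm_eq_one, one_mul])
    have h2 : |inner ℝ (N x) v * (I - J)| ≤ ‖v‖ * (((1 - ε)⁻¹ ^ n - 1) * J) := by
      rw [abs_mul]
      refine mul_le_mul hxv ?_ (abs_nonneg _) (norm_nonneg _)
      rw [abs_sub_comm, abs_of_nonneg (by linarith)]
      have : ((1 - ε)⁻¹ ^ n - 1) * I ≤ ((1 - ε)⁻¹ ^ n - 1) * J :=
        mul_le_mul_of_nonneg_left hIJ (by linarith)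
      linarith
    have hfNi : Integrable (fun y => f y * inner ℝ (N y) v) (surfaceMeasure n Ω) :=
      (hf.continuous.mul (hNc.inner continuous_const)).integrable_of_hasCompactSupport hfc.mul_right
    have h3 : |inner ℝ (N x) v * J - ∫ y, f y * inner ℝ (N y) v ∂(surfaceMeasure n Ω)|
        ≤ ε * ‖v‖ * J := by
      rw [hJ, ← integral_const_mul, ← integral_sub (hfi.const_mul _) hfNi, ← integral_const_mul,
        ← Real.norm_eq_abs]
      refine norm_integral_le_of_norm_le (hfi.const_mul _) (Eventually.of_forall fun y => ?_)
      by_cases hy : y ∈ Metric.ball x r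
      · have e1 : inner ℝ (N x) v * f y - f y * inner ℝ (N y) v
            = -(f y * inner ℝ (N y - N x) v) := by rw [inner_sub_left]; ring
        rw [e1, norm_neg, norm_mul, Real.norm_of_nonneg (hf0 y), mul_comm]
        refine mul_le_mul_of_nonneg_right ?_ (hf0 y)
        exact (norm_inner_le_norm _ _).trans (mul_le_mul_of_nonneg_right
          (hball y (Metric.ball_subset_ball hrr₁ hy)).le (norm_nonneg _))
      · have : f y = 0 := image_eq_zero_of_notMem_tsupport fun h => hy (hfU h)
        simp [this]
    have e1 : divergenceDefect n Ω N v f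
        = ((∫ y in Ω, fderiv ℝ f y v) - inner ℝ (N x) v * I) + inner ℝ (N x) v * (I - J)
          + (inner ℝ (N x) v * J - ∫ y, f y * inner ℝ (N y) v ∂(surfaceMeasure n Ω)) := by
      rw [divergenceDefect]; ring
    rw [e1]
    calc _ ≤ ε * ‖v‖ * J + ‖v‖ * (((1 - ε)⁻¹ ^ n - 1) * J) + ε * ‖v‖ * J :=
          (abs_add_three _ _ _).trans (add_le_add (add_le_add h1 h2) h3)
      _ = (ε + ((1 - ε)⁻¹ ^ n - 1) + ε) * (‖v‖ * J) := by ring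
      _ ≤ η * (‖v‖ * J) := mul_le_mul_of_nonneg_right hε.le (by positivity)
      _ = _ := by ring
  · have hnf : (frontier Ω)ᶜ ∈ 𝓝 x := isClosed_frontier.isOpen_compl.mem_nhds hx
    obtain ⟨r, hr, hball⟩ := Metric.mem_nhds_iff.1 hnf
    refine ⟨r, hr, fun f hf hfc hfU hf0 v => ?_⟩
    have hb := hbdry r (fun y hy hyb => hball hyb hy) f hfU
    have h1 : ∫ y in Ω, fderiv ℝ f y v = 0 := by
      have hconn : IsPreconnected (Metric.ball x r) := (convex_ball x r).isPreconnected
      rcases hconn.subset_or_subset hΩ isClosed_closure.isOpen_compl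
        (disjoint_left.2 fun y hy hy' => hy' (subset_closure hy)) (fun y hy => by
          by_cases hyc : y ∈ closure Ω
          · left
            by_contra hyΩ
            exact hball hy ⟨hyc, by rwa [hΩ.interior_eq]⟩
          · exact Or.inr hyc) with hsub | hsub
      · have e1 : ∫ y in Ω, fderiv ℝ f y v = ∫ y, fderiv ℝ f y v := by
          refine setIntegral_eq_integral_of_forall_compl_eq_zero fun y hy => ?_
          rw [fderiv_eq_zero_of_notMem hfU fun hyb => hy (hsub hyb)]; rfl
        rw [e1]
        have := integral_mul_fderiv_eq_neg_fderiv_mul_of_integrable (μ := (volume : Measure (Rd d)))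
          (f := fun _ => (1 : ℝ)) (g := f) (v := v) (by simp)
          (by simpa using integrable_fderiv_apply hf hfc v)
          (by simpa using hf.continuous.integrable_of_hasCompactSupport hfc)
          (fun x _ => differentiableAt_const _) (fun x _ => hf.differentiable one_ne_zero x)
        simpa using this
      · refine setIntegral_eq_zero_of_forall_eq_zero fun y hy => ?_
        rw [fderiv_eq_zero_of_notMem hfU fun hyb => hsub hyb (subset_closure hy)]; rfl
    have h2 : ∫ y, f y ∂(surfaceMeasure n Ω) = 0 := by simpa using hb (fun _ => 1)
    rw [divergenceDefect, h1, hb, h2]; simp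

theorem divergenceDefect_sum [IsFiniteMeasure (surfaceMeasure n Ω)] (hNc : Continuous N)
    {ι : Type*} (s : Finset ι) {f : ι → Rd d → ℝ} (hf : ∀ i ∈ s, ContDiff ℝ 1 (f i))
    (hc : ∀ i ∈ s, HasCompactSupport (f i)) (v : Rd d) :
    divergenceDefect n Ω N v (fun y => ∑ i ∈ s, f i y) =
      ∑ i ∈ s, divergenceDefect n Ω N v (f i) := by
  have h1 : ∀ y, fderiv ℝ (fun y => ∑ i ∈ s, f i y) y v = ∑ i ∈ s, fderiv ℝ (f i) y v := fun y => by
    rw [fderiv_fun_sum fun i hi => (hf i hi).differentiable one_ne_zero y]; simp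
  simp only [divergenceDefect, h1, Finset.sum_mul]
  rw [integral_finsetSum _ fun i hi => (integrable_fderiv_apply (hf i hi) (hc i hi) v).integrableOn,
    integral_finsetSum _ fun i hi => ?_, Finset.sum_sub_distrib]
  exact ((hf i hi).continuous.mul (hNc.inner continuous_const)).integrable_of_hasCompactSupport
    (hc i hi).mul_right

theorem divergenceDefect_sub [IsFiniteMeasure (surfaceMeasure n Ω)] (hNc : Continuous N)
    {f g : Rd d → ℝ} (hf : ContDiff ℝ 1 f) (hg : ContDiff ℝ 1 g)
    (hfc : HasCompactSupport f) (hgc : HasCompactSupport g) (v : Rd d) :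
    divergenceDefect n Ω N v (fun y => f y - g y)
      = divergenceDefect n Ω N v f - divergenceDefect n Ω N v g := by
  have h1 : ∀ y, fderiv ℝ (fun y => f y - g y) y v = fderiv ℝ f y v - fderiv ℝ g y v := fun y => by
    rw [fderiv_fun_sub (hf.differentiable one_ne_zero y) (hg.differentiable one_ne_zero y)]; rfl
  have hi : ∀ f : Rd d → ℝ, ContDiff ℝ 1 f → HasCompactSupport f →
      Integrable (fun y => f y * inner ℝ (N y) v) (surfaceMeasure n Ω) := fun f hf hfc =>
    (hf.continuous.mul (hNc.inner continuous_const)).integrable_of_hasCompactSupport hfc.mul_right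
  simp only [divergenceDefect, h1, sub_mul]
  rw [integral_sub (integrable_fderiv_apply hf hfc v).integrableOn
    (integrable_fderiv_apply hg hgc v).integrableOn, integral_sub (hi f hf hfc) (hi g hg hgc)]
  ring

/-- The divergence theorem for a `C¹` function times a constant vector. The local estimates for
nonnegative functions are summed up by a partition of unity; the accumulated error is
proportional to the total area, hence arbitrarily small. -/
theorem divergenceDefect_eq_zero (hn : d = n + 1) (hΩ : IsOpen Ω)
    (hc : IsCompact (frontier Ω)) (hNc : Continuous N)
    (hN : ∀ x ∈ frontier Ω, IsExteriorUnitNormal Ω x (N x)) {g : Rd d → ℝ} (hg : ContDiff ℝ 1 g)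
    (hgc : HasCompactSupport g) (v : Rd d) : divergenceDefect n Ω N v g = 0 := by
  have hfin : IsFiniteMeasure (surfaceMeasure n Ω) := ⟨surfaceMeasure_univ_lt_top hn hΩ hc hN⟩
  obtain ⟨M, hM⟩ := hgc.exists_bound_of_continuous hg.continuous
  have hM0 : 0 ≤ M := (norm_nonneg _).trans (hM 0)
  set A := (surfaceMeasure n Ω).real univ with hA
  have hA0 : 0 ≤ A := measureReal_nonneg
  have key : ∀ η > 0, |divergenceDefect n Ω N v g| ≤ η * (‖v‖ * (3 * M * A)) := by
    intro η hη
    choose r hr hloc using exists_ball_abs_divergenceDefect_le hn hΩ hc hNc hN hη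
    obtain ⟨t, -, ht⟩ := hgc.isCompact.elim_nhds_subcover (fun x => Metric.ball x (r x))
      fun x _ => Metric.ball_mem_nhds x (hr x)
    obtain ⟨p, hp⟩ := SmoothPartitionOfUnity.exists_isSubordinate (𝓘(ℝ, Rd d)) hgc.isCompact.isClosed
      (fun i : t => Metric.ball (i : Rd d) (r i)) (fun i => Metric.isOpen_ball) (by
        intro y hy
        obtain ⟨x, hxt, hx⟩ := mem_iUnion₂.1 (ht hy)
        exact mem_iUnion.2 ⟨⟨x, hxt⟩, hx⟩)
    have hpc : ∀ i, ContDiff ℝ 1 (p i) := fun i => (p i).contMDiff.contDiff.of_le (by simp)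
    have hps : ∀ i, HasCompactSupport (p i) := fun i =>
      (isCompact_closedBall (i : Rd d) (r i)).of_isClosed_subset (isClosed_tsupport _)
        ((hp i).trans Metric.ball_subset_closedBall)
    have hp1 : ∀ y ∈ tsupport g, ∑ i, p i y = 1 := fun y hy => by
      rw [← finsum_eq_sum_of_fintype]; exact p.sum_eq_one hy
    have hple : ∀ y, ∑ i, p i y ≤ 1 := fun y => by
      rw [← finsum_eq_sum_of_fintype]; exact p.sum_le_one y
    have hgsum : g = fun y => ∑ i, p i y * g y := by
      ext y
      rw [← Finset.sum_mul]
      by_cases hy : y ∈ tsupport g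
      · rw [hp1 y hy, one_mul]
      · rw [image_eq_zero_of_notMem_tsupport hy, mul_zero]
    have hpg : ∀ i, ContDiff ℝ 1 (fun y => p i y * g y) := fun i => (hpc i).mul hg
    have hterm : ∀ i, |divergenceDefect n Ω N v (fun y => p i y * g y)|
        ≤ η * ‖v‖ * (3 * M * ∫ y, p i y ∂(surfaceMeasure n Ω)) := fun i => by
      have hpi : Integrable (p i) (surfaceMeasure n Ω) :=
        (hpc i).continuous.integrable_of_hasCompactSupport (hps i)
      -- the local estimate is for nonnegative functions, and `g` need not have a sign
      have e1 : (fun y => p i y * g y) = fun y => p i y * (g y + M) - p i y * M := by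
        ext y; ring
      have c1 : ContDiff ℝ 1 (fun y => p i y * (g y + M)) := (hpc i).mul (hg.add contDiff_const)
      have c2 : ContDiff ℝ 1 (fun y => p i y * M) := (hpc i).mul contDiff_const
      have s1 : HasCompactSupport (fun y => p i y * (g y + M)) := (hps i).mul_right
      have s2 : HasCompactSupport (fun y => p i y * M) := (hps i).mul_right
      rw [e1, divergenceDefect_sub hNc c1 c2 s1 s2]
      have b1 := hloc i _ c1 s1 ((tsupport_mul_subset_left).trans (hp i)) (fun y =>
        mul_nonneg (p.nonneg i y) (by linarith [neg_le_of_abs_le (hM y)])) v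
      have b2 := hloc i _ c2 s2 ((tsupport_mul_subset_left).trans (hp i)) (fun y =>
        mul_nonneg (p.nonneg i y) hM0) v
      have m1 : ∫ y, p i y * (g y + M) ∂(surfaceMeasure n Ω)
          ≤ ∫ y, p i y * (2 * M) ∂(surfaceMeasure n Ω) := by
        refine integral_mono (c1.continuous.integrable_of_hasCompactSupport s1)
          (hpi.mul_const _) fun y => ?_
        exact mul_le_mul_of_nonneg_left (by linarith [le_of_abs_le (hM y)]) (p.nonneg i y)
      rw [integral_mul_const] at m1 b2
      have h0 : 0 ≤ η * ‖v‖ := by positivity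
      refine (abs_sub _ _).trans ((add_le_add b1 b2).trans ?_)
      rw [← mul_add]
      exact mul_le_mul_of_nonneg_left (by linarith) h0
    have hsumle : ∑ i, ∫ y, p i y ∂(surfaceMeasure n Ω) ≤ A := by
      rw [← integral_finsetSum _ fun i _ =>
        (hpc i).continuous.integrable_of_hasCompactSupport (hps i)]
      calc ∫ y, ∑ i, p i y ∂(surfaceMeasure n Ω) ≤ ∫ y, (1 : ℝ) ∂(surfaceMeasure n Ω) :=
            integral_mono (integrable_finsetSum _ fun i _ =>
              (hpc i).continuous.integrable_of_hasCompactSupport (hps i)) (integrable_const _) hple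
        _ = A := by simp [hA]
    rw [hgsum, divergenceDefect_sum hNc _ (fun i _ => hpg i) fun i _ => (hps i).mul_right]
    calc |∑ i, divergenceDefect n Ω N v (fun y => p i y * g y)|
        ≤ ∑ i, η * ‖v‖ * (3 * M * ∫ y, p i y ∂(surfaceMeasure n Ω)) :=
          (Finset.abs_sum_le_sum_abs _ _).trans (Finset.sum_le_sum fun i _ => hterm i)
      _ = η * ‖v‖ * (3 * M * ∑ i, ∫ y, p i y ∂(surfaceMeasure n Ω)) := by
          rw [Finset.mul_sum, Finset.mul_sum]
      _ ≤ η * ‖v‖ * (3 * M * A) := by gcongr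
      _ = _ := by ring
  by_contra hne
  have hpos : 0 < |divergenceDefect n Ω N v g| := abs_pos.2 hne
  have h1 := key (|divergenceDefect n Ω N v g| / (2 * (‖v‖ * (3 * M * A) + 1))) (by positivity)
  rw [div_mul_eq_mul_div, le_div_iff₀ (by positivity)] at h1
  have : 0 ≤ ‖v‖ * (3 * M * A) := by positivity
  nlinarith

/-- The distributional gradient of the characteristic function of a regular open set is the
surface measure with the exterior unit normal. -/
theorem isPolarGradient_charFn (hn : d = n + 1) (hΩ : IsOpen Ω)
    (hc : IsCompact (frontier Ω)) (hNc : Continuous N)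
    (hN : ∀ x ∈ frontier Ω, IsExteriorUnitNormal Ω x (N x)) :
    IsPolarGradient (charFn Ω) (surfaceMeasure n Ω) N where
  finite := ⟨surfaceMeasure_univ_lt_top hn hΩ hc hN⟩
  measurable := hNc.measurable
  norm_eq_one := by
    filter_upwards [ae_restrict_mem isClosed_frontier.measurableSet] with y hy
    exact (hN y hy).norm_eq_one
  integral_divergence φ hφ hφc := by
    have hfin : IsFiniteMeasure (surfaceMeasure n Ω) := ⟨surfaceMeasure_univ_lt_top hn hΩ hc hN⟩
    have hφi : ∀ i, ContDiff ℝ 1 (fun y => φ y i) := fun i => by fun_prop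
    have hφs : ∀ i, HasCompactSupport (fun y => φ y i) := fun i =>
      hφc.comp_left (g := fun v : Rd d => v i) rfl
    have h1 : ∫ y, charFn Ω y * divergence φ y = ∫ y in Ω, divergence φ y := by
      rw [← integral_indicator hΩ.measurableSet]
      congr 1; ext y
      by_cases hy : y ∈ Ω <;> simp [charFn, hy]
    have h2 : ∀ i : Fin d, ∫ y in Ω, fderiv ℝ (fun y => φ y i) y (EuclideanSpace.single i 1)
        = ∫ y, φ y i * inner ℝ (N y) (EuclideanSpace.single i 1) ∂(surfaceMeasure n Ω) := fun i =>
      sub_eq_zero.1 (divergenceDefect_eq_zero hn hΩ hc hNc hN (hφi i) (hφs i) _)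
    rw [h1]
    simp only [divergence_eq_sum_coord (hφ.differentiable one_ne_zero _)]
    have h3 : ∀ i : Fin d, Integrable
        (fun y => φ y i * inner ℝ (N y) (EuclideanSpace.single i 1)) (surfaceMeasure n Ω) :=
      fun i => ((hφi i).continuous.mul
        (hNc.inner continuous_const)).integrable_of_hasCompactSupport (hφs i).mul_right
    rw [integral_finsetSum _ fun i _ =>
      (integrable_fderiv_apply (hφi i) (hφs i) (EuclideanSpace.single i 1)).integrableOn,
      Finset.sum_congr rfl fun i _ => h2 i, ← integral_finsetSum _ fun i _ => h3 i]
    congr 1; ext y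
    simp [PiLp.inner_apply]

/-- A set of finite codimension-one measure is Lebesgue null. -/
theorem volume_frontier_eq_zero (hn : d = n + 1) (hΩ : IsOpen Ω)
    (hc : IsCompact (frontier Ω)) (hN : ∀ x ∈ frontier Ω, IsExteriorUnitNormal Ω x (N x)) :
    volume (frontier Ω) = 0 := by
  have h1 := surfaceMeasure_univ_lt_top hn hΩ hc hN
  rw [surfaceMeasure, Measure.restrict_apply_univ] at h1
  have h2 : (μHE[d] : Measure (Rd d)) = volume :=
    EuclideanSpace.euclideanHausdorffMeasure_eq_volume d
  rw [← h2]
  exact (Measure.euclideanHausdorffMeasure_zero_or_top (show n < d by omega) _).resolve_right h1.ne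

end Divergence

/-! ### Measurable dependence of the perimeter measures on time -/

section

variable {d : ℕ}

theorem IsBV.isFiniteMeasure {u : Rd d → ℝ} (h : IsBV u) : IsFiniteMeasure (gradMeasure u) :=
  h.isPolarGradient.finite

theorem IsPolarGradient.congr {u u' : Rd d → ℝ} {μ : Measure (Rd d)} {ν : Rd d → Rd d}
    (h : IsPolarGradient u μ ν) (huu' : u =ᵐ[volume] u') : IsPolarGradient u' μ ν where
  finite := h.finite
  measurable := h.measurable
  norm_eq_one := h.norm_eq_one
  integral_divergence φ hφ hc := by
    rw [← h.integral_divergence φ hφ hc]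
    refine integral_congr_ae ?_
    filter_upwards [huu'] with x hx
    rw [hx]

namespace IsDistributionalSolution

variable {Tstar : ℝ} {χ V : ℝ → Rd d → ℝ} {lam Clam : ℝ → ℝ}

theorem exists_measurable_version (hs : IsDistributionalSolution Tstar χ V lam Clam) :
    ∃ g : ℝ × Rd d → ℝ, Measurable g ∧
      ∀ᵐ t ∂(volume.restrict (Ioo 0 Tstar)), ∀ᵐ x, χ t x = g (t, x) := by
  obtain ⟨g, hg, h⟩ := hs.aemeasurable
  refine ⟨g, hg, ?_⟩
  rw [Measure.volume_eq_prod, ← Measure.prod_restrict, Measure.restrict_univ] at h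
  exact Measure.ae_ae_of_ae_prod h

theorem gradMeasure_univ_le (hs : IsDistributionalSolution Tstar χ V lam Clam) :
    ∀ᵐ t ∂(volume.restrict (Ioo 0 Tstar)), gradMeasure (χ t) univ ≤ gradMeasure (χ 0) univ := by
  filter_upwards [hs.dissipation] with t ht
  exact le_self_add.trans ht

/-- The perimeter measures `|∇χ(·, t)|` form, up to a null set of times, a finite measurable
kernel: on open sets they are suprema of countably many integrals of `χ(·, t)`. -/
theorem exists_kernel (hs : IsDistributionalSolution Tstar χ V lam Clam) :
    ∃ κ : ProbabilityTheory.Kernel ℝ (Rd d), ProbabilityTheory.IsFiniteKernel κ ∧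
      ∀ᵐ t ∂(volume.restrict (Ioo 0 Tstar)), κ t = gradMeasure (χ t) := by
  classical
  obtain ⟨g, hg, hχg⟩ := hs.exists_measurable_version
  have hM : gradMeasure (χ 0) univ < ∞ := by
    have := hs.bv_zero.isFiniteMeasure
    exact measure_lt_top _ _
  have hgood : ∀ᵐ t ∂(volume.restrict (Ioo 0 Tstar)), IsBV (χ t) ∧ (∀ᵐ x, χ t x = g (t, x)) ∧
      gradMeasure (χ t) univ ≤ gradMeasure (χ 0) univ :=
    hs.bv.and (hχg.and hs.gradMeasure_univ_le)
  obtain ⟨G, hG, hGm, hGsub⟩ : ∃ G ∈ ae (volume.restrict (Ioo 0 Tstar)), MeasurableSet G ∧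
      ∀ t ∈ G, IsBV (χ t) ∧ (∀ᵐ x, χ t x = g (t, x)) ∧
      gradMeasure (χ t) univ ≤ gradMeasure (χ 0) univ := by
    obtain ⟨G, hG, hGm, h⟩ := exists_measurable_superset_of_null (ae_iff.1 hgood)
    refine ⟨Gᶜ, ?_, hGm.compl, fun t ht => ?_⟩
    · rwa [mem_ae_iff, compl_compl]
    · by_contra hcon
      exact ht (hG hcon)
  set m : ℝ → Measure (Rd d) := fun t => if t ∈ G then gradMeasure (χ t) else 0 with hm
  have hmle : ∀ t, m t univ ≤ gradMeasure (χ 0) univ := by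
    intro t
    by_cases ht : t ∈ G
    · simpa [hm, ht] using (hGsub t ht).2.2
    · simp [hm, ht]
  have hmfin : ∀ t, IsFiniteMeasure (m t) := fun t => ⟨(hmle t).trans_lt hM⟩
  have hopen : ∀ U : Set (Rd d), IsOpen U → Measurable fun t => m t U := by
    intro U hU
    obtain ⟨D, hD, hDc, hsup⟩ := exists_countable_testFields hU
    have heq : (fun t => m t U) = G.indicator
        (fun t => ⨆ φ ∈ D, ENNReal.ofReal (∫ x, g (t, x) * divergence φ x)) := by
      funext t
      by_cases ht : t ∈ G
      · obtain ⟨h1, h2, -⟩ := hGsub t ht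
        simp only [hm, ht, if_true, indicator_of_mem]
        exact hsup _ _ _ (h1.isPolarGradient.congr h2)
      · simp [hm, ht]
    rw [heq]
    refine Measurable.indicator ?_ hGm
    refine Measurable.biSup D hDc fun φ hφ => ?_
    refine ENNReal.measurable_ofReal.comp ?_
    refine StronglyMeasurable.measurable (StronglyMeasurable.integral_prod_right'
      (f := fun p : ℝ × Rd d => g p * divergence φ p.2) ?_)
    refine (hg.mul ?_).stronglyMeasurable
    have : Continuous (divergence φ) := continuous_divergence (hD hφ).1
    exact this.measurable.comp measurable_snd
  have hmm : Measurable m := by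
    refine Measurable.measure_of_isPiSystem (S := {U : Set (Rd d) | IsOpen U})
      (BorelSpace.measurable_eq) isPiSystem_isOpen ?_ ?_
    · intro U hU
      exact hopen U hU
    · exact hopen univ isOpen_univ
  refine ⟨⟨m, hmm⟩, ⟨_, hM, hmle⟩, ?_⟩
  filter_upwards [hG] with t ht
  simp [hm, ht]

end IsDistributionalSolution

/-! ### The space-time perimeter measure and weak normal velocities -/

theorem exists_mem_Ioo_of_ae {a b T : ℝ} (ha : 0 ≤ a) (hab : a < b) (hb : b ≤ T) {P : ℝ → Prop}
    (hP : ∀ᵐ t ∂(volume.restrict (Ioo 0 T)), P t) : ∃ t ∈ Ioo a b, P t := by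
  have h1 : ∀ᵐ t ∂(volume.restrict (Ioo a b)), P t :=
    ae_restrict_of_ae_restrict_of_subset (Ioo_subset_Ioo ha hb) hP
  have h2 : (ae (volume.restrict (Ioo a b))).NeBot := by
    rw [ae_neBot, Ne, Measure.restrict_eq_zero, Real.volume_Ioo]
    simpa using hab
  obtain ⟨t, ht⟩ := ((ae_restrict_mem measurableSet_Ioo).and h1).exists
  exact ⟨t, ht⟩

namespace IsDistributionalSolution

variable {Tstar : ℝ} {χ V : ℝ → Rd d → ℝ} {lam Clam : ℝ → ℝ}

/-- A measurable kernel that agrees with the perimeter measures `|∇χ(·, t)|` at almost every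
time. -/
def kernel (hs : IsDistributionalSolution Tstar χ V lam Clam) : ProbabilityTheory.Kernel ℝ (Rd d) :=
  hs.exists_kernel.choose

theorem isFiniteKernel (hs : IsDistributionalSolution Tstar χ V lam Clam) :
    ProbabilityTheory.IsFiniteKernel hs.kernel := hs.exists_kernel.choose_spec.1

theorem kernel_ae_eq (hs : IsDistributionalSolution Tstar χ V lam Clam) :
    ∀ᵐ t ∂(volume.restrict (Ioo 0 Tstar)), hs.kernel t = gradMeasure (χ t) :=
  hs.exists_kernel.choose_spec.2

/-- The space-time perimeter measure `|∇χ(·, t)| dt`. -/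
def perimeter (hs : IsDistributionalSolution Tstar χ V lam Clam) : Measure (ℝ × Rd d) :=
  (volume.restrict (Ioo 0 Tstar)).compProd hs.kernel

theorem isFiniteMeasure_perimeter (hs : IsDistributionalSolution Tstar χ V lam Clam) :
    IsFiniteMeasure hs.perimeter := by
  have := hs.isFiniteKernel
  unfold perimeter
  infer_instance

/-- The total dissipation up to the final time, as the limit of the dissipation up to almost every
earlier time. -/
theorem lintegral_sq_le (hs : IsDistributionalSolution Tstar χ V lam Clam) (hT : 0 < Tstar) :
    ∫⁻ t in Ioo 0 Tstar, ∫⁻ x, ENNReal.ofReal (V t x ^ 2) ∂(gradMeasure (χ t))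
      ≤ gradMeasure (χ 0) univ := by
  have hU : Ioo 0 Tstar = ⋃ n : ℕ, Ioo 0 (Tstar - 1 / (n + 1)) := by
    ext t
    simp only [mem_Ioo, mem_iUnion]
    constructor
    · rintro ⟨h1, h2⟩
      obtain ⟨n, hn⟩ := exists_nat_one_div_lt (sub_pos.2 h2)
      exact ⟨n, h1, by linarith⟩
    · rintro ⟨n, h1, h2⟩
      have : (0:ℝ) < 1 / (n + 1) := by positivity
      exact ⟨h1, by linarith⟩
  rw [hU, setLIntegral_iUnion_of_directed]
  · refine iSup_le fun n => ?_
    have hn : (0:ℝ) < 1 / (n + 1) := by positivity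
    obtain ⟨t, ht, htd⟩ := exists_mem_Ioo_of_ae (a := max 0 (Tstar - 1 / (n + 1))) (b := Tstar)
      (le_max_left _ _) (max_lt hT (by linarith)) le_rfl hs.dissipation
    refine le_trans (lintegral_mono_set (Ioo_subset_Ioo_right ?_)) (le_add_self.trans htd)
    exact (le_max_right _ _).trans ht.1.le
  · refine Monotone.directed_le fun m n hmn => Ioo_subset_Ioo_right ?_
    have : (1:ℝ) / (n + 1) ≤ 1 / (m + 1) := by
      apply one_div_le_one_div_of_le (by positivity)
      have : (m:ℝ) ≤ n := by exact_mod_cast hmn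
      linarith
    linarith

theorem memLp_two (hs : IsDistributionalSolution Tstar χ V lam Clam) (hT : 0 < Tstar) :
    MemLp (Function.uncurry V) 2 hs.perimeter := by
  have := hs.isFiniteKernel
  rw [memLp_two_iff_integrable_sq hs.V_measurable.aestronglyMeasurable]
  refine ⟨(hs.V_measurable.pow_const 2).aestronglyMeasurable, ?_⟩
  have hM : gradMeasure (χ 0) univ < ∞ := by
    have := hs.bv_zero.isFiniteMeasure
    exact measure_lt_top _ _
  rw [hasFiniteIntegral_iff_ofReal (ae_of_all _ fun p => sq_nonneg _), perimeter,
    Measure.lintegral_compProd (hs.V_measurable.pow_const 2).ennreal_ofReal]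
  refine lt_of_le_of_lt ?_ hM
  refine le_trans (le_of_eq ?_) (hs.lintegral_sq_le hT)
  refine lintegral_congr_ae ?_
  filter_upwards [hs.kernel_ae_eq] with t ht
  rw [ht]
  rfl

theorem ae_memLp_two (hs : IsDistributionalSolution Tstar χ V lam Clam) (hT : 0 < Tstar) :
    ∀ᵐ t ∂(volume.restrict (Ioo 0 Tstar)), MemLp (V t) 2 (gradMeasure (χ t)) := by
  have := hs.isFiniteKernel
  have h := (memLp_two_iff_integrable_sq hs.V_measurable.aestronglyMeasurable).1 (hs.memLp_two hT)
  rw [perimeter, Measure.integrable_compProd_iff h.1] at h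
  filter_upwards [h.1, hs.kernel_ae_eq] with t ht hκ
  rw [hκ] at ht
  exact (memLp_two_iff_integrable_sq
    (hs.V_measurable.comp measurable_prodMk_left).aestronglyMeasurable).2 ht

theorem integrable_mul_V (hs : IsDistributionalSolution Tstar χ V lam Clam) (hT : 0 < Tstar)
    {f : ℝ × Rd d → ℝ} (hf : Measurable f) {M : ℝ} (hM : ∀ p, |f p| ≤ M) :
    Integrable (fun p => f p * V p.1 p.2) hs.perimeter := by
  have := hs.isFiniteMeasure_perimeter
  have h1 : Integrable (Function.uncurry V) hs.perimeter :=
    (hs.memLp_two hT).integrable one_le_two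
  exact h1.bdd_mul (c := M) hf.aestronglyMeasurable (ae_of_all _ hM)

theorem setIntegral_perimeter (hs : IsDistributionalSolution Tstar χ V lam Clam)
    {f : ℝ × Rd d → ℝ} (hf : Integrable f hs.perimeter) {T : ℝ} (hT : T ≤ Tstar) :
    ∫ t in Ioo 0 T, ∫ x, f (t, x) ∂(gradMeasure (χ t))
      = ∫ p in Ioo 0 T ×ˢ univ, f p ∂hs.perimeter := by
  have := hs.isFiniteKernel
  rw [perimeter, Measure.setIntegral_compProd measurableSet_Ioo MeasurableSet.univ
    hf.integrableOn, Measure.restrict_restrict measurableSet_Ioo,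
    inter_eq_left.2 (Ioo_subset_Ioo_right hT)]
  refine integral_congr_ae ?_
  filter_upwards [ae_restrict_of_ae_restrict_of_subset (Ioo_subset_Ioo_right hT) hs.kernel_ae_eq]
    with t ht
  rw [ht, Measure.restrict_univ]

theorem integrable_integral_perimeter (hs : IsDistributionalSolution Tstar χ V lam Clam)
    {f : ℝ × Rd d → ℝ} (hf : Integrable f hs.perimeter) :
    IntegrableOn (fun t => ∫ x, f (t, x) ∂(gradMeasure (χ t))) (Ioo 0 Tstar) := by
  have := hs.isFiniteKernel
  refine Integrable.congr (Integrable.integral_compProd hf) ?_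
  filter_upwards [hs.kernel_ae_eq] with t ht
  simp only [ProbabilityTheory.Kernel.prodMkLeft_apply, ht]

theorem integrable_chi (hs : IsDistributionalSolution Tstar χ V lam Clam) :
    Integrable (Function.uncurry χ)
      ((volume.restrict (Ioo 0 Tstar)).prod (volume : Measure (Rd d))) := by
  have hm : AEStronglyMeasurable (Function.uncurry χ)
      ((volume.restrict (Ioo 0 Tstar)).prod (volume : Measure (Rd d))) := by
    have h := hs.aemeasurable.aestronglyMeasurable
    rwa [Measure.volume_eq_prod, ← Measure.prod_restrict, Measure.restrict_univ] at h
  rw [integrable_prod_iff hm]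
  refine ⟨?_, ?_⟩
  · filter_upwards [hs.bv] with t ht
    exact ht.1
  · refine (integrable_const (∫ x, χ 0 x)).congr ?_
    filter_upwards [hs.volume_eq, ae_restrict_mem measurableSet_Ioo] with t ht htI
    rw [← ht]
    refine integral_congr_ae (ae_of_all _ fun x => ?_)
    rcases hs.values t ⟨htI.1.le, htI.2⟩ x with h | h <;> simp [h]

theorem integrable_chi_mul (hs : IsDistributionalSolution Tstar χ V lam Clam)
    {f : ℝ × Rd d → ℝ} (hf : AEStronglyMeasurable f
      ((volume.restrict (Ioo 0 Tstar)).prod (volume : Measure (Rd d)))) {M : ℝ}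
      (hM : ∀ᵐ p ∂((volume.restrict (Ioo 0 Tstar)).prod (volume : Measure (Rd d))), |f p| ≤ M) :
    Integrable (fun p => χ p.1 p.2 * f p)
      ((volume.restrict (Ioo 0 Tstar)).prod (volume : Measure (Rd d))) :=
  hs.integrable_chi.mul_bdd (c := M) hf hM

/-- Fubini's theorem on a time slab contained in `(0, Tstar) × ℝ^d`. -/
theorem setIntegral_prod_Ioo {f : ℝ × Rd d → ℝ} (hf : Integrable f
      ((volume.restrict (Ioo 0 Tstar)).prod (volume : Measure (Rd d)))) {T : ℝ} (hT : T ≤ Tstar) :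
    ∫ t in Ioo 0 T, ∫ x, f (t, x)
      = ∫ p in Ioo 0 T ×ˢ univ, f p
        ∂((volume.restrict (Ioo 0 Tstar)).prod (volume : Measure (Rd d))) := by
  rw [setIntegral_prod _ hf.integrableOn, Measure.restrict_restrict measurableSet_Ioo,
    inter_eq_left.2 (Ioo_subset_Ioo_right hT), Measure.restrict_univ]

end IsDistributionalSolution

/-- The pair `(f, D)`, with `D` in the role of `∂ₜf`, satisfies the weak form of the statement that
`V` is the normal velocity of `χ`. -/
def HasWeakVelocity (Tstar : ℝ) (χ V : ℝ → Rd d → ℝ) (f D : ℝ × Rd d → ℝ) : Prop :=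
  ∀ᵐ T' ∂(volume.restrict (Ioo 0 Tstar)),
    (∫ x, f (T', x) * χ T' x) - ∫ x, f (0, x) * χ 0 x
      = (∫ t in Ioo 0 T', ∫ x, χ t x * D (t, x))
        + ∫ t in Ioo 0 T', ∫ x, f (t, x) * V t x ∂(gradMeasure (χ t))

namespace IsDistributionalSolution

variable {Tstar : ℝ} {χ V : ℝ → Rd d → ℝ} {lam Clam : ℝ → ℝ}

/-- The weak velocity equation is stable under bounded pointwise convergence of the test functions
and of their time derivatives, where the latter may fail to converge on a null set of space-time.
-/
theorem hasWeakVelocity_of_tendsto (hs : IsDistributionalSolution Tstar χ V lam Clam)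
    (hT : 0 < Tstar) {f D : ℝ × Rd d → ℝ} {F G : ℕ → ℝ × Rd d → ℝ}
    (hFG : ∀ n, HasWeakVelocity Tstar χ V (F n) (G n)) (hF : ∀ n, Measurable (F n))
    (hG : ∀ n, Measurable (G n)) {M : ℝ} (hFM : ∀ n p, |F n p| ≤ M) (hGM : ∀ n p, |G n p| ≤ M)
    (hlim : ∀ p, Tendsto (fun n => F n p) atTop (𝓝 (f p)))
    (hlim' : ∀ᵐ p, Tendsto (fun n => G n p) atTop (𝓝 (D p))) :
    HasWeakVelocity Tstar χ V f D := by
  set π : Measure (ℝ × Rd d) := (volume.restrict (Ioo 0 Tstar)).prod volume with hπ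
  have hfm : Measurable f := measurable_of_tendsto_metrizable hF (tendsto_pi_nhds.2 hlim)
  have hfM : ∀ p, |f p| ≤ M := fun p => le_of_tendsto (hlim p).abs
    (Eventually.of_forall fun n => hFM n p)
  have hlimπ : ∀ᵐ p ∂π, Tendsto (fun n => G n p) atTop (𝓝 (D p)) := by
    have h2 := ae_restrict_of_ae (s := Ioo 0 Tstar ×ˢ univ) hlim'
    rwa [Measure.volume_eq_prod, ← Measure.prod_restrict, Measure.restrict_univ] at h2
  have hDm : AEStronglyMeasurable D π :=
    aestronglyMeasurable_of_tendsto_ae atTop (fun n => (hG n).aestronglyMeasurable) hlimπ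
  have hDM : ∀ᵐ p ∂π, |D p| ≤ M := by
    filter_upwards [hlimπ] with p hp
    exact le_of_tendsto hp.abs (Eventually.of_forall fun n => hGM n p)
  filter_upwards [ae_all_iff.2 hFG, hs.bv, ae_restrict_mem measurableSet_Ioo] with T' h hbv hT'
  have hvel : ∀ n, (∫ x, F n (T', x) * χ T' x) - ∫ x, F n (0, x) * χ 0 x
      = (∫ p in Ioo 0 T' ×ˢ univ, χ p.1 p.2 * G n p ∂π)
        + ∫ p in Ioo 0 T' ×ˢ univ, F n p * V p.1 p.2 ∂hs.perimeter := fun n => by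
    rw [h n]
    congr 1
    · exact setIntegral_prod_Ioo (f := fun p => χ p.1 p.2 * G n p)
        (hs.integrable_chi_mul (hG n).aestronglyMeasurable (ae_of_all _ (hGM n))) hT'.2.le
    · exact hs.setIntegral_perimeter (f := fun p => F n p * V p.1 p.2)
        (hs.integrable_mul_V hT (hF n) (hFM n)) hT'.2.le
  rw [setIntegral_prod_Ioo (f := fun p => χ p.1 p.2 * D p)
      (hs.integrable_chi_mul hDm hDM) hT'.2.le,
    hs.setIntegral_perimeter (f := fun p => f p * V p.1 p.2)
      (hs.integrable_mul_V hT hfm hfM) hT'.2.le]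
  have hspace : ∀ (t : ℝ) (u : Rd d → ℝ), Integrable u →
      Tendsto (fun n => ∫ x, F n (t, x) * u x) atTop (𝓝 (∫ x, f (t, x) * u x)) := by
    intro t u hu
    refine tendsto_integral_of_dominated_convergence (fun x => M * ‖u x‖) (fun n => ?_)
      (hu.norm.const_mul M) (fun n => ae_of_all _ fun x => ?_) (ae_of_all _ fun x => ?_)
    · exact ((hF n).comp measurable_prodMk_left).aestronglyMeasurable.mul hu.1
    · rw [norm_mul]
      exact mul_le_mul_of_nonneg_right (hFM n _) (norm_nonneg _)
    · exact (hlim _).mul_const _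
  refine tendsto_nhds_unique ((hspace T' _ hbv.1).sub (hspace 0 _ hs.bv_zero.1)) ?_
  simp_rw [hvel]
  refine Tendsto.add ?_ ?_
  · refine tendsto_integral_of_dominated_convergence (fun p => ‖χ p.1 p.2‖ * M) (fun n => ?_)
      ((hs.integrable_chi.norm.mul_const M).integrableOn) (fun n => ae_of_all _ fun p => ?_) ?_
    · exact (hs.integrable_chi_mul (hG n).aestronglyMeasurable
        (ae_of_all _ (hGM n))).integrableOn.1
    · rw [norm_mul]
      exact mul_le_mul_of_nonneg_left (hGM n _) (norm_nonneg _)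
    · filter_upwards [ae_restrict_of_ae hlimπ] with p hp
      exact hp.const_mul _
  · have hVi := (hs.integrable_mul_V hT (f := fun _ => 1) measurable_const (M := 1) (by simp))
    refine tendsto_integral_of_dominated_convergence (fun p => M * ‖V p.1 p.2‖) (fun n => ?_)
      (((by simpa using hVi : Integrable (fun p => V p.1 p.2) hs.perimeter).norm.const_mul
        M).integrableOn) (fun n => ae_of_all _ fun p => ?_) (ae_of_all _ fun p => ?_)
    · exact (hs.integrable_mul_V hT (hF n) (hFM n)).integrableOn.1
    · rw [norm_mul]
      exact mul_le_mul_of_nonneg_right (hFM n _) (norm_nonneg _)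
    · exact (hlim _).mul_const _

end IsDistributionalSolution

end

/-! ### The velocity equation for Lipschitz test functions -/

section

variable {d : ℕ}

theorem hasFDerivAt_slice {F : Type*} [NormedAddCommGroup F] [NormedSpace ℝ F] {f : ℝ × Rd d → F}
    {t : ℝ} {x : Rd d} (hf : DifferentiableAt ℝ f (t, x)) :
    HasFDerivAt (fun y => f (t, y))
      ((fderiv ℝ f (t, x)).comp (ContinuousLinearMap.inr ℝ ℝ (Rd d))) x :=
  HasFDerivAt.comp x (g := f) (f := fun y => (t, y)) hf.hasFDerivAt (hasFDerivAt_prodMk_right t x)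

theorem hasDerivAt_slice {F : Type*} [NormedAddCommGroup F] [NormedSpace ℝ F] {f : ℝ × Rd d → F}
    {t : ℝ} {x : Rd d} (hf : DifferentiableAt ℝ f (t, x)) :
    HasDerivAt (fun s => f (s, x)) (fderiv ℝ f (t, x) (1, 0)) t :=
  (HasFDerivAt.comp t (g := f) (f := fun s => (s, x)) hf.hasFDerivAt
    (hasFDerivAt_prodMk_left t x)).hasDerivAt

theorem fderiv_slice {F : Type*} [NormedAddCommGroup F] [NormedSpace ℝ F] {f : ℝ × Rd d → F}
    {t : ℝ} {x : Rd d} (hf : DifferentiableAt ℝ f (t, x)) (v : Rd d) :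
    fderiv ℝ (fun y => f (t, y)) x v = fderiv ℝ f (t, x) (0, v) := by
  rw [(hasFDerivAt_slice hf).fderiv]
  simp

instance isAddHaarMeasure_prod : (volume : Measure (ℝ × Rd d)).IsAddHaarMeasure := by
  rw [Measure.volume_eq_prod]
  infer_instance

theorem norm_one_zero_le : ‖((1 : ℝ), (0 : Rd d))‖ ≤ 1 := by simp [Prod.norm_def]

theorem abs_fderiv_time_le {f : ℝ × Rd d → ℝ} {K : ℝ≥0} (hf : LipschitzWith K f) (p : ℝ × Rd d) :
    |fderiv ℝ f p (1, 0)| ≤ K := by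
  have h := (fderiv ℝ f p).le_of_opNorm_le (norm_fderiv_le_of_lipschitz ℝ hf) (1, 0)
  calc |fderiv ℝ f p (1, 0)| ≤ K * ‖((1 : ℝ), (0 : Rd d))‖ := h
    _ ≤ K * 1 := by gcongr; exact norm_one_zero_le
    _ = K := mul_one _

namespace IsDistributionalSolution

variable {Tstar : ℝ} {χ V : ℝ → Rd d → ℝ} {lam Clam : ℝ → ℝ}

theorem hasWeakVelocity_C1 (hs : IsDistributionalSolution Tstar χ V lam Clam)
    {f : ℝ × Rd d → ℝ} (hf : ContDiff ℝ 1 f) (hc : HasCompactSupport f) :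
    HasWeakVelocity Tstar χ V f (fun p => fderiv ℝ f p (1, 0)) := by
  filter_upwards [hs.velocity (fun t x => f (t, x)) hf hc] with T h
  rw [h]
  congr 1
  refine integral_congr_ae (ae_of_all _ fun t => integral_congr_ae (ae_of_all _ fun x => ?_))
  simp only
  rw [(hasDerivAt_slice (hf.differentiable one_ne_zero (t, x))).deriv]

/-- By mollification; the derivatives of the mollified function converge almost everywhere. -/
theorem hasWeakVelocity_lipschitz_of_hasCompactSupport
    (hs : IsDistributionalSolution Tstar χ V lam Clam) (hT : 0 < Tstar)
    {f : ℝ × Rd d → ℝ} {K : ℝ≥0} (hf : LipschitzWith K f) (hc : HasCompactSupport f) :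
    HasWeakVelocity Tstar χ V f (fun p => fderiv ℝ f p (1, 0)) := by
  obtain ⟨M, hM⟩ := hf.continuous.bounded_above_of_compact_support hc
  have hM0 : 0 ≤ M := (norm_nonneg _).trans (hM 0)
  set F := mollify (volume : Measure (ℝ × Rd d)) f with hFdef
  have hF : ∀ n, ContDiff ℝ 1 (F n) := fun n => (contDiff_mollify hf n).of_le (by simp)
  refine hs.hasWeakVelocity_of_tendsto hT (F := F) (G := fun n p => fderiv ℝ (F n) p (1, 0))
    (M := M + K) (fun n => hs.hasWeakVelocity_C1 (hF n) (hasCompactSupport_mollify hc n))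
    (fun n => (hF n).continuous.measurable) (fun n => measurable_fderiv_apply_const ℝ (F n) _)
    (fun n p => ?_) (fun n p => ?_) (fun p => tendsto_mollify hf p) ?_
  · have h1 := abs_mollify_sub_le (μ := volume) hf n p
    have h2 : (K : ℝ) * (1 / (n + 1)) ≤ K := by
      refine mul_le_of_le_one_right K.2 ?_
      rw [div_le_one (by positivity)]
      linarith [(Nat.cast_nonneg n : (0:ℝ) ≤ n)]
    have h3 := abs_le.1 (hM p)
    have h4 := abs_le.1 (h1.trans h2)
    rw [abs_le]
    constructor <;> linarith [h3.1, h3.2, h4.1, h4.2]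
  · exact (abs_fderiv_time_le (lipschitzWith_mollify hf n) p).trans (by linarith)
  · filter_upwards [ae_tendsto_fderiv_mollify (μ := volume) hf] with p hp
    exact ((ContinuousLinearMap.apply ℝ ℝ ((1 : ℝ), (0 : Rd d))).continuous.tendsto _).comp hp

/-- The velocity equation holds for bounded Lipschitz functions without compact support; in
particular it may be tested with constants. -/
theorem hasWeakVelocity_lipschitz (hs : IsDistributionalSolution Tstar χ V lam Clam)
    (hT : 0 < Tstar) {f : ℝ × Rd d → ℝ} {K : ℝ≥0} (hf : LipschitzWith K f) {M : ℝ}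
    (hM : ∀ p, |f p| ≤ M) :
    HasWeakVelocity Tstar χ V f (fun p => fderiv ℝ f p (1, 0)) := by
  have hM0 : 0 ≤ M := (abs_nonneg _).trans (hM 0)
  set η := cutoff (ℝ × Rd d) with hη
  set K' : ℝ≥0 := K + M.toNNReal * cutoffConst (ℝ × Rd d) with hK'
  have hlip : ∀ n, LipschitzWith K' (fun p => η n p * f p) := fun n => by
    refine LipschitzWith.of_dist_le_mul fun p q => ?_
    have h1 := (lipschitzWith_cutoff (E := ℝ × Rd d) n).dist_le_mul p q
    have h2 := hf.dist_le_mul p q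
    rw [Real.dist_eq] at *
    calc |η n p * f p - η n q * f q| = |η n p * (f p - f q) + f q * (η n p - η n q)| := by ring_nf
      _ ≤ |η n p| * |f p - f q| + |f q| * |η n p - η n q| := by
          rw [← abs_mul, ← abs_mul]; exact abs_add_le _ _
      _ ≤ 1 * (K * dist p q) + M * (cutoffConst (ℝ × Rd d) * dist p q) := by
          gcongr
          · exact abs_cutoff_le_one _ _
          · exact hM q
      _ = K' * dist p q := by
          rw [hK']; push_cast; rw [Real.coe_toNNReal M hM0]; ring
  refine hs.hasWeakVelocity_of_tendsto hT (F := fun n p => η n p * f p)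
    (G := fun n p => fderiv ℝ (fun p => η n p * f p) p (1, 0)) (M := M + K')
    (fun n => hs.hasWeakVelocity_lipschitz_of_hasCompactSupport hT (hlip n)
      (hasCompactSupport_cutoff n).mul_right)
    (fun n => (hlip n).continuous.measurable) (fun n => measurable_fderiv_apply_const ℝ _ _)
    (fun n p => ?_) (fun n p => ?_) (fun p => ?_) (ae_of_all _ fun p => ?_)
  · rw [abs_mul]
    calc |η n p| * |f p| ≤ 1 * M := by
          gcongr
          · exact abs_cutoff_le_one _ _
          · exact hM p
      _ ≤ M + K' := by rw [one_mul]; linarith [K'.2]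
  · exact (abs_fderiv_time_le (hlip n) p).trans (by linarith)
  · simpa using (tendsto_cutoff p).mul_const (f p)
  · refine tendsto_const_nhds.congr' ?_
    filter_upwards [eventually_cutoff_eq_one p] with n hn
    have : (fun p => η n p * f p) =ᶠ[𝓝 p] f := by
      filter_upwards [hn] with q hq
      rw [hη, hq]
      simp
    rw [this.fderiv_eq]

theorem integrableOn_integral_V (hs : IsDistributionalSolution Tstar χ V lam Clam)
    (hT : 0 < Tstar) :
    IntegrableOn (fun t => ∫ x, V t x ∂(gradMeasure (χ t))) (Ioo 0 Tstar) := by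
  have hi := hs.integrable_mul_V hT (f := fun _ => 1) measurable_const (M := 1) (by simp)
  simpa using hs.integrable_integral_perimeter hi

/-- The total normal velocity vanishes, since the enclosed volume is constant. -/
theorem integral_V_eq_zero (hs : IsDistributionalSolution Tstar χ V lam Clam) (hT : 0 < Tstar) :
    ∀ᵐ t ∂(volume.restrict (Ioo 0 Tstar)), ∫ x, V t x ∂(gradMeasure (χ t)) = 0 := by
  set v : ℝ → ℝ := fun t => ∫ x, V t x ∂(gradMeasure (χ t)) with hv
  have hvi : Integrable ((Ioo 0 Tstar).indicator v) :=
    (hs.integrableOn_integral_V hT).integrable_indicator measurableSet_Ioo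
  have h1 := hs.hasWeakVelocity_lipschitz hT (f := fun _ => 1) (K := 0)
    (LipschitzWith.const 1) (M := 1) (by simp)
  have hzero : ∀ᵐ T ∂(volume.restrict (Ioo 0 Tstar)),
      ∫ t in (0)..T, (Ioo 0 Tstar).indicator v t = 0 := by
    filter_upwards [h1, hs.volume_eq, ae_restrict_mem measurableSet_Ioo] with T h hvol hTI
    rw [intervalIntegral.integral_of_le hTI.1.le, integral_Ioc_eq_integral_Ioo,
      setIntegral_indicator measurableSet_Ioo,
      inter_eq_left.2 (Ioo_subset_Ioo_right hTI.2.le)]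
    simp only [one_mul, fderiv_fun_const, Pi.zero_apply, hvol, sub_self,
      zero_apply, mul_zero, integral_zero, zero_add] at h
    exact h.symm
  -- a continuous primitive that vanishes almost everywhere vanishes, and so does its derivative
  have hcont : Continuous fun T => ∫ t in (0)..T, (Ioo 0 Tstar).indicator v t :=
    intervalIntegral.continuous_primitive (fun a b => hvi.intervalIntegrable) 0
  have hall : ∀ T ∈ Ioo 0 Tstar, ∫ t in (0)..T, (Ioo 0 Tstar).indicator v t = 0 := by
    intro T hTI
    by_contra hne
    have hU : IsOpen {S | ∫ t in (0)..S, (Ioo 0 Tstar).indicator v t ≠ 0} :=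
      isOpen_ne.preimage hcont
    obtain ⟨ε, hε, hball⟩ := Metric.isOpen_iff.1 hU T hne
    obtain ⟨S, hS, hS0⟩ := exists_mem_Ioo_of_ae (a := T) (b := min (T + ε) Tstar) hTI.1.le
      (lt_min (by linarith) hTI.2) (min_le_right _ _) hzero
    refine hball ?_ hS0
    rw [Metric.mem_ball, Real.dist_eq, abs_lt]
    have := hS.2.trans_le (min_le_left _ _)
    constructor <;> linarith [hS.1]
  filter_upwards [ae_restrict_of_ae (LocallyIntegrable.ae_hasDerivAt_integral
    hvi.locallyIntegrable), ae_restrict_mem measurableSet_Ioo] with T hd hTI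
  have hd0 := hd 0
  have h0 : HasDerivAt (fun S => ∫ t in (0)..S, (Ioo 0 Tstar).indicator v t) 0 T := by
    refine (hasDerivAt_const T (0:ℝ)).congr_of_eventuallyEq ?_
    filter_upwards [isOpen_Ioo.mem_nhds hTI] with S hS
    exact hall S hS
  have := hd0.unique h0
  rwa [indicator_of_mem hTI] at this

end IsDistributionalSolution

/-! ### The velocity equation tested with a divergence -/

theorem divergence_sum_single {g : Fin d → Rd d → ℝ} {x : Rd d}
    (hg : ∀ i, DifferentiableAt ℝ (g i) x) :
    divergence (fun y => ∑ i, g i y • (EuclideanSpace.single i 1 : Rd d)) x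
      = ∑ i, fderiv ℝ (g i) x (EuclideanSpace.single i 1) := by
  have hc : ∀ i y, (∑ j, g j y • (EuclideanSpace.single j 1 : Rd d)) i = g i y := fun i y => by
    simp [Pi.single_apply]
  rw [divergence_eq_sum_coord]
  · simp_rw [hc]
  · exact DifferentiableAt.fun_sum fun i _ => (hg i).smul_const _

theorem hasCompactSupport_slice {F : Type*} [NormedAddCommGroup F] {f : ℝ × Rd d → F}
    (hc : HasCompactSupport f) (t : ℝ) : HasCompactSupport fun x => f (t, x) := by
  refine hc.comp_isClosedEmbedding (g := fun x : Rd d => (t, x)) ?_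
  refine Isometry.isClosedEmbedding (Isometry.of_dist_eq fun x y => ?_)
  simp [Prod.dist_eq]

theorem abs_fderiv_space_le {f : ℝ × Rd d → ℝ} {K : ℝ≥0} (hf : LipschitzWith K f) (p : ℝ × Rd d)
    (i : Fin d) : |fderiv ℝ f p (0, EuclideanSpace.single i 1)| ≤ K := by
  have h := (fderiv ℝ f p).le_of_opNorm_le (norm_fderiv_le_of_lipschitz ℝ hf)
    (0, EuclideanSpace.single i 1)
  calc |fderiv ℝ f p (0, EuclideanSpace.single i 1)|
      ≤ K * ‖((0 : ℝ), (EuclideanSpace.single i 1 : Rd d))‖ := h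
    _ ≤ K * 1 := by
        gcongr
        simp [Prod.norm_def]
    _ = K := mul_one _

theorem norm_sum_single_le {a : Fin d → ℝ} {c : ℝ} (h : ∀ i, |a i| ≤ c) :
    ‖∑ i, a i • (EuclideanSpace.single i 1 : Rd d)‖ ≤ d * c := by
  refine (norm_sum_le _ _).trans ?_
  calc ∑ i, ‖a i • (EuclideanSpace.single i 1 : Rd d)‖ ≤ ∑ _i : Fin d, c := by
        refine Finset.sum_le_sum fun i _ => ?_
        rw [norm_smul]
        simpa using h i
    _ = d * c := by simp

namespace IsDistributionalSolution

variable {Tstar : ℝ} {χ V : ℝ → Rd d → ℝ} {lam Clam : ℝ → ℝ}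

/-- Differentiating the velocity equation in space: its version for test fields tested against the
normal, obtained from the test function `∇ · X` with mollified `X`. -/
theorem velocity_normal (hs : IsDistributionalSolution Tstar χ V lam Clam) (hT : 0 < Tstar)
    {X : ℝ × Rd d → Rd d} {K : ℝ≥0} (hX : LipschitzWith K X) (hc : HasCompactSupport X)
    (hX' : ∀ t ∈ Ioo 0 Tstar, ∀ x, ContDiffAt ℝ 1 X (t, x)) :
    IntegrableOn (fun t => ∫ x, inner ℝ (extNormal (χ t) x) (fderiv ℝ X (t, x) (1, 0))
        ∂(gradMeasure (χ t))) (Ioo 0 Tstar) ∧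
    IntegrableOn (fun t => ∫ x, divergence (fun y => X (t, y)) x * V t x ∂(gradMeasure (χ t)))
      (Ioo 0 Tstar) ∧
    ∀ᵐ T ∂(volume.restrict (Ioo 0 Tstar)),
      (∫ x, inner ℝ (extNormal (χ T) x) (X (T, x)) ∂(gradMeasure (χ T)))
          - ∫ x, inner ℝ (extNormal (χ 0) x) (X (0, x)) ∂(gradMeasure (χ 0))
        = (∫ t in Ioo 0 T, ∫ x, inner ℝ (extNormal (χ t) x) (fderiv ℝ X (t, x) (1, 0))
            ∂(gradMeasure (χ t)))
          + ∫ t in Ioo 0 T, ∫ x, divergence (fun y => X (t, y)) x * V t x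
            ∂(gradMeasure (χ t)) := by
  set e : Fin d → Rd d := fun i => EuclideanSpace.single i 1 with he
  set f : Fin d → ℝ × Rd d → ℝ := fun i p => X p i with hf
  have hvec : ∀ v : Rd d, v = ∑ i, v i • e i := fun v => by
    conv_lhs => rw [← (EuclideanSpace.basisFun (Fin d) ℝ).sum_repr v]
    simp [he]
  have hfL : ∀ i, LipschitzWith K (f i) := fun i => LipschitzWith.of_dist_le_mul fun p q => by
    refine le_trans ?_ (hX.dist_le_mul p q)
    rw [Real.dist_eq, dist_eq_norm]
    simpa [hf] using PiLp.norm_apply_le (X p - X q) i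
  have hfc : ∀ i, HasCompactSupport (f i) := fun i =>
    hc.comp_left (g := fun v : Rd d => v i) rfl
  have hfC : ∀ i, ∀ t ∈ Ioo 0 Tstar, ∀ x, ContDiffAt ℝ 1 (f i) (t, x) := fun i t ht x =>
    (EuclideanSpace.proj (𝕜 := ℝ) i : Rd d →L[ℝ] ℝ).contDiff.contDiffAt.comp _ (hX' t ht x)
  have hfd : ∀ i, ∀ t ∈ Ioo 0 Tstar, ∀ x v, fderiv ℝ (f i) (t, x) v = (fderiv ℝ X (t, x) v) i := by
    intro i t ht x v
    have h1 : HasFDerivAt (f i) ((EuclideanSpace.proj (𝕜 := ℝ) i : Rd d →L[ℝ] ℝ).comp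
        (fderiv ℝ X (t, x))) (t, x) :=
      (EuclideanSpace.proj (𝕜 := ℝ) i : Rd d →L[ℝ] ℝ).hasFDerivAt.comp _
        ((hX' t ht x).differentiableAt one_ne_zero).hasFDerivAt
    rw [h1.fderiv]
    rfl
  obtain ⟨M, hM⟩ := hX.continuous.bounded_above_of_compact_support hc
  have hM0 : 0 ≤ M := (norm_nonneg _).trans (hM 0)
  have hfM : ∀ i p, |f i p| ≤ M := fun i p => (PiLp.norm_apply_le (X p) i).trans (hM p)
  set F : ℕ → Fin d → ℝ × Rd d → ℝ :=
    fun n i => mollify (volume : Measure (ℝ × Rd d)) (f i) n with hF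
  have hFM : ∀ n i p, |F n i p| ≤ M + K := fun n i p => by
    have h1 := abs_mollify_sub_le (μ := volume) (hfL i) n p
    have h2 : (K : ℝ) * (1 / (n + 1)) ≤ K := by
      refine mul_le_of_le_one_right K.2 ?_
      rw [div_le_one (by positivity)]
      linarith [(Nat.cast_nonneg n : (0:ℝ) ≤ n)]
    have h3 := abs_le.1 (hfM i p)
    have h4 := abs_le.1 (h1.trans h2)
    rw [abs_le]
    constructor <;> linarith [h3.1, h3.2, h4.1, h4.2]
  have hF2 : ∀ n i, ContDiff ℝ 2 (F n i) := fun n i =>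
    (contDiff_mollify (hfL i) n).of_le (WithTop.coe_le_coe.2 le_top)
  have hFd : ∀ n i, ContDiff ℝ 1 (fderiv ℝ (F n i)) := fun n i =>
    (hF2 n i).fderiv_right (by norm_num)
  have hFv : ∀ n i (v : ℝ × Rd d), ContDiff ℝ 1 (fun p => fderiv ℝ (F n i) p v) := fun n i v =>
    (hFd n i).clm_apply contDiff_const
  have hFc : ∀ n i, HasCompactSupport (F n i) := fun n i => hasCompactSupport_mollify (hfc i) n
  have hFvc : ∀ n i (v : ℝ × Rd d), HasCompactSupport (fun p => fderiv ℝ (F n i) p v) :=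
    fun n i v => (hFc n i).fderiv_apply ℝ v
  have hFL : ∀ n i, LipschitzWith K (F n i) := fun n i => lipschitzWith_mollify (hfL i) n
  -- the mollified field, its time derivative and its spatial divergence
  set Xn : ℕ → ℝ × Rd d → Rd d := fun n p => ∑ i, F n i p • e i with hXn
  set Dn : ℕ → ℝ × Rd d → Rd d := fun n p => ∑ i, fderiv ℝ (F n i) p (1, 0) • e i with hDn
  set ζ : ℕ → ℝ × Rd d → ℝ := fun n p => ∑ i, fderiv ℝ (F n i) p (0, e i) with hζ
  have hXnC : ∀ n, ContDiff ℝ 1 (Xn n) := fun n =>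
    ContDiff.sum fun i _ => ((hF2 n i).of_le one_le_two).smul contDiff_const
  have hDnC : ∀ n, ContDiff ℝ 1 (Dn n) := fun n =>
    ContDiff.sum fun i _ => (hFv n i _).smul contDiff_const
  have hζC : ∀ n, ContDiff ℝ 1 (ζ n) := fun n => ContDiff.sum fun i _ => hFv n i _
  have hsumc : ∀ {G : Type} [NormedAddCommGroup G] (g : Fin d → ℝ × Rd d → G),
      (∀ i, HasCompactSupport (g i)) → HasCompactSupport fun p => ∑ i, g i p := by
    intro G _ g hg
    refine HasCompactSupport.intro (K := ⋃ i, tsupport (g i)) (isCompact_iUnion fun i => hg i)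
      fun p hp => Finset.sum_eq_zero fun i _ => ?_
    exact image_eq_zero_of_notMem_tsupport fun h => hp (mem_iUnion.2 ⟨i, h⟩)
  have hXnc : ∀ n, HasCompactSupport (Xn n) := fun n => hsumc _ fun i => (hFc n i).smul_right
  have hDnc : ∀ n, HasCompactSupport (Dn n) := fun n => hsumc _ fun i => (hFvc n i _).smul_right
  have hζc : ∀ n, HasCompactSupport (ζ n) := fun n => hsumc _ fun i => hFvc n i _
  have hdivX : ∀ n t x, divergence (fun y => Xn n (t, y)) x = ζ n (t, x) := fun n t x => by
    have hd : ∀ i, DifferentiableAt ℝ (F n i) (t, x) := fun i =>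
      (hF2 n i).differentiable two_ne_zero _
    refine (divergence_sum_single fun i => (hasFDerivAt_slice (hd i)).differentiableAt).trans ?_
    exact Finset.sum_congr rfl fun i _ => fderiv_slice (hd i) _
  have hdivD : ∀ n t x, divergence (fun y => Dn n (t, y)) x = fderiv ℝ (ζ n) (t, x) (1, 0) :=
    fun n t x => by
    have hd : ∀ i v, DifferentiableAt ℝ (fun p => fderiv ℝ (F n i) p v) (t, x) := fun i v =>
      (hFv n i v).differentiable one_ne_zero _
    have hsnd : ∀ i v w, fderiv ℝ (fun p => fderiv ℝ (F n i) p v) (t, x) w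
        = fderiv ℝ (fderiv ℝ (F n i)) (t, x) w v := fun i v w => by
      rw [((((hFd n i).differentiable one_ne_zero _).hasFDerivAt).clm_apply
        (hasFDerivAt_const v (t, x))).fderiv]
      simp
    refine (divergence_sum_single fun i => (hasFDerivAt_slice (hd i _)).differentiableAt).trans ?_
    rw [hζ, fderiv_fun_sum fun i _ => hd i _, sum_apply]
    refine Finset.sum_congr rfl fun i _ => ?_
    rw [fderiv_slice (hd i _), hsnd, hsnd]
    exact ((hF2 n i).contDiffAt.isSymmSndFDerivAt (by simp)) _ _
  have hXnM : ∀ n p, ‖Xn n p‖ ≤ d * (M + K) := fun n p => norm_sum_single_le fun i => hFM n i p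
  have hDnM : ∀ n p, ‖Dn n p‖ ≤ d * K := fun n p =>
    norm_sum_single_le fun i => abs_fderiv_time_le (hFL n i) p
  have hζM : ∀ n p, |ζ n p| ≤ d * K := fun n p =>
    (Finset.abs_sum_le_sum_abs _ _).trans ((Finset.sum_le_sum fun i _ =>
      abs_fderiv_space_le (hFL n i) p i).trans (by simp))
  have hXlim : ∀ p, Tendsto (fun n => Xn n p) atTop (𝓝 (X p)) := fun p => by
    rw [hvec (X p)]
    exact tendsto_finsetSum _ fun i _ => (tendsto_mollify (hfL i) p).smul_const _
  have hflim : ∀ i, ∀ t ∈ Ioo 0 Tstar, ∀ x v, Tendsto (fun n => fderiv ℝ (F n i) (t, x) v) atTop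
      (𝓝 (fderiv ℝ (f i) (t, x) v)) := fun i t ht x v =>
    ((ContinuousLinearMap.apply ℝ ℝ v).continuous.tendsto _).comp
      (tendsto_fderiv_mollify (hfL i) ((hfC i t ht x).continuousAt_fderiv one_ne_zero))
  have hDlim : ∀ t ∈ Ioo 0 Tstar, ∀ x, Tendsto (fun n => Dn n (t, x)) atTop
      (𝓝 (fderiv ℝ X (t, x) (1, 0))) := fun t ht x => by
    rw [hvec (fderiv ℝ X (t, x) (1, 0))]
    simp_rw [← hfd _ t ht]
    exact tendsto_finsetSum _ fun i _ => (hflim i t ht x _).smul_const _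
  set g : ℝ × Rd d → ℝ := fun p => ∑ i, fderiv ℝ (f i) p (0, e i) with hg
  have hgm : Measurable g := Finset.measurable_fun_sum _ fun i _ =>
    measurable_fderiv_apply_const ℝ (f i) _
  have hgM : ∀ p, |g p| ≤ d * K := fun p =>
    (Finset.abs_sum_le_sum_abs _ _).trans ((Finset.sum_le_sum fun i _ =>
      abs_fderiv_space_le (hfL i) p i).trans (by simp))
  have hgdiv : ∀ t ∈ Ioo 0 Tstar, ∀ x, divergence (fun y => X (t, y)) x = g (t, x) :=
    fun t ht x => by
    rw [divergence_eq_sum_coord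
      (hasFDerivAt_slice ((hX' t ht x).differentiableAt one_ne_zero)).differentiableAt]
    exact Finset.sum_congr rfl fun i _ =>
      fderiv_slice ((hfC i t ht x).differentiableAt one_ne_zero) _
  have hglim : ∀ t ∈ Ioo 0 Tstar, ∀ x, Tendsto (fun n => ζ n (t, x)) atTop (𝓝 (g (t, x))) :=
    fun t ht x => tendsto_finsetSum _ fun i _ => hflim i t ht x _
  -- convergence of integrals against the normal, for bounded fields
  have hnorm : ∀ (u : Rd d → ℝ), IsBV u → ∀ (Y : ℕ → Rd d → Rd d) (Z : Rd d → Rd d) (c : ℝ),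
      (∀ n, Continuous (Y n)) → (∀ n x, ‖Y n x‖ ≤ c) →
      (∀ x, Tendsto (fun n => Y n x) atTop (𝓝 (Z x))) →
      Tendsto (fun n => ∫ x, inner ℝ (extNormal u x) (Y n x) ∂(gradMeasure u)) atTop
        (𝓝 (∫ x, inner ℝ (extNormal u x) (Z x) ∂(gradMeasure u))) := by
    intro u hu Y Z c hYc hYb hYlim
    have hp := hu.isPolarGradient
    have := hp.finite
    refine tendsto_integral_of_dominated_convergence (fun _ => c) (fun n => ?_)
      (integrable_const _) (fun n => ?_) (ae_of_all _ fun x => ?_)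
    · exact (hp.integrable_inner (hYc n).aestronglyMeasurable (hYb n)).1
    · filter_upwards [hp.norm_eq_one] with x hx
      refine (norm_inner_le_norm _ _).trans ?_
      rw [hx, one_mul]
      exact hYb n x
    · exact tendsto_const_nhds.inner (hYlim x)
  set H : ℕ → ℝ → ℝ := fun n t =>
    ∫ x, inner ℝ (extNormal (χ t) x) (Dn n (t, x)) ∂(gradMeasure (χ t)) with hH
  have hHeq : ∀ n, ∀ᵐ t ∂(volume.restrict (Ioo 0 Tstar)),
      ∫ x, χ t x * fderiv ℝ (ζ n) (t, x) (1, 0) = H n t := fun n => by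
    filter_upwards [hs.bv] with t ht
    rw [hH]
    simp only
    rw [← ht.isPolarGradient.integral_divergence (fun x => Dn n (t, x))
      ((hDnC n).comp (contDiff_const.prodMk contDiff_id)) (hasCompactSupport_slice (hDnc n) t)]
    simp_rw [hdivD]
  have hHm : ∀ n, AEStronglyMeasurable (H n) (volume.restrict (Ioo 0 Tstar)) := fun n => by
    have hcont : Continuous fun p => fderiv ℝ (ζ n) p (1, 0) :=
      ((hζC n).continuous_fderiv one_ne_zero).clm_apply continuous_const
    obtain ⟨c, hcb⟩ := hcont.bounded_above_of_compact_support ((hζc n).fderiv_apply ℝ (1, 0))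
    exact ((hs.integrable_chi_mul hcont.aestronglyMeasurable
      (ae_of_all _ hcb)).integral_prod_left).1.congr (hHeq n)
  have hHM : ∀ n, ∀ᵐ t ∂(volume.restrict (Ioo 0 Tstar)),
      ‖H n t‖ ≤ d * K * (gradMeasure (χ 0) univ).toReal := fun n => by
    have hfin0 := hs.bv_zero.isFiniteMeasure
    filter_upwards [hs.bv, hs.gradMeasure_univ_le] with t ht hle
    have hfin := ht.isFiniteMeasure
    have h1 : ‖H n t‖ ≤ d * K * (gradMeasure (χ t)).real univ := by
      refine norm_integral_le_of_norm_le_const ?_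
      filter_upwards [ht.isPolarGradient.norm_eq_one] with x hx
      refine (norm_inner_le_norm _ _).trans ?_
      rw [hx, one_mul]
      exact hDnM n _
    refine h1.trans (mul_le_mul_of_nonneg_left ?_ (by positivity))
    exact ENNReal.toReal_mono (measure_ne_top _ _) hle
  have hHlim : ∀ᵐ t ∂(volume.restrict (Ioo 0 Tstar)), Tendsto (fun n => H n t) atTop
      (𝓝 (∫ x, inner ℝ (extNormal (χ t) x) (fderiv ℝ X (t, x) (1, 0)) ∂(gradMeasure (χ t)))) := by
    filter_upwards [hs.bv, ae_restrict_mem measurableSet_Ioo] with t ht htI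
    exact hnorm _ ht (fun n x => Dn n (t, x)) _ _
      (fun n => (hDnC n).continuous.comp (by fun_prop)) (fun n x => hDnM n _)
      (fun x => hDlim t htI x)
  refine ⟨?_, ?_, ?_⟩
  · refine Integrable.of_bound (aestronglyMeasurable_of_tendsto_ae atTop hHm hHlim)
      (d * K * (gradMeasure (χ 0) univ).toReal) ?_
    filter_upwards [hHlim, ae_all_iff.2 hHM] with t h1 h2
    exact le_of_tendsto h1.norm (Eventually.of_forall h2)
  · refine (hs.integrable_integral_perimeter (hs.integrable_mul_V hT hgm hgM)).congr_fun
      (fun t ht => ?_) measurableSet_Ioo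
    simp only
    simp_rw [hgdiv t ht]
  filter_upwards [ae_all_iff.2 fun n => hs.hasWeakVelocity_C1 (hζC n) (hζc n), hs.bv,
    ae_restrict_mem measurableSet_Ioo] with T hvel hbv hTI
  have hbd : ∀ (u : Rd d → ℝ), IsBV u → ∀ n t, ∫ x, ζ n (t, x) * u x
      = ∫ x, inner ℝ (extNormal u x) (Xn n (t, x)) ∂(gradMeasure u) := fun u hu n t => by
    rw [← hu.isPolarGradient.integral_divergence (fun x => Xn n (t, x))
      ((hXnC n).comp (contDiff_const.prodMk contDiff_id)) (hasCompactSupport_slice (hXnc n) t)]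
    simp_rw [hdivX, mul_comm]
  have hres : ∀ {P : ℝ → Prop}, (∀ᵐ t ∂(volume.restrict (Ioo 0 Tstar)), P t) →
      ∀ᵐ t ∂(volume.restrict (Ioo 0 T)), P t := fun h =>
    ae_restrict_of_ae_restrict_of_subset (Ioo_subset_Ioo_right hTI.2.le) h
  have hlim1 : Tendsto (fun n => ∫ t in Ioo 0 T, H n t) atTop
      (𝓝 (∫ t in Ioo 0 T, ∫ x, inner ℝ (extNormal (χ t) x) (fderiv ℝ X (t, x) (1, 0))
        ∂(gradMeasure (χ t)))) :=
    tendsto_integral_of_dominated_convergence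
      (fun _ => d * K * (gradMeasure (χ 0) univ).toReal)
      (fun n => (hHm n).mono_measure (Measure.restrict_mono (Ioo_subset_Ioo_right hTI.2.le) le_rfl))
      (integrable_const _) (fun n => hres (hHM n)) (hres hHlim)
  have hlim2 : Tendsto (fun n => ∫ p in Ioo 0 T ×ˢ univ, ζ n p * V p.1 p.2 ∂hs.perimeter) atTop
      (𝓝 (∫ p in Ioo 0 T ×ˢ univ, g p * V p.1 p.2 ∂hs.perimeter)) := by
    have hVi := hs.integrable_mul_V hT (f := fun _ => 1) measurable_const (M := 1) (by simp)
    refine tendsto_integral_of_dominated_convergence (fun p => d * K * ‖V p.1 p.2‖) (fun n => ?_)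
      (((by simpa using hVi : Integrable (fun p => V p.1 p.2) hs.perimeter).norm.const_mul
        (d * K : ℝ)).integrableOn) (fun n => ae_of_all _ fun p => ?_) ?_
    · exact (hs.integrable_mul_V hT (hζC n).continuous.measurable (hζM n)).integrableOn.1
    · rw [norm_mul]
      exact mul_le_mul_of_nonneg_right (hζM n _) (norm_nonneg _)
    · filter_upwards [ae_restrict_mem (measurableSet_Ioo.prod MeasurableSet.univ)] with p hp
      exact (hglim p.1 ⟨hp.1.1, hp.1.2.trans hTI.2⟩ p.2).mul_const _
  have hlast : ∫ t in Ioo 0 T, ∫ x, divergence (fun y => X (t, y)) x * V t x ∂(gradMeasure (χ t))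
      = ∫ p in Ioo 0 T ×ˢ univ, g p * V p.1 p.2 ∂hs.perimeter := by
    rw [← hs.setIntegral_perimeter (f := fun p => g p * V p.1 p.2)
      (hs.integrable_mul_V hT hgm hgM) hTI.2.le]
    refine setIntegral_congr_fun measurableSet_Ioo fun t ht => ?_
    simp only
    simp_rw [hgdiv t ⟨ht.1, ht.2.trans hTI.2⟩]
  rw [hlast]
  have hXs : ∀ (u : Rd d → ℝ), IsBV u → ∀ t,
      Tendsto (fun n => ∫ x, inner ℝ (extNormal u x) (Xn n (t, x)) ∂(gradMeasure u)) atTop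
        (𝓝 (∫ x, inner ℝ (extNormal u x) (X (t, x)) ∂(gradMeasure u))) := fun u hu t =>
    hnorm _ hu (fun n x => Xn n (t, x)) _ _
      (fun n => (hXnC n).continuous.comp (by fun_prop)) (fun n x => hXnM n _) (fun x => hXlim _)
  refine tendsto_nhds_unique ((hXs _ hbv T).sub (hXs _ hs.bv_zero 0)) ((hlim1.add hlim2).congr
    fun n => ?_)
  rw [← hbd _ hbv, ← hbd _ hs.bv_zero, hvel n]
  congr 1
  · exact integral_congr_ae (by filter_upwards [hres (hHeq n)] with t ht using ht.symm)
  · exact (hs.setIntegral_perimeter (f := fun p => ζ n p * V p.1 p.2)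
      (hs.integrable_mul_V hT (hζC n).continuous.measurable (hζM n)) hTI.2.le).symm

end IsDistributionalSolution

end

/-! ### The evolution equation at almost every time -/

section

variable {d : ℕ}

variable {μ : Measure (Rd d)} {ν : Rd d → Rd d} {v : Rd d → ℝ}

/-- The weak form of the curvature equation `-H = v` on a generalized surface `(μ, ν)`, for the
test field `X`. -/
def HasWeakCurvature (μ : Measure (Rd d)) (ν : Rd d → Rd d) (v : Rd d → ℝ) (X : Rd d → Rd d) :
    Prop :=
  ∫ x, (divergence X x - inner ℝ (ν x) (fderiv ℝ X x (ν x))) ∂μ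
    = -∫ x, v x * inner ℝ (ν x) (X x) ∂μ

/-- The curvature equation is stable under bounded pointwise convergence of the fields and of their
derivatives. -/
theorem HasWeakCurvature.of_tendsto [IsFiniteMeasure μ] (hν : Measurable ν)
    (hν1 : ∀ᵐ x ∂μ, ‖ν x‖ = 1) (hv : Integrable v μ) {Y : ℕ → Rd d → Rd d} {X : Rd d → Rd d}
    (hY : ∀ n, ContDiff ℝ 1 (Y n)) {M : ℝ} (hM : ∀ᶠ n in atTop, ∀ x, ‖Y n x‖ ≤ M)
    (hM' : ∀ᶠ n in atTop, ∀ x, ‖fderiv ℝ (Y n) x‖ ≤ M)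
    (hlim : ∀ x, Tendsto (fun n => Y n x) atTop (𝓝 (X x)))
    (hlim' : ∀ x, Tendsto (fun n => fderiv ℝ (Y n) x) atTop (𝓝 (fderiv ℝ X x)))
    (h : ∀ n, HasWeakCurvature μ ν v (Y n)) : HasWeakCurvature μ ν v X := by
  have happ : ∀ x w, Tendsto (fun n => fderiv ℝ (Y n) x w) atTop (𝓝 (fderiv ℝ X x w)) :=
    fun x w => ((ContinuousLinearMap.apply ℝ (Rd d) w).continuous.tendsto _).comp (hlim' x)
  have hdiv : ∀ x, Tendsto (fun n => divergence (Y n) x) atTop (𝓝 (divergence X x)) := fun x =>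
    tendsto_finsetSum _ fun i _ => ((EuclideanSpace.proj (𝕜 := ℝ) i :
      Rd d →L[ℝ] ℝ).continuous.tendsto _).comp (happ x _)
  have hl : Tendsto (fun n => ∫ x, (divergence (Y n) x
      - inner ℝ (ν x) (fderiv ℝ (Y n) x (ν x))) ∂μ) atTop
      (𝓝 (∫ x, (divergence X x - inner ℝ (ν x) (fderiv ℝ X x (ν x))) ∂μ)) := by
    refine tendsto_integral_filter_of_dominated_convergence (fun _ => d * M + M)
      (Eventually.of_forall fun n => ?_) ?_ (integrable_const _) (ae_of_all _ fun x => ?_)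
    · have h1 : Continuous (fderiv ℝ (Y n)) := (hY n).continuous_fderiv one_ne_zero
      have h2 : Measurable fun x => fderiv ℝ (Y n) x (ν x) := by
        have : Continuous fun p : (Rd d →L[ℝ] Rd d) × Rd d => p.1 p.2 := by fun_prop
        exact this.measurable.comp (h1.measurable.prodMk hν)
      exact ((continuous_divergence (hY n)).measurable.sub (hν.inner h2)).aestronglyMeasurable
    · filter_upwards [hM'] with n hn
      filter_upwards [hν1] with x hx
      refine (norm_sub_le _ _).trans (add_le_add ?_ ?_)
      · exact (abs_divergence_le (Y n) x).trans (mul_le_mul_of_nonneg_left (hn x) (by positivity))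
      · refine (norm_inner_le_norm _ _).trans ?_
        rw [hx, one_mul]
        refine ((fderiv ℝ (Y n) x).le_opNorm _).trans ?_
        rw [hx, mul_one]
        exact hn x
    · exact (hdiv x).sub (tendsto_const_nhds.inner (happ x _))
  have hr : Tendsto (fun n => ∫ x, v x * inner ℝ (ν x) (Y n x) ∂μ) atTop
      (𝓝 (∫ x, v x * inner ℝ (ν x) (X x) ∂μ)) := by
    refine tendsto_integral_filter_of_dominated_convergence (fun x => ‖v x‖ * M)
      (Eventually.of_forall fun n => ?_) ?_ (hv.norm.mul_const _) (ae_of_all _ fun x => ?_)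
    · exact hv.1.mul (hν.inner (hY n).continuous.measurable).aestronglyMeasurable
    · filter_upwards [hM] with n hn
      filter_upwards [hν1] with x hx
      rw [norm_mul]
      refine mul_le_mul_of_nonneg_left ?_ (norm_nonneg _)
      refine (norm_inner_le_norm _ _).trans ?_
      rw [hx, one_mul]
      exact hn x
    · exact (tendsto_const_nhds.inner (hlim x)).const_mul _
  refine tendsto_nhds_unique hl (hr.neg.congr fun n => ?_)
  exact (h n).symm

namespace IsDistributionalSolution

variable {Tstar : ℝ} {χ V : ℝ → Rd d → ℝ} {lam Clam : ℝ → ℝ}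

/-- The exceptional set of times in the evolution equation can be chosen independent of the test
field, by separability of the space of `C¹` fields. -/
theorem ae_hasWeakCurvature (hs : IsDistributionalSolution Tstar χ V lam Clam) (hT : 0 < Tstar) :
    ∀ᵐ t ∂(volume.restrict (Ioo 0 Tstar)), ∀ X : Rd d → Rd d, ContDiff ℝ 1 X →
      (∃ M, ∀ x, ‖X x‖ ≤ M ∧ ‖fderiv ℝ X x‖ ≤ M) →
      HasWeakCurvature (gradMeasure (χ t)) (extNormal (χ t)) (fun x => V t x - lam t) X := by
  set S : ℕ → Set (Rd d → Rd d) := fun m => {X | ContDiff ℝ 1 X ∧ ∀ x, (m : ℝ) < ‖x‖ → X x = 0}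
    with hS
  have hScs : ∀ m, ∀ X ∈ S m, HasCompactSupport X := fun m X hX =>
    HasCompactSupport.intro (isCompact_closedBall 0 m) fun x hx => hX.2 x (by simpa using hx)
  choose D hDS hDc hDd using fun m => exists_countable_dense_C1 (S m) fun X hX => hX.1
  have hall : ∀ᵐ t ∂(volume.restrict (Ioo 0 Tstar)), ∀ m, ∀ X ∈ D m,
      HasWeakCurvature (gradMeasure (χ t)) (extNormal (χ t)) (fun x => V t x - lam t) X := by
    rw [ae_all_iff]
    intro m
    rw [ae_ball_iff (hDc m)]
    intro X hX
    exact hs.evolution X (hDS m hX).1 (hScs m X (hDS m hX))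
  filter_upwards [hall, hs.bv, hs.ae_memLp_two hT] with t ht hbv hV2
  have hp := hbv.isPolarGradient
  have := hp.finite
  have hv : Integrable (fun x => V t x - lam t) (gradMeasure (χ t)) :=
    (hV2.integrable one_le_two).sub (integrable_const _)
  have hcs : ∀ m, ∀ X ∈ S m,
      HasWeakCurvature (gradMeasure (χ t)) (extNormal (χ t)) (fun x => V t x - lam t) X := by
    intro m X hX
    obtain ⟨Y, hYD, hY, hY'⟩ := hDd m X hX
    have hXc := hScs m X hX
    obtain ⟨M, hM⟩ := hX.1.continuous.bounded_above_of_compact_support hXc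
    obtain ⟨M', hM'⟩ := (hX.1.continuous_fderiv one_ne_zero).bounded_above_of_compact_support
      (hXc.fderiv ℝ)
    have hM0 : 0 ≤ M := (norm_nonneg _).trans (hM 0)
    have hM0' : 0 ≤ M' := (norm_nonneg _).trans (hM' 0)
    have hbound : ∀ {G : Type} [NormedAddCommGroup G] (y : ℕ → Rd d → G) (z : Rd d → G) (c : ℝ),
        0 ≤ c → TendstoLocallyUniformly y z atTop → (∀ x, ‖z x‖ ≤ c) →
        (∀ n x, (m : ℝ) < ‖x‖ → y n x = 0) → ∀ᶠ n in atTop, ∀ x, ‖y n x‖ ≤ c + 1 := by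
      intro G _ y z c hc hyz hz hy0
      have h1 := (tendstoLocallyUniformlyOn_iff_tendstoUniformlyOn_of_compact
        (isCompact_closedBall (0 : Rd d) m)).1 (hyz.tendstoLocallyUniformlyOn)
      filter_upwards [Metric.tendstoUniformlyOn_iff.1 h1 1 one_pos] with n hn x
      by_cases hx : (m : ℝ) < ‖x‖
      · rw [hy0 n x hx, norm_zero]
        linarith
      · have h2 := hn x (by simpa using hx)
        rw [dist_eq_norm] at h2
        have h3 := norm_sub_le (z x) (z x - y n x)
        rw [sub_sub_cancel] at h3
        linarith [hz x]
    have hb1 := hbound Y X M hM0 hY hM fun n x hx => (hDS m (hYD n)).2 x hx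
    have hb2 := hbound (fun n => fderiv ℝ (Y n)) (fderiv ℝ X) M' hM0' hY' hM' fun n x hx => by
      have h1 : Y n =ᶠ[𝓝 x] fun _ => 0 := by
        filter_upwards [(isOpen_lt continuous_const continuous_norm).mem_nhds hx] with y hy
        exact (hDS m (hYD n)).2 y hy
      rw [h1.fderiv_eq]
      simp
    refine HasWeakCurvature.of_tendsto hp.measurable hp.norm_eq_one hv (Y := Y)
      (M := max (M + 1) (M' + 1)) (fun n => (hDS m (hYD n)).1)
      (hb1.mono fun n h x => (h x).trans (le_max_left _ _))
      (hb2.mono fun n h x => (h x).trans (le_max_right _ _)) (fun x => ?_) (fun x => ?_)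
      (fun n => ht m _ (hYD n))
    · exact (tendstoLocallyUniformlyOn_univ.2 hY).tendsto_at (mem_univ x)
    · exact (tendstoLocallyUniformlyOn_univ.2 hY').tendsto_at (mem_univ x)
  rintro X hX ⟨M, hM⟩
  have hM0 : 0 ≤ M := (norm_nonneg _).trans (hM 0).1
  set η := cutoff (Rd d) with hη
  have hηC : ∀ n, ContDiff ℝ 1 (η n) := fun n => (contDiff_cutoff n).of_le (by simp)
  have hfd : ∀ n x, fderiv ℝ (fun y => η n y • X y) x
      = η n x • fderiv ℝ X x + (fderiv ℝ (η n) x).smulRight (X x) := fun n x =>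
    fderiv_fun_smul ((hηC n).differentiable one_ne_zero x) (hX.differentiable one_ne_zero x)
  refine HasWeakCurvature.of_tendsto hp.measurable hp.norm_eq_one hv
    (Y := fun n x => η n x • X x) (M := M + cutoffConst (Rd d) * M) (fun n => (hηC n).smul hX)
    (Eventually.of_forall fun n x => ?_) (Eventually.of_forall fun n x => ?_) (fun x => ?_)
    (fun x => ?_) (fun n => ?_)
  · rw [norm_smul]
    have h1 : ‖η n x‖ ≤ 1 := abs_cutoff_le_one n x
    have h2 : 0 ≤ (cutoffConst (Rd d) : ℝ) * M := by positivity
    nlinarith [norm_nonneg (X x), norm_nonneg (η n x), (hM x).1]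
  · rw [hfd]
    refine (norm_add_le _ _).trans (add_le_add ?_ ?_)
    · rw [norm_smul]
      have h1 : ‖η n x‖ ≤ 1 := abs_cutoff_le_one n x
      nlinarith [norm_nonneg (fderiv ℝ X x), norm_nonneg (η n x), (hM x).2]
    · rw [ContinuousLinearMap.norm_smulRight_apply]
      exact mul_le_mul (norm_fderiv_cutoff_le n x) (hM x).1 (norm_nonneg _) (by positivity)
  · simpa using (tendsto_cutoff x).smul_const (X x)
  · refine tendsto_const_nhds.congr' ?_
    filter_upwards [eventually_cutoff_eq_one x] with n hn
    refine Filter.EventuallyEq.fderiv_eq ?_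
    filter_upwards [hn] with y hy
    rw [hη, hy]
    simp
  · have hcomp : HasCompactSupport (η n) := hasCompactSupport_cutoff n
    obtain ⟨r, hr⟩ := hcomp.isBounded.subset_closedBall 0
    obtain ⟨m, hm⟩ := exists_nat_ge r
    refine hcs m _ ⟨(hηC n).smul hX, fun x hx => ?_⟩
    have hnot : x ∉ tsupport (η n) := fun hmem => by
      have := hr hmem
      rw [mem_closedBall_zero_iff] at this
      linarith
    simp only
    rw [image_eq_zero_of_notMem_tsupport hnot, zero_smul]

end IsDistributionalSolution

end

/-! ### Coercivity and dissipation at a fixed time -/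

section

variable {d : ℕ}

/-- Coercivity of the relative entropy in the normal. -/
theorem norm_sub_sq_le_of_unit {n x : Rd d} (hn : ‖n‖ = 1) (hx : ‖x‖ ≤ 1) :
    ‖n - x‖ ^ 2 ≤ 2 * (1 - inner ℝ n x) := by
  rw [norm_sub_sq_real, hn]
  nlinarith [norm_nonneg x]

/-- Coercivity of the relative entropy in the length of the calibration field. -/
theorem one_sub_norm_le_of_unit {n x : Rd d} (hn : ‖n‖ = 1) : 1 - ‖x‖ ≤ 1 - inner ℝ n x := by
  have h := real_inner_le_norm n x
  rw [hn, one_mul] at h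
  linarith

/-- The pointwise inequality behind the relative entropy estimate. With `n` the normal, `x` the
calibration field and `b = n · B`, all terms except those of the equation `V = -H + λ` are
quadratic in `n - x` and in the distance, hence controlled by `1 - n · x`. -/
theorem entropy_pointwise {n x b τ y : Rd d} {L : Rd d →L[ℝ] Rd d} {K V f p q l ls : ℝ}
    (hn : ‖n‖ = 1) (hx : ‖x‖ ≤ 1) (hb : ‖b‖ ≤ K) (hL : ‖L‖ ≤ K) (hf : |f| ≤ K) (hq : |q| ≤ K)
    (hR : ‖τ + y + ContinuousLinearMap.adjoint L x - f • x‖ ^ 2 ≤ K * (1 - ‖x‖))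
    (hN : |inner ℝ x τ + inner ℝ x y| ≤ K * (1 - ‖x‖))
    (hs : (inner ℝ b x + p - ls) ^ 2 ≤ K * (1 - ‖x‖)) :
    -V ^ 2 - inner ℝ n τ - p * V - (inner ℝ n y - inner ℝ n (L x))
        + (inner ℝ n b * p - inner ℝ n x * q) + (q - inner ℝ n (L n)) + (V - l) * inner ℝ n b
        + ls * V
      ≤ -(1 / 2) * (V - inner ℝ n b) ^ 2 + (ls - l) * inner ℝ n b
        + (1 + 10 * K + 2 * K ^ 2) * (1 - inner ℝ n x) := by
  have hK : 0 ≤ K := (norm_nonneg _).trans hb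
  set m := 1 - inner ℝ n x with hm
  have ha := norm_sub_sq_le_of_unit hn hx
  have hxm : 1 - ‖x‖ ≤ m := one_sub_norm_le_of_unit hn
  rw [← hm] at ha
  set a := n - x with had
  have hna : n = a + x := by rw [had]; abel
  set R := τ + y + ContinuousLinearMap.adjoint L x - f • x with hRd
  have hKx : K * (1 - ‖x‖) ≤ K * m := mul_le_mul_of_nonneg_left hxm hK
  have haR : |inner ℝ a R| ≤ m + K / 2 * m := by
    have h1 := abs_real_inner_le_norm a R
    have h2 := two_mul_le_add_sq ‖a‖ ‖R‖
    linarith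
  have hax : |f * inner ℝ a x| ≤ K * (3 * m) := by
    have h1 : inner ℝ a x = (1 - ‖x‖ ^ 2) - m := by
      rw [had, inner_sub_left, real_inner_self_eq_norm_sq, hm]; ring
    have hm0 : 0 ≤ m := le_trans (by linarith) hxm
    have h2 : |inner ℝ a x| ≤ 3 * m := by
      rw [h1, abs_le]
      constructor <;> nlinarith [norm_nonneg x]
    rw [abs_mul]
    exact mul_le_mul hf h2 (abs_nonneg _) hK
  have haL : |inner ℝ a (L a)| ≤ K * (2 * m) := by
    have h1 := abs_real_inner_le_norm a (L a)
    have h2 := L.le_of_opNorm_le hL a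
    have h3 : ‖a‖ * ‖L a‖ ≤ ‖a‖ * (K * ‖a‖) := mul_le_mul_of_nonneg_left h2 (norm_nonneg _)
    nlinarith
  have hqm : |m * q| ≤ K * m := by
    have hm0 : 0 ≤ m := le_trans (by linarith) hxm
    rw [abs_mul, abs_of_nonneg hm0]
    nlinarith
  -- the transport equation, tested with `n = (n - x) + x`
  have hid : -inner ℝ n τ - (inner ℝ n y - inner ℝ n (L x)) - inner ℝ n x * q
        + (q - inner ℝ n (L n))
      = -inner ℝ a R - f * inner ℝ a x - (inner ℝ x τ + inner ℝ x y) - inner ℝ a (L a) + m * q := by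
    have e1 : inner ℝ a R = inner ℝ a τ + inner ℝ a y + inner ℝ x (L a) - f * inner ℝ a x := by
      rw [hRd, inner_sub_right, inner_add_right, inner_add_right, inner_smul_right,
        ContinuousLinearMap.adjoint_inner_right, real_inner_comm x (L a)]
    have e2 : inner ℝ n x = 1 - m := by rw [hm]; ring
    rw [e1, e2, hna]
    simp only [inner_add_left, inner_add_right, map_add]
    ring
  set w := V - inner ℝ n b with hw
  set s := inner ℝ b x + p - ls with hsd
  have hab : (inner ℝ a b) ^ 2 ≤ K ^ 2 * (2 * m) := by
    have h1 := abs_real_inner_le_norm a b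
    have h2 : |inner ℝ a b| ≤ ‖a‖ * K := h1.trans (mul_le_mul_of_nonneg_left hb (norm_nonneg _))
    have h3 : (inner ℝ a b) ^ 2 ≤ (‖a‖ * K) ^ 2 := by
      rw [← sq_abs]
      exact pow_le_pow_left₀ (abs_nonneg _) h2 2
    nlinarith [mul_le_mul_of_nonneg_left ha (sq_nonneg K)]
  have hp : p = ls - inner ℝ n b + (inner ℝ a b + s) := by
    rw [hsd, had, inner_sub_left, real_inner_comm b x]; ring
  have hq2 : (inner ℝ a b + s) ^ 2 ≤ (4 * K ^ 2 + 2 * K) * m := by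
    have h1 := add_sq_le (a := inner ℝ a b) (b := s)
    linarith
  -- completing the square in `V - n · b`
  have hsplit : -V ^ 2 - p * V + inner ℝ n b * p + (V - l) * inner ℝ n b + ls * V
      = -w ^ 2 + (ls - l) * inner ℝ n b - w * (inner ℝ a b + s) := by
    rw [hp, hw]; ring
  have hyoung : -w * (inner ℝ a b + s) ≤ 1 / 2 * w ^ 2 + 1 / 2 * (inner ℝ a b + s) ^ 2 := by
    have h1 := two_mul_le_add_sq (-w) (inner ℝ a b + s)
    linarith
  have g1 := abs_le.1 haR
  have g2 := abs_le.1 hax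
  have g3 := abs_le.1 haL
  have g4 := abs_le.1 hqm
  have g5 := abs_le.1 hN
  have hm0 : 0 ≤ m := le_trans (by linarith) hxm
  have hKm : 0 ≤ K * m := mul_nonneg hK hm0
  linarith

variable {u w : Rd d → ℝ} {μ σ : Measure (Rd d)} {ν : Rd d → Rd d} {ξ B τ : Rd d → Rd d}
  {ϑ V : Rd d → ℝ}

theorem measurable_apply {L : Rd d → Rd d →L[ℝ] Rd d} {y : Rd d → Rd d} (hL : Continuous L)
    (hy : Measurable y) : Measurable fun x => L x (y x) := by
  have : Continuous fun p : (Rd d →L[ℝ] Rd d) × Rd d => p.1 p.2 := by fun_prop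
  exact this.measurable.comp (hL.measurable.prodMk hy)

/-- The entropy dissipation inequality at a fixed time. -/
theorem IsPolarGradient.entropy_dissipation (h : IsPolarGradient u μ ν) (hξ : ContDiff ℝ 1 ξ)
    (hξc : HasCompactSupport ξ) (hB : ContDiff ℝ 1 B) (hτ : Continuous τ) {K l ls : ℝ}
    {f : Rd d → ℝ} (hV : MemLp V 2 μ) (hV0 : ∫ x, V x ∂μ = 0)
    (hcurv : HasWeakCurvature μ ν (fun x => V x - l) B)
    (hξ1 : ∀ x, ‖ξ x‖ ≤ 1) (hξd : ∀ x, ‖fderiv ℝ ξ x‖ ≤ K) (hBK : ∀ x, ‖B x‖ ≤ K)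
    (hBd : ∀ x, ‖fderiv ℝ B x‖ ≤ K) (hτK : ∀ x, ‖τ x‖ ≤ K) (hf : ∀ x, |f x| ≤ K)
    (hdiv : ∀ x, |divergence B x| ≤ K)
    (hR : ∀ x, ‖τ x + fderiv ℝ ξ x (B x) + ContinuousLinearMap.adjoint (fderiv ℝ B x) (ξ x)
      - f x • ξ x‖ ^ 2 ≤ K * (1 - ‖ξ x‖))
    (hN : ∀ x, |inner ℝ (ξ x) (τ x) + inner ℝ (ξ x) (fderiv ℝ ξ x (B x))| ≤ K * (1 - ‖ξ x‖))
    (hs : ∀ x, (inner ℝ (B x) (ξ x) + divergence ξ x - ls) ^ 2 ≤ K * (1 - ‖ξ x‖)) :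
    -(∫ x, V x ^ 2 ∂μ) - (∫ x, inner ℝ (ν x) (τ x) ∂μ) - ∫ x, divergence ξ x * V x ∂μ
      ≤ -(1 / 2) * (∫ x, (V x - inner ℝ (ν x) (B x)) ^ 2 ∂μ)
        + (ls - l) * (∫ x, inner ℝ (ν x) (B x) ∂μ)
        + (1 + 10 * K + 2 * K ^ 2) * ∫ x, (1 - inner ℝ (ν x) (ξ x)) ∂μ := by
  have := h.finite
  have hK : 0 ≤ K := (norm_nonneg _).trans (hBK 0)
  have hν := h.measurable
  have hDξ : Continuous (fderiv ℝ ξ) := hξ.continuous_fderiv one_ne_zero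
  have hDB : Continuous (fderiv ℝ B) := hB.continuous_fderiv one_ne_zero
  have hdξ : Continuous (divergence ξ) := continuous_divergence hξ
  have hdB : Continuous (divergence B) := continuous_divergence hB
  have hV1 : Integrable V μ := hV.integrable one_le_two
  have hV2 : Integrable (fun x => V x ^ 2) μ := (memLp_two_iff_integrable_sq hV.1).1 hV
  have hbint : ∀ {g : Rd d → ℝ} (c : ℝ), Measurable g → (∀ x, ‖ν x‖ = 1 → |g x| ≤ c) →
      Integrable g μ := fun c hg hc => Integrable.of_bound hg.aestronglyMeasurable c
        (by filter_upwards [h.norm_eq_one] with x hx using hc x hx)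
  have hin : ∀ {y : Rd d → Rd d} (c : ℝ), Measurable y → (∀ x, ‖ν x‖ = 1 → ‖y x‖ ≤ c) →
      Integrable (fun x => inner ℝ (ν x) (y x)) μ := fun c hy hc =>
    hbint c (hν.inner hy) fun x hx => (abs_real_inner_le_norm _ _).trans
      (by rw [hx, one_mul]; exact hc x hx)
  have hdξK : ∀ x, |divergence ξ x| ≤ d * K := fun x =>
    (abs_divergence_le ξ x).trans (mul_le_mul_of_nonneg_left (hξd x) (by positivity))
  have iτ := hin K hτ.measurable fun x _ => hτK x
  have ib := hin K hB.continuous.measurable fun x _ => hBK x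
  have ix := hin 1 hξ.continuous.measurable fun x _ => hξ1 x
  have iy := hin (y := fun x => fderiv ℝ ξ x (B x)) (K * K)
    (measurable_apply hDξ hB.continuous.measurable) fun x _ =>
      ((fderiv ℝ ξ x).le_of_opNorm_le (hξd x) _).trans (mul_le_mul_of_nonneg_left (hBK x) hK)
  have iLx := hin (y := fun x => fderiv ℝ B x (ξ x)) (K * 1)
    (measurable_apply hDB hξ.continuous.measurable) fun x _ =>
      ((fderiv ℝ B x).le_of_opNorm_le (hBd x) _).trans (mul_le_mul_of_nonneg_left (hξ1 x) hK)
  have iLn := hin (y := fun x => fderiv ℝ B x (ν x)) (K * 1)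
    (measurable_apply hDB hν) fun x hx =>
      ((fderiv ℝ B x).le_of_opNorm_le (hBd x) _).trans (by rw [hx])
  have ipV : Integrable (fun x => divergence ξ x * V x) μ :=
    hV1.bdd_mul (c := d * K) hdξ.aestronglyMeasurable (ae_of_all _ hdξK)
  have ibp : Integrable (fun x => inner ℝ (ν x) (B x) * divergence ξ x) μ :=
    ib.mul_bdd (c := d * K) hdξ.aestronglyMeasurable (ae_of_all _ hdξK)
  have ixq : Integrable (fun x => inner ℝ (ν x) (ξ x) * divergence B x) μ :=
    ix.mul_bdd (c := K) hdB.aestronglyMeasurable (ae_of_all _ hdiv)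
  have iq : Integrable (divergence B) μ := hbint K hdB.measurable fun x _ => hdiv x
  have hbm : AEStronglyMeasurable (fun x => inner ℝ (ν x) (B x)) μ := ib.1
  have hbK : ∀ᵐ x ∂μ, ‖inner ℝ (ν x) (B x)‖ ≤ K := by
    filter_upwards [h.norm_eq_one] with x hx
    exact (abs_real_inner_le_norm _ _).trans (by rw [hx, one_mul]; exact hBK x)
  have iVl : Integrable (fun x => (V x - l) * inner ℝ (ν x) (B x)) μ :=
    (hV1.sub (integrable_const l)).mul_bdd (c := K) hbm hbK
  have iw : Integrable (fun x => (V x - inner ℝ (ν x) (B x)) ^ 2) μ := by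
    have h1 : MemLp (fun x => inner ℝ (ν x) (B x)) 2 μ := MemLp.of_bound hbm K hbK
    exact (memLp_two_iff_integrable_sq (hV.sub h1).1).1 (hV.sub h1)
  have im : Integrable (fun x => 1 - inner ℝ (ν x) (ξ x)) μ := (integrable_const 1).sub ix
  have hcomm := h.integral_commutator hB hξ hξc
  -- of the left integrand, the two parenthesised differences of `B`- and `ξ`-terms cancel by the
  -- commutator identity, the terms `∇ · B - ν · ∇B ν + (V - l) ν · B` integrate to zero by the
  -- curvature equation, and `ls * V` integrates to zero by `hV0`
  have hmono := integral_mono_ae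
    (f := fun x => (-V x ^ 2 - inner ℝ (ν x) (τ x) - divergence ξ x * V x
      - (inner ℝ (ν x) (fderiv ℝ ξ x (B x)) - inner ℝ (ν x) (fderiv ℝ B x (ξ x)))
      + (inner ℝ (ν x) (B x) * divergence ξ x - inner ℝ (ν x) (ξ x) * divergence B x)
      + (divergence B x - inner ℝ (ν x) (fderiv ℝ B x (ν x))) + (V x - l) * inner ℝ (ν x) (B x)
      + ls * V x))
    (g := fun x => -(1 / 2) * (V x - inner ℝ (ν x) (B x)) ^ 2 + (ls - l) * inner ℝ (ν x) (B x)
        + (1 + 10 * K + 2 * K ^ 2) * (1 - inner ℝ (ν x) (ξ x)))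
    (((((((hV2.neg.sub iτ).sub ipV).sub (iy.sub iLx)).add (ibp.sub ixq)).add
      (iq.sub iLn)).add iVl).add (hV1.const_mul ls))
    (((iw.const_mul _).add (ib.const_mul _)).add (im.const_mul _))
    (by
      filter_upwards [h.norm_eq_one] with x hx
      exact entropy_pointwise hx (hξ1 x) (hBK x) (hBd x) (hf x) (hdiv x) (hR x) (hN x) (hs x))
  rw [integral_add, integral_add, integral_add, integral_add, integral_sub, integral_sub,
    integral_sub, integral_neg, integral_const_mul, hV0, hcomm, hcurv, integral_add, integral_add,
    integral_const_mul, integral_const_mul, integral_const_mul] at hmono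
  · linarith
  · exact iw.const_mul _
  · exact ib.const_mul _
  · exact (iw.const_mul _).add (ib.const_mul _)
  · exact im.const_mul _
  · exact hV2.neg
  · exact iτ
  · exact hV2.neg.sub iτ
  · exact ipV
  · exact (hV2.neg.sub iτ).sub ipV
  · exact iy.sub iLx
  · exact ((hV2.neg.sub iτ).sub ipV).sub (iy.sub iLx)
  · exact ibp.sub ixq
  · exact (((hV2.neg.sub iτ).sub ipV).sub (iy.sub iLx)).add (ibp.sub ixq)
  · exact iq.sub iLn
  · exact ((((hV2.neg.sub iτ).sub ipV).sub (iy.sub iLx)).add (ibp.sub ixq)).add (iq.sub iLn)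
  · exact iVl
  · exact (((((hV2.neg.sub iτ).sub ipV).sub (iy.sub iLx)).add (ibp.sub ixq)).add
      (iq.sub iLn)).add iVl
  · exact hV1.const_mul ls

/-- The growth of the volume error at a fixed time; `w` plays the role of the characteristic
function of the calibrated domain and `σ` that of its surface measure, on which `ϑ` vanishes. -/
theorem IsPolarGradient.volError_growth (h : IsPolarGradient u μ ν) (h' : IsPolarGradient w σ ξ)
    (hu : Integrable u) (hw : Integrable w) (hB : ContDiff ℝ 1 B) {K M : ℝ} {L : ℝ≥0}
    {D : Rd d → ℝ} (hV : MemLp V 2 μ)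
    (hξm : Continuous ξ) (hξ1 : ∀ x, ‖ξ x‖ ≤ 1) (hBK : ∀ x, ‖B x‖ ≤ K)
    (hBd : ∀ x, ‖fderiv ℝ B x‖ ≤ K)
    (hdiv : ∀ x, |divergence B x| ≤ K) (hϑ : LipschitzWith L ϑ) (hϑM : ∀ x, |ϑ x| ≤ M)
    (hϑσ : ∀ᵐ x ∂σ, ϑ x = 0) (hDm : Measurable D) (hDM : ∀ x, |D x| ≤ M)
    (hϑξ : ∀ x, ϑ x ^ 2 ≤ K * (1 - ‖ξ x‖))
    (htr : ∀ᵐ x, |D x + fderiv ℝ ϑ x (B x)| ≤ K * |ϑ x|) :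
    (∫ x, (u x - w x) * D x) + ∫ x, ϑ x * V x ∂μ
      ≤ 1 / 2 * (∫ x, (V x - inner ℝ (ν x) (B x)) ^ 2 ∂μ)
        + K / 2 * (∫ x, (1 - inner ℝ (ν x) (ξ x)) ∂μ) + 2 * K * ∫ x, |u x - w x| * |ϑ x| := by
  have := h.finite
  have hK : 0 ≤ K := (norm_nonneg _).trans (hBK 0)
  have hν := h.measurable
  have hdB : Continuous (divergence B) := continuous_divergence hB
  have hDϑm : Measurable fun x => fderiv ℝ ϑ x (B x) := by
    have : Continuous fun p : (Rd d →L[ℝ] ℝ) × Rd d => p.1 p.2 := by fun_prop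
    exact this.measurable.comp ((measurable_fderiv ℝ ϑ).prodMk hB.continuous.measurable)
  have hDϑK : ∀ x, |fderiv ℝ ϑ x (B x)| ≤ L * K := fun x =>
    ((fderiv ℝ ϑ x).le_of_opNorm_le (norm_fderiv_le_of_lipschitz ℝ hϑ) _).trans
      (mul_le_mul_of_nonneg_left (hBK x) L.2)
  set G : Rd d → ℝ := fun x => fderiv ℝ ϑ x (B x) + ϑ x * divergence B x with hG
  have hGm : Measurable G := hDϑm.add (hϑ.continuous.measurable.mul hdB.measurable)
  have hM0 : 0 ≤ M := (abs_nonneg _).trans (hϑM 0)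
  have hGM : ∀ x, ‖G x‖ ≤ L * K + M * K := fun x => (abs_add_le _ _).trans (add_le_add (hDϑK x)
    (by rw [abs_mul]; exact mul_le_mul (hϑM x) (hdiv x) (abs_nonneg _) hM0))
  have huw : Integrable (fun x => u x - w x) := hu.sub hw
  have iuG : Integrable fun x => u x * G x := hu.mul_bdd (c := L * K + M * K)
    hGm.aestronglyMeasurable (ae_of_all _ hGM)
  have iwG : Integrable fun x => w x * G x := hw.mul_bdd (c := L * K + M * K)
    hGm.aestronglyMeasurable (ae_of_all _ hGM)
  have iD : Integrable fun x => (u x - w x) * D x := huw.mul_bdd (c := M)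
    hDm.aestronglyMeasurable (ae_of_all _ hDM)
  have iF : Integrable fun x => |u x - w x| * |ϑ x| := huw.abs.mul_bdd (c := M)
    (hϑ.continuous.abs.aestronglyMeasurable) (ae_of_all _ fun x => by simpa using hϑM x)
  have e1 : ∫ x, u x * G x = ∫ x, ϑ x * inner ℝ (ν x) (B x) ∂μ :=
    h.integral_lipschitz_smul hu hϑ hϑM hB hBK hBd
  have e2 : ∫ x, w x * G x = 0 := by
    refine (h'.integral_lipschitz_smul hw hϑ hϑM hB hBK hBd).trans ?_
    refine integral_eq_zero_of_ae ?_
    filter_upwards [hϑσ] with x hx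
    simp [hx]
  have hmono := integral_mono_ae (f := fun x => (u x - w x) * D x)
    (g := fun x => w x * G x - u x * G x + 2 * K * (|u x - w x| * |ϑ x|)) iD
    ((iwG.sub iuG).add (iF.const_mul _)) (by
      filter_upwards [htr] with x hx
      have h1 : (u x - w x) * (D x + fderiv ℝ ϑ x (B x)) ≤ |u x - w x| * (K * |ϑ x|) :=
        (le_abs_self _).trans (by
          rw [abs_mul]; exact mul_le_mul_of_nonneg_left hx (abs_nonneg _))
      have h2 : (u x - w x) * (ϑ x * divergence B x) ≤ |u x - w x| * (|ϑ x| * K) :=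
        (le_abs_self _).trans (by
          rw [abs_mul, abs_mul]
          exact mul_le_mul_of_nonneg_left
            (mul_le_mul_of_nonneg_left (hdiv x) (abs_nonneg _)) (abs_nonneg _))
      simp only [hG]
      linarith)
  have iwu : Integrable fun x => w x * G x - u x * G x := iwG.sub iuG
  rw [integral_add iwu (iF.const_mul _), integral_sub iwG iuG, e1, e2,
    integral_const_mul] at hmono
  have hV1 : Integrable V μ := hV.integrable one_le_two
  have hbm : AEStronglyMeasurable (fun x => inner ℝ (ν x) (B x)) μ :=
    (hν.inner hB.continuous.measurable).aestronglyMeasurable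
  have hbK : ∀ᵐ x ∂μ, ‖inner ℝ (ν x) (B x)‖ ≤ K := by
    filter_upwards [h.norm_eq_one] with x hx
    exact (abs_real_inner_le_norm _ _).trans (by rw [hx, one_mul]; exact hBK x)
  have ib : Integrable (fun x => inner ℝ (ν x) (B x)) μ := Integrable.of_bound hbm K hbK
  have iw : Integrable (fun x => (V x - inner ℝ (ν x) (B x)) ^ 2) μ := by
    have h1 : MemLp (fun x => inner ℝ (ν x) (B x)) 2 μ := MemLp.of_bound hbm K hbK
    exact (memLp_two_iff_integrable_sq (hV.sub h1).1).1 (hV.sub h1)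
  have im : Integrable (fun x => 1 - inner ℝ (ν x) (ξ x)) μ :=
    (integrable_const 1).sub (h.integrable_inner hξm.aestronglyMeasurable hξ1)
  have iϑV : Integrable (fun x => ϑ x * V x) μ := hV1.bdd_mul (c := M)
    hϑ.continuous.aestronglyMeasurable (ae_of_all _ hϑM)
  have iϑb : Integrable (fun x => ϑ x * inner ℝ (ν x) (B x)) μ := ib.bdd_mul (c := M)
    hϑ.continuous.aestronglyMeasurable (ae_of_all _ hϑM)
  have hmono2 := integral_mono_ae
    (f := fun x => ϑ x * V x - ϑ x * inner ℝ (ν x) (B x))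
    (g := fun x => 1 / 2 * (V x - inner ℝ (ν x) (B x)) ^ 2 + K / 2 * (1 - inner ℝ (ν x) (ξ x)))
    (iϑV.sub iϑb) ((iw.const_mul _).add (im.const_mul _)) (by
      filter_upwards [h.norm_eq_one] with x hx
      have h1 := one_sub_norm_le_of_unit (x := ξ x) hx
      have h2 := mul_le_mul_of_nonneg_left h1 hK
      have h3 := hϑξ x
      nlinarith [sq_nonneg (ϑ x - (V x - inner ℝ (ν x) (B x)))])
  rw [integral_sub iϑV iϑb, integral_add (iw.const_mul _) (im.const_mul _), integral_const_mul,
    integral_const_mul] at hmono2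
  linarith

/-- The flux of `B` through the generalized surface is controlled by the volume error, if `w` has no
flux. -/
theorem IsPolarGradient.abs_flux_le (h : IsPolarGradient u μ ν) (hu : Integrable u)
    (hw : Integrable w) (hB : ContDiff ℝ 1 B) {K M : ℝ} (hBK : ∀ x, ‖B x‖ ≤ K)
    (hBd : ∀ x, ‖fderiv ℝ B x‖ ≤ K) (hdiv : ∀ x, |divergence B x| ≤ K)
    (hϑm : Continuous ϑ) (hϑM : ∀ x, |ϑ x| ≤ M) (hdivϑ : ∀ x, |divergence B x| ≤ K * |ϑ x|)
    (hflux : ∫ x, w x * divergence B x = 0) :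
    |∫ x, inner ℝ (ν x) (B x) ∂μ| ≤ K * ∫ x, |u x - w x| * |ϑ x| := by
  have hdB : Continuous (divergence B) := continuous_divergence hB
  have iu : Integrable fun x => u x * divergence B x :=
    hu.mul_bdd (c := K) hdB.aestronglyMeasurable (ae_of_all _ hdiv)
  have iw : Integrable fun x => w x * divergence B x :=
    hw.mul_bdd (c := K) hdB.aestronglyMeasurable (ae_of_all _ hdiv)
  have iF : Integrable fun x => |u x - w x| * |ϑ x| := (hu.sub hw).abs.mul_bdd (c := M)
    (hϑm.abs.aestronglyMeasurable) (ae_of_all _ fun x => by simpa using hϑM x)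
  have e : ∫ x, inner ℝ (ν x) (B x) ∂μ = ∫ x, (u x * divergence B x - w x * divergence B x) := by
    rw [integral_sub iu iw, hflux, sub_zero, h.integral_divergence_of_bounded hu hB hBK hBd]
  rw [e, ← integral_const_mul]
  refine norm_integral_le_of_norm_le
    (f := fun x => u x * divergence B x - w x * divergence B x) (iF.const_mul K)
    (ae_of_all _ fun x => ?_)
  rw [← sub_mul, norm_mul]
  calc |u x - w x| * |divergence B x| ≤ |u x - w x| * (K * |ϑ x|) :=
        mul_le_mul_of_nonneg_left (hdivϑ x) (abs_nonneg _)
    _ = K * (|u x - w x| * |ϑ x|) := by ring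

end

/-! ### Regularity of the calibration -/

section

variable {d : ℕ}

/-- At the boundary of a regular open set there are exterior points arbitrarily close by. -/
theorem IsLocalDefiningFunction.mem_closure_exterior {Ω : Set (Rd d)} {x : Rd d} {φ : Rd d → ℝ}
    (h : IsLocalDefiningFunction Ω x φ) (hx : x ∉ Ω) : x ∈ closure (closure Ω)ᶜ := by
  obtain ⟨hφ, hg, hloc⟩ := h
  set g := gradient φ x with hgdef
  have hφx : 0 ≤ φ x := not_lt.1 fun hlt => hx (hloc.self_of_nhds.2 hlt)
  have hd : HasDerivAt (fun s : ℝ => φ (x + s • g)) (‖g‖ ^ 2) 0 := by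
    have h1 : HasDerivAt (fun s : ℝ => x + s • g) g 0 := by
      simpa using ((hasDerivAt_id (0:ℝ)).smul_const g).const_add x
    have h2 : HasFDerivAt φ (fderiv ℝ φ x) (x + (0:ℝ) • g) := by
      simpa using (hφ.differentiable one_ne_zero x).hasFDerivAt
    have h3 := h2.comp_hasDerivAt (0:ℝ) h1
    have h4 : fderiv ℝ φ x g = ‖g‖ ^ 2 := by
      rw [← real_inner_self_eq_norm_sq, hgdef]
      exact inner_gradient_left.symm
    rwa [h4] at h3
  have hpos : ∀ᶠ s in 𝓝[>] (0:ℝ), 0 < φ (x + s • g) := by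
    have hsq : 0 < ‖g‖ ^ 2 := by positivity
    have h1 := hd.hasDerivWithinAt (s := Ioi 0)
    have h2 := (hasDerivWithinAt_iff_tendsto_slope' (by simp)).1 h1
    filter_upwards [h2.eventually (lt_mem_nhds hsq), self_mem_nhdsWithin] with s hs hs0
    rw [slope_def_field] at hs
    have hs0' : (0:ℝ) < s - 0 := by simpa using hs0
    have := (lt_div_iff₀ hs0').1 hs
    simp at this
    linarith
  have hlim : Tendsto (fun s : ℝ => x + s • g) (𝓝[>] 0) (𝓝 x) := by
    have : Tendsto (fun s : ℝ => x + s • g) (𝓝 0) (𝓝 (x + (0:ℝ) • g)) :=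
      Continuous.tendsto (by fun_prop) 0
    simp only [zero_smul, add_zero] at this
    exact this.mono_left nhdsWithin_le_nhds
  refine mem_closure_of_tendsto hlim ?_
  filter_upwards [hpos, hlim.eventually hloc.eventually_nhds] with s hs hev
  rw [mem_compl_iff, mem_closure_iff_frequently, not_frequently]
  filter_upwards [hev, hφ.continuous.continuousAt.eventually (lt_mem_nhds hs)] with y hy hy'
  exact fun hyΩ => (hy.1 hyΩ).not_gt hy'

/-- `ϑ` is nonpositive on the surface as a limit from inside, and nonnegative as a limit from
outside; the latter needs that `Ω` lies locally on one side of its boundary. -/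
theorem BoundsClosedSurface.theta_eq_zero {Ω : Set (Rd d)} (hΩ : BoundsClosedSurface Ω)
    {ϑ : Rd d → ℝ} (hϑ : Continuous ϑ) (hneg : ∀ x ∈ Ω, ϑ x < 0)
    (hpos : ∀ x ∉ closure Ω, 0 < ϑ x) {x : Rd d} (hx : x ∈ frontier Ω) : ϑ x = 0 := by
  refine le_antisymm ?_ ?_
  · exact closure_minimal (fun y hy => (hneg y hy).le) (isClosed_le hϑ continuous_const)
      (frontier_subset_closure hx)
  · obtain ⟨φ, hφ⟩ := hΩ.regular x hx
    have hxΩ : x ∉ Ω := by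
      rw [hΩ.isOpen.frontier_eq] at hx
      exact hx.2
    exact closure_minimal (fun y hy => (hpos y hy).le) (isClosed_le continuous_const hϑ)
      (hφ.mem_closure_exterior hxΩ)

theorem BoundsClosedSurface.theta_neg_iff {Ω : Set (Rd d)} (hΩ : BoundsClosedSurface Ω)
    {ϑ : Rd d → ℝ} (hϑ : Continuous ϑ) (hneg : ∀ x ∈ Ω, ϑ x < 0)
    (hpos : ∀ x ∉ closure Ω, 0 < ϑ x) (x : Rd d) : ϑ x < 0 ↔ x ∈ Ω := by
  refine ⟨fun h => ?_, hneg x⟩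
  by_contra hx
  by_cases hc : x ∈ closure Ω
  · have := hΩ.theta_eq_zero hϑ hneg hpos (x := x) (by
      rw [hΩ.isOpen.frontier_eq]; exact ⟨hc, hx⟩)
    exact h.ne this
  · exact (hpos x hc).not_gt h

/-- In dimension zero all gradients vanish, so there is no regular boundary point. -/
theorem BoundsClosedSurface.exists_eq_add_one {Ω : Set (Rd d)} (hΩ : BoundsClosedSurface Ω) :
    ∃ n, d = n + 1 := by
  cases d with
  | zero =>
    obtain ⟨x, hx⟩ := hΩ.nonempty
    obtain ⟨φ, -, hφ, -⟩ := hΩ.regular x hx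
    exact absurd (Subsingleton.elim _ _) hφ
  | succ n => exact ⟨n, rfl⟩

namespace IsCalibration

variable {Tstar : ℝ} {Ω : ℝ → Set (Rd d)} {ξ B : ℝ → Rd d → Rd d} {ϑ : ℝ → Rd d → ℝ}
  {lamStar : ℝ → ℝ}

/-- The time derivative of the calibration field. -/
def timeDeriv (Tstar : ℝ) (ξ : ℝ → Rd d → Rd d) (t : ℝ) (x : Rd d) : Rd d :=
  derivWithin (fun s => ξ s x) (Icc 0 Tstar) t

/-- The space-time derivative of the calibration field. -/
def spaceTimeDeriv (Tstar : ℝ) (ξ : ℝ → Rd d → Rd d) (p : ℝ × Rd d) : ℝ × Rd d →L[ℝ] Rd d :=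
  fderivWithin ℝ (Function.uncurry ξ) (Icc 0 Tstar ×ˢ univ) p

theorem uniqueDiffOn (hT : 0 < Tstar) :
    UniqueDiffOn ℝ (Icc 0 Tstar ×ˢ (univ : Set (Rd d))) :=
  (uniqueDiffOn_Icc hT).prod uniqueDiffOn_univ

theorem hasFDerivWithinAt (hcal : IsCalibration Tstar Ω ξ B ϑ lamStar) {t : ℝ}
    (ht : t ∈ Icc 0 Tstar) (x : Rd d) :
    HasFDerivWithinAt (Function.uncurry ξ) (spaceTimeDeriv Tstar ξ (t, x))
      (Icc 0 Tstar ×ˢ univ) (t, x) :=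
  (hcal.xi_C1.differentiableOn one_ne_zero (t, x) ⟨ht, mem_univ _⟩).hasFDerivWithinAt

theorem continuousOn_spaceTimeDeriv (hcal : IsCalibration Tstar Ω ξ B ϑ lamStar) (hT : 0 < Tstar) :
    ContinuousOn (spaceTimeDeriv Tstar ξ) (Icc 0 Tstar ×ˢ univ) :=
  hcal.xi_C1.continuousOn_fderivWithin (uniqueDiffOn hT) le_rfl

theorem fderiv_xi (hcal : IsCalibration Tstar Ω ξ B ϑ lamStar) {t : ℝ}
    (ht : t ∈ Icc 0 Tstar) (x : Rd d) :
    fderiv ℝ (ξ t) x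
      = (spaceTimeDeriv Tstar ξ (t, x)).comp (ContinuousLinearMap.inr ℝ ℝ (Rd d)) := by
  have h := (hcal.hasFDerivWithinAt ht x).comp x (f := fun y => (t, y)) (s := univ)
    (hasFDerivAt_prodMk_right t x).hasFDerivWithinAt fun y _ => ⟨ht, mem_univ _⟩
  exact (hasFDerivWithinAt_univ.1 h).fderiv

theorem hasDerivWithinAt_xi (hcal : IsCalibration Tstar Ω ξ B ϑ lamStar) {t : ℝ}
    (ht : t ∈ Icc 0 Tstar) (x : Rd d) :
    HasDerivWithinAt (fun s => ξ s x) (spaceTimeDeriv Tstar ξ (t, x) (1, 0)) (Icc 0 Tstar) t := by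
  have h := (hcal.hasFDerivWithinAt ht x).comp t (f := fun s => (s, x)) (s := Icc 0 Tstar)
    (hasFDerivAt_prodMk_left t x).hasFDerivWithinAt fun y hy => ⟨hy, mem_univ _⟩
  have h' := h.hasDerivWithinAt
  rw [ContinuousLinearMap.comp_apply, ContinuousLinearMap.inl_apply] at h'
  exact h'

theorem timeDeriv_eq (hcal : IsCalibration Tstar Ω ξ B ϑ lamStar)
    (hT : 0 < Tstar) {t : ℝ} (ht : t ∈ Icc 0 Tstar) (x : Rd d) :
    timeDeriv Tstar ξ t x = spaceTimeDeriv Tstar ξ (t, x) (1, 0) :=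
  (hcal.hasDerivWithinAt_xi ht x).derivWithin (uniqueDiffOn_Icc hT t ht)

theorem contDiff_xi (hcal : IsCalibration Tstar Ω ξ B ϑ lamStar)
    {t : ℝ} (ht : t ∈ Icc 0 Tstar) : ContDiff ℝ 1 (ξ t) := by
  rw [← contDiffOn_univ]
  exact hcal.xi_C1.comp (f := fun y : Rd d => (t, y)) (contDiff_prodMk_right t).contDiffOn
    fun y _ => ⟨ht, mem_univ _⟩

theorem continuous_timeDeriv (hcal : IsCalibration Tstar Ω ξ B ϑ lamStar)
    (hT : 0 < Tstar) {t : ℝ} (ht : t ∈ Icc 0 Tstar) :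
    Continuous (timeDeriv Tstar ξ t) := by
  have h1 : timeDeriv Tstar ξ t = fun x => spaceTimeDeriv Tstar ξ (t, x) (1, 0) :=
    funext fun x => hcal.timeDeriv_eq hT ht x
  rw [h1]
  have h2 : Continuous fun x : Rd d => spaceTimeDeriv Tstar ξ (t, x) := by
    rw [← continuousOn_univ]
    exact (hcal.continuousOn_spaceTimeDeriv hT).comp (f := fun y : Rd d => (t, y))
      (by fun_prop) fun y _ => ⟨ht, mem_univ _⟩
  exact h2.clm_apply continuous_const

theorem hasCompactSupport_xi (hcal : IsCalibration Tstar Ω ξ B ϑ lamStar)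
    {t : ℝ} (ht : t ∈ Icc 0 Tstar) : HasCompactSupport (ξ t) := by
  obtain ⟨R, hR⟩ := hcal.xi_compact
  exact HasCompactSupport.intro (isCompact_closedBall 0 R) fun x hx =>
    hR t ht x (by simpa using hx)

theorem exists_norm_spaceTimeDeriv_le (hcal : IsCalibration Tstar Ω ξ B ϑ lamStar)
    (hT : 0 < Tstar) :
    ∃ K : ℝ≥0, ∀ t ∈ Icc 0 Tstar, ∀ x, ‖spaceTimeDeriv Tstar ξ (t, x)‖ ≤ K := by
  obtain ⟨R, hR⟩ := hcal.xi_compact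
  have hcomp : IsCompact (Icc 0 Tstar ×ˢ Metric.closedBall (0 : Rd d) R) :=
    isCompact_Icc.prod (isCompact_closedBall 0 R)
  obtain ⟨C, hC⟩ := hcomp.exists_bound_of_continuousOn
    ((hcal.continuousOn_spaceTimeDeriv hT).mono (prod_mono_right (subset_univ _)))
  refine ⟨C.toNNReal, fun t ht x => ?_⟩
  by_cases hx : R < ‖x‖
  · have h0 : HasFDerivWithinAt (Function.uncurry ξ) (0 : ℝ × Rd d →L[ℝ] Rd d)
        (Icc 0 Tstar ×ˢ univ) (t, x) := by
      refine (hasFDerivWithinAt_const (0 : Rd d) (t, x) _).congr_of_eventuallyEq ?_ (hR t ht x hx)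
      have hU : {p : ℝ × Rd d | R < ‖p.2‖} ∈ 𝓝 (t, x) :=
        (isOpen_lt continuous_const (by fun_prop)).mem_nhds hx
      filter_upwards [mem_nhdsWithin_of_mem_nhds hU, self_mem_nhdsWithin] with p hp hpS
      exact hR p.1 hpS.1 p.2 hp
    rw [spaceTimeDeriv, h0.fderivWithin (uniqueDiffOn hT (t, x) ⟨ht, mem_univ _⟩)]
    simp
  · exact (hC (t, x) ⟨ht, by simpa using hx⟩).trans (Real.le_coe_toNNReal C)

theorem norm_xi_le_one (hcal : IsCalibration Tstar Ω ξ B ϑ lamStar) {t : ℝ}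
    (ht : t ∈ Icc 0 Tstar) (x : Rd d) : ‖ξ t x‖ ≤ 1 := by
  obtain ⟨c, hc, h⟩ := hcal.xi_short
  refine (h t ht x).trans (max_le ?_ zero_le_one)
  have : 0 ≤ c * Metric.infDist x (frontier (Ω t)) ^ 2 := by positivity
  linarith

theorem exists_lipschitzOnWith_xi (hcal : IsCalibration Tstar Ω ξ B ϑ lamStar) (hT : 0 < Tstar) :
    ∃ K : ℝ≥0, LipschitzOnWith K (Function.uncurry ξ) (Icc 0 Tstar ×ˢ univ) := by
  obtain ⟨K, hK⟩ := hcal.exists_norm_spaceTimeDeriv_le hT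
  refine ⟨K, Convex.lipschitzOnWith_of_nnnorm_fderivWithin_le
    (hcal.xi_C1.differentiableOn one_ne_zero) (fun p hp => ?_)
    ((convex_Icc 0 Tstar).prod convex_univ)⟩
  exact hK p.1 hp.1 p.2

end IsCalibration

end

/-! ### Uniform bounds for the calibration -/

section

variable {d : ℕ}

/-- A bounded quantity of order `δ` has its square controlled by the truncation of `δ ^ 2`. -/
theorem sq_le_of_dist {a C M c δ m : ℝ} (hc : 0 < c) (h1 : |a| ≤ C * δ) (h2 : |a| ≤ M)
    (hm : min (c * δ ^ 2) 1 ≤ m) : a ^ 2 ≤ (C ^ 2 / c + M ^ 2) * m := by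
  rw [← sq_abs]
  have h3 : |a| ^ 2 ≤ (C * δ) ^ 2 := pow_le_pow_left₀ (abs_nonneg a) h1 2
  have h4 : |a| ^ 2 ≤ M ^ 2 := pow_le_pow_left₀ (abs_nonneg a) h2 2
  have hm0 : 0 ≤ m := le_trans (le_min (by positivity) zero_le_one) hm
  rw [add_mul]
  rcases min_le_iff.1 hm with h | h
  · have h5 : C ^ 2 / c * (c * δ ^ 2) ≤ C ^ 2 / c * m := mul_le_mul_of_nonneg_left h (by positivity)
    have h6 : C ^ 2 / c * (c * δ ^ 2) = (C * δ) ^ 2 := by field_simp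
    have h7 : 0 ≤ M ^ 2 * m := by positivity
    linarith
  · have h5 : M ^ 2 * 1 ≤ M ^ 2 * m := mul_le_mul_of_nonneg_left h (by positivity)
    have h7 : 0 ≤ C ^ 2 / c * m := by positivity
    linarith

/-- A bounded quantity of order `δ ^ 2` is controlled by the truncation of `δ ^ 2`. -/
theorem abs_le_of_dist_sq {a C M c δ m : ℝ} (hc : 0 < c) (h1 : |a| ≤ C * δ ^ 2) (h2 : |a| ≤ M)
    (hm : min (c * δ ^ 2) 1 ≤ m) : |a| ≤ (|C| / c + |M|) * m := by
  have h3 : |a| ≤ |C| * δ ^ 2 := h1.trans (mul_le_mul_of_nonneg_right (le_abs_self C) (sq_nonneg δ))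
  have hm0 : 0 ≤ m := le_trans (le_min (by positivity) zero_le_one) hm
  rw [add_mul]
  rcases min_le_iff.1 hm with h | h
  · have h5 : |C| / c * (c * δ ^ 2) ≤ |C| / c * m := mul_le_mul_of_nonneg_left h (by positivity)
    have h6 : |C| / c * (c * δ ^ 2) = |C| * δ ^ 2 := by field_simp
    have h7 : 0 ≤ |M| * m := by positivity
    linarith
  · have h5 : |M| * 1 ≤ |M| * m := mul_le_mul_of_nonneg_left h (by positivity)
    have h7 : 0 ≤ |C| / c * m := by positivity
    linarith [le_abs_self M]

/-- A bounded quantity of order `δ` is controlled by the truncation of `δ`. -/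
theorem abs_le_of_dist_min {a C M c δ m : ℝ} (hc : 0 < c) (hδ : 0 ≤ δ) (h1 : |a| ≤ C * δ)
    (h2 : |a| ≤ M) (hm : min δ c ≤ m) : |a| ≤ (|C| + |M| / c) * m := by
  have h3 : |a| ≤ |C| * δ := h1.trans (mul_le_mul_of_nonneg_right (le_abs_self C) hδ)
  have hm0 : 0 ≤ m := le_trans (le_min hδ hc.le) hm
  rw [add_mul]
  rcases min_le_iff.1 hm with h | h
  · have h5 : |C| * δ ≤ |C| * m := mul_le_mul_of_nonneg_left h (by positivity)
    have h7 : 0 ≤ |M| / c * m := by positivity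
    linarith
  · have h5 : |M| / c * c ≤ |M| / c * m := mul_le_mul_of_nonneg_left h (by positivity)
    have h6 : |M| / c * c = |M| := by field_simp
    have h7 : 0 ≤ |C| * m := by positivity
    linarith [le_abs_self M]

/-- The calibration estimates with a single constant, with the distance to the surface replaced by
the quantities `1 - |ξ|` and `|ϑ|` that enter the relative entropy and the volume error. The
function `f` is the one in the transport equation for `ξ`. -/
structure CalibrationBounds (Tstar : ℝ) (ξ B : ℝ → Rd d → Rd d) (ϑ : ℝ → Rd d → ℝ)
    (lamStar : ℝ → ℝ) (f : ℝ → Rd d → ℝ) (K : ℝ) : Prop where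
  norm_fderiv_xi : ∀ t ∈ Icc 0 Tstar, ∀ x, ‖fderiv ℝ (ξ t) x‖ ≤ K
  norm_timeDeriv : ∀ t ∈ Icc 0 Tstar, ∀ x, ‖IsCalibration.timeDeriv Tstar ξ t x‖ ≤ K
  norm_B : ∀ t ∈ Icc 0 Tstar, ∀ x, ‖B t x‖ ≤ K
  norm_fderiv_B : ∀ t ∈ Icc 0 Tstar, ∀ x, ‖fderiv ℝ (B t) x‖ ≤ K
  abs_f : ∀ t ∈ Icc 0 Tstar, ∀ x, |f t x| ≤ K
  transport_xi : ∀ t ∈ Icc 0 Tstar, ∀ x,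
    ‖IsCalibration.timeDeriv Tstar ξ t x + fderiv ℝ (ξ t) x (B t x)
      + ContinuousLinearMap.adjoint (fderiv ℝ (B t) x) (ξ t x) - f t x • ξ t x‖ ^ 2
      ≤ K * (1 - ‖ξ t x‖)
  transport_norm_xi : ∀ t ∈ Icc 0 Tstar, ∀ x,
    |inner ℝ (ξ t x) (IsCalibration.timeDeriv Tstar ξ t x)
      + inner ℝ (ξ t x) (fderiv ℝ (ξ t) x (B t x))| ≤ K * (1 - ‖ξ t x‖)
  evolution : ∀ t ∈ Icc 0 Tstar, ∀ x,
    (inner ℝ (B t x) (ξ t x) + divergence (ξ t) x - lamStar t) ^ 2 ≤ K * (1 - ‖ξ t x‖)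
  abs_lamStar : ∀ t ∈ Icc 0 Tstar, |lamStar t| ≤ K
  abs_theta : ∀ t ∈ Icc 0 Tstar, ∀ x, |ϑ t x| ≤ K
  theta_sq : ∀ t ∈ Icc 0 Tstar, ∀ x, ϑ t x ^ 2 ≤ K * (1 - ‖ξ t x‖)
  abs_div_B : ∀ t ∈ Icc 0 Tstar, ∀ x, |divergence (B t) x| ≤ K
  div_B : ∀ t ∈ Icc 0 Tstar, ∀ x, |divergence (B t) x| ≤ K * |ϑ t x|
  transport_theta : ∀ᵐ t ∂(volume.restrict (Ioo 0 Tstar)), ∀ᵐ x : Rd d,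
    |deriv (fun s => ϑ s x) t + fderiv ℝ (ϑ t) x (B t x)| ≤ K * |ϑ t x|

namespace IsCalibration

variable {Tstar : ℝ} {Ω : ℝ → Set (Rd d)} {ξ B : ℝ → Rd d → Rd d} {ϑ : ℝ → Rd d → ℝ}
  {lamStar : ℝ → ℝ}

theorem lipschitzWith_theta {K : ℝ≥0}
    (hK : LipschitzOnWith K (Function.uncurry ϑ) (Icc 0 Tstar ×ˢ univ)) {t : ℝ}
    (ht : t ∈ Icc 0 Tstar) : LipschitzWith K (ϑ t) := LipschitzWith.of_dist_le_mul fun x y => by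
  have h := hK.dist_le_mul (t, x) ⟨ht, mem_univ _⟩ (t, y) ⟨ht, mem_univ _⟩
  simpa [Prod.dist_eq] using h

theorem lipschitzOnWith_theta_time {K : ℝ≥0}
    (hK : LipschitzOnWith K (Function.uncurry ϑ) (Icc 0 Tstar ×ˢ univ)) (x : Rd d) :
    LipschitzOnWith K (fun s => ϑ s x) (Icc 0 Tstar) :=
  LipschitzOnWith.of_dist_le_mul fun s hs t ht => by
  have h := hK.dist_le_mul (s, x) ⟨hs, mem_univ _⟩ (t, x) ⟨ht, mem_univ _⟩
  simpa [Prod.dist_eq] using h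

/-- The shortness of `ξ` in the form used with `sq_le_of_dist` and `abs_le_of_dist_sq`: the
truncated squared distance is bounded by `1 - |ξ|`. -/
theorem min_dist_le (hcal : IsCalibration Tstar Ω ξ B ϑ lamStar) :
    ∃ c : ℝ, 0 < c ∧ ∀ t ∈ Icc 0 Tstar, ∀ x,
      min (c * Metric.infDist x (frontier (Ω t)) ^ 2) 1 ≤ 1 - ‖ξ t x‖ := by
  obtain ⟨c, hc, h⟩ := hcal.xi_short
  refine ⟨c, hc, fun t ht x => ?_⟩
  rcases le_max_iff.1 (h t ht x) with h1 | h1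
  · exact (min_le_left _ _).trans (by linarith)
  · exact (min_le_right _ _).trans (by linarith)

/-- `ϑ` is Lipschitz and vanishes on the surface. -/
theorem abs_theta_le_dist (hcal : IsCalibration Tstar Ω ξ B ϑ lamStar)
    (hΩ : ∀ t ∈ Icc 0 Tstar, BoundsClosedSurface (Ω t)) {K : ℝ≥0}
    (hK : LipschitzOnWith K (Function.uncurry ϑ) (Icc 0 Tstar ×ˢ univ)) {t : ℝ}
    (ht : t ∈ Icc 0 Tstar) (x : Rd d) : |ϑ t x| ≤ K * Metric.infDist x (frontier (Ω t)) := by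
  have hL := lipschitzWith_theta hK ht
  obtain ⟨y, hy, hyd⟩ := (hΩ t ht).isCompact.exists_infDist_eq_dist (hΩ t ht).nonempty x
  have h0 := (hΩ t ht).theta_eq_zero hL.continuous (hcal.theta_neg t ht) (hcal.theta_pos t ht) hy
  have h1 := hL.dist_le_mul x y
  rw [h0, Real.dist_eq, sub_zero] at h1
  rw [hyd]
  exact h1

/-- Every quantity of order `dist` or `dist ^ 2` in the conditions on the calibration is also
bounded, so the distance can be truncated and then replaced by `1 - |ξ|` or `|ϑ|`. -/
theorem exists_bounds (hcal : IsCalibration Tstar Ω ξ B ϑ lamStar) (hT : 0 < Tstar)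
    (hΩ : ∀ t ∈ Icc 0 Tstar, BoundsClosedSurface (Ω t)) :
    ∃ (f : ℝ → Rd d → ℝ) (K : ℝ), CalibrationBounds Tstar ξ B ϑ lamStar f K := by
  obtain ⟨Kξ, hKξ⟩ := hcal.exists_norm_spaceTimeDeriv_le hT
  obtain ⟨Kϑ, hKϑ⟩ := hcal.theta_lip
  obtain ⟨Mϑ, hMϑ⟩ := hcal.theta_bdd
  obtain ⟨KB, hKB⟩ := hcal.B_bdd
  obtain ⟨Cd, hCd⟩ := hcal.div_B
  obtain ⟨c, hc, hmin⟩ := hcal.min_dist_le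
  obtain ⟨Ct, hCt⟩ := hcal.transport_theta
  obtain ⟨Cn, hCn⟩ := hcal.transport_norm_xi
  obtain ⟨Cx, f, hCx⟩ := hcal.transport_xi
  obtain ⟨Ce, hCe⟩ := hcal.evolution
  obtain ⟨c', hc', hcoer⟩ := hcal.theta_coercive
  have h0 : (0:ℝ) ∈ Icc 0 Tstar := ⟨le_rfl, hT.le⟩
  have hKB0 : 0 ≤ KB := (norm_nonneg _).trans (hKB 0 h0 0).1
  have hMϑ0 : 0 ≤ Mϑ := (abs_nonneg _).trans (hMϑ 0 h0 0)
  have hCx0 : 0 ≤ Cx := (abs_nonneg _).trans (hCx 0 h0 0).1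
  have hKξ0 : (0:ℝ) ≤ Kξ := Kξ.2
  have bξ : ∀ t ∈ Icc 0 Tstar, ∀ x v, ‖fderiv ℝ (ξ t) x v‖ ≤ Kξ * ‖v‖ := fun t ht x v => by
    rw [hcal.fderiv_xi ht]
    refine ((spaceTimeDeriv Tstar ξ (t, x)).le_of_opNorm_le (hKξ t ht x) _).trans (le_of_eq ?_)
    simp [Prod.norm_def]
  have bξ' : ∀ t ∈ Icc 0 Tstar, ∀ x, ‖fderiv ℝ (ξ t) x‖ ≤ Kξ := fun t ht x =>
    ContinuousLinearMap.opNorm_le_bound _ hKξ0 (bξ t ht x)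
  have bτ : ∀ t ∈ Icc 0 Tstar, ∀ x, ‖timeDeriv Tstar ξ t x‖ ≤ Kξ := fun t ht x => by
    rw [hcal.timeDeriv_eq hT ht]
    refine ((spaceTimeDeriv Tstar ξ (t, x)).le_of_opNorm_le (hKξ t ht x) _).trans (le_of_eq ?_)
    simp [Prod.norm_def]
  have bξB : ∀ t ∈ Icc 0 Tstar, ∀ x, ‖fderiv ℝ (ξ t) x (B t x)‖ ≤ Kξ * KB := fun t ht x =>
    (bξ t ht x _).trans (mul_le_mul_of_nonneg_left (hKB t ht x).1 hKξ0)
  have b1 := fun t ht x => hcal.norm_xi_le_one (t := t) ht x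
  have bdivξ : ∀ t ∈ Icc 0 Tstar, ∀ x, |divergence (ξ t) x| ≤ d * Kξ := fun t ht x =>
    (abs_divergence_le _ x).trans (mul_le_mul_of_nonneg_left (bξ' t ht x) (by positivity))
  have bdivB : ∀ t ∈ Icc 0 Tstar, ∀ x, |divergence (B t) x| ≤ d * KB := fun t ht x =>
    (abs_divergence_le _ x).trans (mul_le_mul_of_nonneg_left (hKB t ht x).2 (by positivity))
  have bin : ∀ t ∈ Icc 0 Tstar, ∀ x, |inner ℝ (B t x) (ξ t x)| ≤ KB := fun t ht x =>
    (abs_real_inner_le_norm _ _).trans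
      ((mul_le_mul (hKB t ht x).1 (b1 t ht x) (norm_nonneg _) hKB0).trans (by rw [mul_one]))
  -- on the surface, where the distance vanishes, the evolution equation determines `lamStar`
  have bl : ∀ t ∈ Icc 0 Tstar, |lamStar t| ≤ KB + d * Kξ := fun t ht => by
    obtain ⟨y, hy⟩ := (hΩ t ht).nonempty
    have h1 := hCe t ht y
    rw [Metric.infDist_zero_of_mem hy, mul_zero] at h1
    have h2 := abs_nonpos_iff.1 h1
    have h3 : lamStar t = inner ℝ (B t y) (ξ t y) + divergence (ξ t) y := by linarith
    rw [h3]
    exact (abs_add_le _ _).trans (add_le_add (bin t ht y) (bdivξ t ht y))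
  have bR : ∀ t ∈ Icc 0 Tstar, ∀ x, ‖timeDeriv Tstar ξ t x + fderiv ℝ (ξ t) x (B t x)
      + ContinuousLinearMap.adjoint (fderiv ℝ (B t) x) (ξ t x) - f t x • ξ t x‖ ^ 2
      ≤ (Cx ^ 2 / c + (Kξ + Kξ * KB + KB + Cx) ^ 2) * (1 - ‖ξ t x‖) := fun t ht x => by
    refine sq_le_of_dist hc (δ := Metric.infDist x (frontier (Ω t))) ?_ ?_ (hmin t ht x)
    · rw [abs_norm]; exact (hCx t ht x).2
    · rw [abs_norm]
      refine (norm_sub_le _ _).trans (add_le_add ((norm_add_le _ _).trans (add_le_add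
        ((norm_add_le _ _).trans (add_le_add (bτ t ht x) (bξB t ht x))) ?_)) ?_)
      · refine (ContinuousLinearMap.le_opNorm _ _).trans ?_
        rw [LinearIsometryEquiv.norm_map]
        exact (mul_le_mul (hKB t ht x).2 (b1 t ht x) (norm_nonneg _) hKB0).trans (by rw [mul_one])
      · rw [norm_smul]
        exact (mul_le_mul (hCx t ht x).1 (b1 t ht x) (norm_nonneg _) hCx0).trans (by rw [mul_one])
  have bN : ∀ t ∈ Icc 0 Tstar, ∀ x, |inner ℝ (ξ t x) (timeDeriv Tstar ξ t x)
      + inner ℝ (ξ t x) (fderiv ℝ (ξ t) x (B t x))|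
      ≤ (|Cn / 2| / c + |Kξ + Kξ * KB|) * (1 - ‖ξ t x‖) := fun t ht x => by
    refine abs_le_of_dist_sq hc (δ := Metric.infDist x (frontier (Ω t))) ?_ ?_ (hmin t ht x)
    · have h1 := hCn t ht x
      have e1 : derivWithin (fun s => ‖ξ s x‖ ^ 2) (Icc 0 Tstar) t
          = 2 * inner ℝ (ξ t x) (timeDeriv Tstar ξ t x) := by
        rw [hcal.timeDeriv_eq hT ht]
        exact (hcal.hasDerivWithinAt_xi ht x).norm_sq.derivWithin (uniqueDiffOn_Icc hT t ht)
      have e2 : fderiv ℝ (fun y => ‖ξ t y‖ ^ 2) x (B t x)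
          = 2 * inner ℝ (ξ t x) (fderiv ℝ (ξ t) x (B t x)) := by
        rw [((hcal.contDiff_xi ht).differentiable one_ne_zero x).hasFDerivAt.norm_sq.fderiv]
        simp
      rw [e1, e2, ← mul_add, abs_mul, abs_two] at h1
      linarith
    · refine (abs_add_le _ _).trans (add_le_add ?_ ?_) <;>
        refine (abs_real_inner_le_norm _ _).trans ?_
      · exact (mul_le_mul (b1 t ht x) (bτ t ht x) (norm_nonneg _) zero_le_one).trans
          (by rw [one_mul])
      · exact (mul_le_mul (b1 t ht x) (bξB t ht x) (norm_nonneg _) zero_le_one).trans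
          (by rw [one_mul])
  have bs : ∀ t ∈ Icc 0 Tstar, ∀ x,
      (inner ℝ (B t x) (ξ t x) + divergence (ξ t) x - lamStar t) ^ 2
      ≤ (Ce ^ 2 / c + (KB + d * Kξ + (KB + d * Kξ)) ^ 2) * (1 - ‖ξ t x‖) := fun t ht x =>
    sq_le_of_dist hc (hCe t ht x) ((abs_sub _ _).trans (add_le_add ((abs_add_le _ _).trans
      (add_le_add (bin t ht x) (bdivξ t ht x))) (bl t ht))) (hmin t ht x)
  have bϑ2 : ∀ t ∈ Icc 0 Tstar, ∀ x, ϑ t x ^ 2 ≤ ((Kϑ : ℝ) ^ 2 / c + Mϑ ^ 2) * (1 - ‖ξ t x‖) :=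
    fun t ht x => sq_le_of_dist hc (hcal.abs_theta_le_dist hΩ hKϑ ht x) (hMϑ t ht x) (hmin t ht x)
  have bdB : ∀ t ∈ Icc 0 Tstar, ∀ x, |divergence (B t) x|
      ≤ (|Cd| + |d * KB| / c') * |ϑ t x| := fun t ht x =>
    abs_le_of_dist_min hc' Metric.infDist_nonneg (hCd t ht x) (bdivB t ht x) (hcoer t ht x)
  have btr : ∀ᵐ t ∂(volume.restrict (Ioo 0 Tstar)), ∀ᵐ x : Rd d,
      |deriv (fun s => ϑ s x) t + fderiv ℝ (ϑ t) x (B t x)|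
        ≤ (|Ct| + |Kϑ + Kϑ * KB| / c') * |ϑ t x| := by
    filter_upwards [hCt, ae_restrict_mem measurableSet_Ioo] with t ht htI
    filter_upwards [ht] with x hx
    have htI' := Ioo_subset_Icc_self htI
    refine abs_le_of_dist_min hc' Metric.infDist_nonneg hx
      ((abs_add_le _ _).trans (add_le_add ?_ ?_)) (hcoer t htI' x)
    · exact norm_deriv_le_of_lipschitzOn (Icc_mem_nhds htI.1 htI.2)
        (lipschitzOnWith_theta_time hKϑ x)
    · exact ((fderiv ℝ (ϑ t) x).le_of_opNorm_le
        (norm_fderiv_le_of_lipschitz ℝ (lipschitzWith_theta hKϑ htI')) _).trans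
        (mul_le_mul_of_nonneg_left (hKB t htI' x).1 Kϑ.2)
  set K1 := Cx ^ 2 / c + (Kξ + Kξ * KB + KB + Cx) ^ 2
  set K2 := |Cn / 2| / c + |Kξ + Kξ * KB|
  set K3 := Ce ^ 2 / c + (KB + d * Kξ + (KB + d * Kξ)) ^ 2
  set K4 := (Kϑ : ℝ) ^ 2 / c + Mϑ ^ 2
  set K5 := |Cd| + |d * KB| / c'
  set K6 := |Ct| + |Kϑ + Kϑ * KB| / c'
  have p1 : 0 ≤ K1 := by positivity
  have p2 : 0 ≤ K2 := by positivity
  have p3 : 0 ≤ K3 := by positivity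
  have p4 : 0 ≤ K4 := by positivity
  have p5 : 0 ≤ K5 := by positivity
  have p6 : 0 ≤ K6 := by positivity
  have p7 : 0 ≤ (d : ℝ) * Kξ := by positivity
  have p8 : 0 ≤ (d : ℝ) * KB := by positivity
  have p9 := fun t ht x => sub_nonneg.2 (b1 t ht x)
  refine ⟨f, K1 + K2 + K3 + K4 + K5 + K6 + d * Kξ + d * KB + Kξ + KB + Cx + Mϑ, ?_⟩
  constructor
  · exact fun t ht x => (bξ' t ht x).trans (by linarith)
  · exact fun t ht x => (bτ t ht x).trans (by linarith)
  · exact fun t ht x => (hKB t ht x).1.trans (by linarith)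
  · exact fun t ht x => (hKB t ht x).2.trans (by linarith)
  · exact fun t ht x => (hCx t ht x).1.trans (by linarith)
  · exact fun t ht x => (bR t ht x).trans (mul_le_mul_of_nonneg_right (by linarith) (p9 t ht x))
  · exact fun t ht x => (bN t ht x).trans (mul_le_mul_of_nonneg_right (by linarith) (p9 t ht x))
  · exact fun t ht x => (bs t ht x).trans (mul_le_mul_of_nonneg_right (by linarith) (p9 t ht x))
  · exact fun t ht => (bl t ht).trans (by linarith)
  · exact fun t ht x => (hMϑ t ht x).trans (by linarith)
  · exact fun t ht x => (bϑ2 t ht x).trans (mul_le_mul_of_nonneg_right (by linarith) (p9 t ht x))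
  · exact fun t ht x => (bdivB t ht x).trans (by linarith)
  · exact fun t ht x => (bdB t ht x).trans (mul_le_mul_of_nonneg_right (by linarith)
      (abs_nonneg _))
  · filter_upwards [btr] with t ht
    filter_upwards [ht] with x hx
    exact hx.trans (mul_le_mul_of_nonneg_right (by linarith) (abs_nonneg _))

/-- The calibrated domain has vanishing flux of `B`, because `lamStar` is the average of `∇ · ξ`. -/
theorem integral_div_B_eq_zero (hcal : IsCalibration Tstar Ω ξ B ϑ lamStar) {n : ℕ}
    (hn : d = n + 1) {t : ℝ} (ht : t ∈ Icc 0 Tstar) (hΩ : BoundsClosedSurface (Ω t))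
    (hi : Integrable (charFn (Ω t))) : ∫ x, charFn (Ω t) x * divergence (B t) x = 0 := by
  have hpol := isPolarGradient_charFn hn hΩ.isOpen hΩ.isCompact (hcal.contDiff_xi ht).continuous
    (hcal.xi_normal t ht)
  have hfin := hpol.finite
  obtain ⟨KB, hKB⟩ := hcal.B_bdd
  obtain ⟨Ce, hCe⟩ := hcal.evolution
  rw [hpol.integral_divergence_of_bounded hi (hcal.B_C1 t ht) (fun x => (hKB t ht x).1)
    (fun x => (hKB t ht x).2)]
  have h1 : ∫ x, inner ℝ (ξ t x) (B t x) ∂(surfaceMeasure n (Ω t))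
      = ∫ x, (lamStar t - divergence (ξ t) x) ∂(surfaceMeasure n (Ω t)) := by
    refine integral_congr_ae ?_
    filter_upwards [ae_restrict_mem isClosed_frontier.measurableSet] with y hy
    have h2 := hCe t ht y
    rw [Metric.infDist_zero_of_mem hy, mul_zero] at h2
    have h3 := abs_nonpos_iff.1 h2
    rw [real_inner_comm]
    linarith
  have hdiv : Integrable (divergence (ξ t)) (surfaceMeasure n (Ω t)) := by
    have hc : Continuous (divergence (ξ t)) := continuous_divergence (hcal.contDiff_xi ht)
    have hfd := ((hcal.contDiff_xi ht).continuous_fderiv one_ne_zero)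
    obtain ⟨M, hM⟩ := hfd.bounded_above_of_compact_support ((hcal.hasCompactSupport_xi ht).fderiv ℝ)
    exact Integrable.of_bound hc.aestronglyMeasurable (d * M) (ae_of_all _ fun x =>
      (abs_divergence_le _ x).trans (mul_le_mul_of_nonneg_left (hM x) (by positivity)))
  rw [h1, integral_sub (integrable_const _) hdiv, integral_const, smul_eq_mul]
  -- the Hausdorff measure and the surface measure differ by a constant factor
  set k := Measure.addHaarScalarFactor (volume : Measure (EuclideanSpace ℝ (Fin n))) μH[n] with hk
  have hk0 : k ≠ 0 := Measure.addHaarScalarFactor_volume_hausdorffMeasure_ne_zero n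
  have hsm : surfaceMeasure n (Ω t) =
      k • (μH[(n : ℝ)] : Measure (Rd d)).restrict (frontier (Ω t)) := by
    rw [surfaceMeasure, Measure.euclideanHausdorffMeasure_def, Measure.restrict_smul]
  have hdn : (d : ℝ) - 1 = n := by rw [hn]; push_cast; ring
  have hav := hcal.lamStar_eq t ht
  rw [hdn, average_eq, smul_eq_mul] at hav
  set ρ := (μH[(n : ℝ)] : Measure (Rd d)).restrict (frontier (Ω t)) with hρ
  have hρfin : IsFiniteMeasure ρ := by
    refine ⟨?_⟩
    have h2 := measure_lt_top (surfaceMeasure n (Ω t)) univ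
    rw [hsm, Measure.smul_apply] at h2
    by_contra hcon
    rw [not_lt, top_le_iff] at hcon
    rw [hcon, ENNReal.smul_top] at h2
    simp [hk0] at h2
  rw [hsm, integral_smul_nnreal_measure, measureReal_nnreal_smul_apply, hav]
  by_cases hρ0 : ρ.real univ = 0
  · have : ρ = 0 := by
      rwa [measureReal_eq_zero_iff, Measure.measure_univ_eq_zero] at hρ0
    simp [this]
  · rw [NNReal.smul_def, smul_eq_mul]
    field_simp
    ring

end IsCalibration

end

/-! ### Space-time extensions of the calibration -/

section

variable {d : ℕ}

theorem lipschitzWith_smul_of_bounded {α F : Type*} [PseudoMetricSpace α] [NormedAddCommGroup F]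
    [NormedSpace ℝ F] {f : α → ℝ} {g : α → F} {K L M N : ℝ≥0} (hf : LipschitzWith K f)
    (hg : LipschitzWith L g) (hM : ∀ x, |f x| ≤ M) (hN : ∀ x, ‖g x‖ ≤ N) :
    LipschitzWith (M * L + N * K) (fun x => f x • g x) := by
  refine LipschitzWith.of_dist_le_mul fun x y => ?_
  have h1 := hf.dist_le_mul x y
  have h2 := hg.dist_le_mul x y
  rw [dist_eq_norm] at *
  calc ‖f x • g x - f y • g y‖ = ‖f x • (g x - g y) + (f x - f y) • g y‖ := by
        rw [smul_sub, sub_smul]; abel_nf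
    _ ≤ |f x| * ‖g x - g y‖ + ‖f x - f y‖ * ‖g y‖ := by
        refine (norm_add_le _ _).trans (le_of_eq ?_)
        rw [norm_smul, norm_smul, Real.norm_eq_abs]
    _ ≤ M * (L * dist x y) + (K * dist x y) * N := by
        gcongr
        · exact hM x
        · exact hN y
    _ = _ := by push_cast; ring

namespace IsCalibration

variable {Tstar : ℝ} {Ω : ℝ → Set (Rd d)} {ξ B : ℝ → Rd d → Rd d} {ϑ : ℝ → Rd d → ℝ}
  {lamStar : ℝ → ℝ}

/-- Freezing a function in time outside `[0, T]` preserves its Lipschitz constant. -/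
theorem lipschitzWith_comp_projIcc {F : Type*} [PseudoEMetricSpace F] {T : ℝ} (hT : 0 ≤ T)
    {g : ℝ → Rd d → F} {K : ℝ≥0}
    (hK : LipschitzOnWith K (Function.uncurry g) (Icc 0 T ×ˢ univ)) :
    LipschitzWith K (fun p : ℝ × Rd d => g (projIcc 0 T hT p.1) p.2) := by
  have hP : LipschitzWith 1 (fun p : ℝ × Rd d => (((projIcc 0 T hT p.1 : Icc 0 T) : ℝ), p.2)) := by
    have h1 : LipschitzWith 1 (fun p : ℝ × Rd d => ((projIcc 0 T hT p.1 : Icc 0 T) : ℝ)) := by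
      have h := (LipschitzWith.subtype_val (Icc 0 T)).comp
        ((LipschitzWith.projIcc hT).comp (LipschitzWith.prod_fst (α := ℝ) (β := Rd d)))
      rw [mul_one, mul_one] at h
      exact h
    simpa using h1.prodMk LipschitzWith.prod_snd
  have h2 := hK.comp (hP.lipschitzOnWith (s := univ)) fun p _ => ⟨Subtype.mem _, mem_univ _⟩
  rw [mul_one, lipschitzOnWith_univ] at h2
  exact h2

/-- The calibration field extends from `[0, Tstar]` to a compactly supported Lipschitz field in
space-time. -/
theorem exists_xiExt (hcal : IsCalibration Tstar Ω ξ B ϑ lamStar) (hT : 0 < Tstar) :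
    ∃ (X : ℝ × Rd d → Rd d) (K : ℝ≥0), LipschitzWith K X ∧ HasCompactSupport X ∧
      (∀ t ∈ Icc 0 Tstar, ∀ x, X (t, x) = ξ t x) ∧
      (∀ t ∈ Ioo 0 Tstar, ∀ x, ContDiffAt ℝ 1 X (t, x)) := by
  set θ : ContDiffBump (0 : ℝ) := ⟨Tstar + 1, Tstar + 2, by linarith, by linarith⟩ with hθ
  obtain ⟨K, hK⟩ := hcal.exists_lipschitzOnWith_xi hT
  obtain ⟨L, hL⟩ := (θ.contDiff (n := 1)).lipschitzWith_of_hasCompactSupport θ.hasCompactSupport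
    one_ne_zero
  obtain ⟨R, hR⟩ := hcal.xi_compact
  have heq : ∀ t ∈ Icc 0 Tstar, ∀ x,
      θ t • ξ (projIcc 0 Tstar hT.le t) x = ξ t x := fun t ht x => by
    rw [projIcc_of_mem hT.le ht, θ.one_of_mem_closedBall, one_smul]
    rw [mem_closedBall_zero_iff, Real.norm_eq_abs, abs_of_nonneg ht.1]
    show t ≤ Tstar + 1
    linarith [ht.2]
  have hθL : LipschitzWith L (fun p : ℝ × Rd d => θ p.1) := by
    have h := hL.comp (LipschitzWith.prod_fst (α := ℝ) (β := Rd d))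
    rw [mul_one] at h
    exact h
  refine ⟨fun p => θ p.1 • ξ (projIcc 0 Tstar hT.le p.1) p.2, _, lipschitzWith_smul_of_bounded
    (M := 1) (N := 1) hθL
    (lipschitzWith_comp_projIcc hT.le hK) (fun p => ?_) (fun p => ?_), ?_, heq, ?_⟩
  · rw [abs_of_nonneg θ.nonneg]
    exact θ.le_one
  · exact hcal.norm_xi_le_one (Subtype.mem _) _
  · refine HasCompactSupport.intro
      ((isCompact_closedBall (0:ℝ) (Tstar + 2)).prod (isCompact_closedBall (0 : Rd d) R))
      fun p hp => ?_
    rw [mem_prod, not_and_or] at hp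
    rcases hp with hp | hp
    · rw [θ.zero_of_le_dist, zero_smul]
      rw [Metric.mem_closedBall, not_le] at hp
      exact hp.le
    · rw [hR _ (Subtype.mem _) _ (by simpa using hp), smul_zero]
  · intro t ht x
    have hmem : Icc 0 Tstar ×ˢ (univ : Set (Rd d)) ∈ 𝓝 (t, x) :=
      prod_mem_nhds (Icc_mem_nhds ht.1 ht.2) univ_mem
    refine (hcal.xi_C1.contDiffAt hmem).congr_of_eventuallyEq ?_
    filter_upwards [hmem] with p hp
    exact heq p.1 hp.1 p.2

/-- The extension of `ϑ` from `[0, Tstar]` to space-time that is constant in time outside. -/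
def thetaExt (hT : 0 < Tstar) (ϑ : ℝ → Rd d → ℝ) (p : ℝ × Rd d) : ℝ :=
  ϑ (projIcc 0 Tstar hT.le p.1) p.2

theorem thetaExt_eq (hT : 0 < Tstar) {t : ℝ} (ht : t ∈ Icc 0 Tstar) (x : Rd d) :
    thetaExt hT ϑ (t, x) = ϑ t x := by
  simp only [thetaExt, projIcc_of_mem hT.le ht]

theorem exists_lipschitzWith_thetaExt (hcal : IsCalibration Tstar Ω ξ B ϑ lamStar)
    (hT : 0 < Tstar) : ∃ K : ℝ≥0, LipschitzWith K (thetaExt hT ϑ) := by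
  obtain ⟨K, hK⟩ := hcal.theta_lip
  exact ⟨K, lipschitzWith_comp_projIcc hT.le hK⟩

theorem continuous_thetaExt (hcal : IsCalibration Tstar Ω ξ B ϑ lamStar) (hT : 0 < Tstar) :
    Continuous (thetaExt hT ϑ) :=
  (hcal.exists_lipschitzWith_thetaExt hT).choose_spec.continuous

/-- The time derivative of `ϑ`, as a measurable function. -/
def thetaDeriv (hT : 0 < Tstar) (ϑ : ℝ → Rd d → ℝ) (p : ℝ × Rd d) : ℝ :=
  fderiv ℝ (thetaExt hT ϑ) p (1, 0)

theorem measurable_thetaDeriv (hT : 0 < Tstar) (ϑ : ℝ → Rd d → ℝ) :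
    Measurable (thetaDeriv hT ϑ) := measurable_fderiv_apply_const ℝ _ _

theorem exists_abs_thetaDeriv_le (hcal : IsCalibration Tstar Ω ξ B ϑ lamStar)
    (hT : 0 < Tstar) : ∃ K : ℝ, ∀ p, |thetaDeriv hT ϑ p| ≤ K := by
  obtain ⟨K, hK⟩ := hcal.exists_lipschitzWith_thetaExt hT
  exact ⟨K, abs_fderiv_time_le hK⟩

theorem ae_differentiableAt_thetaExt (hcal : IsCalibration Tstar Ω ξ B ϑ lamStar)
    (hT : 0 < Tstar) : ∀ᵐ p, DifferentiableAt ℝ (thetaExt hT ϑ) p := by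
  obtain ⟨K, hK⟩ := hcal.exists_lipschitzWith_thetaExt hT
  exact hK.ae_differentiableAt

theorem ae_thetaDeriv_eq (hcal : IsCalibration Tstar Ω ξ B ϑ lamStar) (hT : 0 < Tstar) :
    ∀ᵐ t ∂(volume.restrict (Ioo 0 Tstar)), ∀ᵐ x : Rd d,
      thetaDeriv hT ϑ (t, x) = deriv (fun s => ϑ s x) t := by
  have h := hcal.ae_differentiableAt_thetaExt hT
  rw [Measure.volume_eq_prod] at h
  filter_upwards [ae_restrict_of_ae (Measure.ae_ae_of_ae_prod h),
    ae_restrict_mem measurableSet_Ioo] with t ht htI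
  filter_upwards [ht] with x hx
  rw [thetaDeriv, ← (hasDerivAt_slice hx).deriv]
  refine EventuallyEq.deriv_eq ?_
  filter_upwards [Icc_mem_nhds htI.1 htI.2] with s hs
  exact thetaExt_eq hT hs x

theorem thetaExt_neg_iff (hcal : IsCalibration Tstar Ω ξ B ϑ lamStar) (hT : 0 < Tstar)
    (hΩ : ∀ t ∈ Icc 0 Tstar, BoundsClosedSurface (Ω t)) {t : ℝ} (ht : t ∈ Icc 0 Tstar) (x : Rd d) :
    thetaExt hT ϑ (t, x) < 0 ↔ x ∈ Ω t := by
  obtain ⟨K, hK⟩ := hcal.theta_lip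
  rw [thetaExt_eq hT ht]
  exact (hΩ t ht).theta_neg_iff (lipschitzWith_theta hK ht).continuous (hcal.theta_neg t ht)
    (hcal.theta_pos t ht) x

/-- The negative part of a differentiable function has vanishing derivative at zeros, since it has
a local maximum there. -/
theorem deriv_min_zero {g : ℝ → ℝ} (hg : Continuous g) (s : ℝ) :
    deriv (fun r => min (g r) 0) s = if g s < 0 then deriv g s else 0 := by
  split_ifs with h
  · refine EventuallyEq.deriv_eq ?_
    filter_upwards [hg.continuousAt.eventually (gt_mem_nhds h)] with r hr
    exact min_eq_left hr.le
  · have : IsLocalMax (fun r => min (g r) 0) s := Eventually.of_forall fun r => by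
      simp only
      rw [min_eq_right (not_lt.1 h)]
      exact min_le_right _ _
    exact this.deriv_eq_zero

theorem charFn_mul_theta (hcal : IsCalibration Tstar Ω ξ B ϑ lamStar) (hT : 0 < Tstar)
    (hΩ : ∀ t ∈ Icc 0 Tstar, BoundsClosedSurface (Ω t)) {t : ℝ} (ht : t ∈ Icc 0 Tstar) (x : Rd d) :
    charFn (Ω t) x * ϑ t x = min (thetaExt hT ϑ (t, x)) 0 := by
  have h := hcal.thetaExt_neg_iff hT hΩ ht x
  rw [← thetaExt_eq (ϑ := ϑ) hT ht]
  by_cases hx : x ∈ Ω t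
  · rw [min_eq_left (h.2 hx).le, charFn, indicator_of_mem hx, Pi.one_apply, one_mul]
  · rw [min_eq_right (not_lt.1 fun hlt => hx (h.1 hlt)), charFn, indicator_of_notMem hx, zero_mul]

theorem integrable_charFn {A : Set (Rd d)} (hA : IsOpen A) (hv : volume A ≠ ∞) :
    Integrable (charFn A) := by
  have h : IntegrableOn (1 : Rd d → ℝ) A := integrableOn_const hv
  exact h.integrable_indicator hA.measurableSet

theorem integrable_prod_charFn_mul_thetaDeriv (hcal : IsCalibration Tstar Ω ξ B ϑ lamStar)
    (hT : 0 < Tstar) (hΩ : ∀ t ∈ Icc 0 Tstar, BoundsClosedSurface (Ω t)) {V₀ : ℝ≥0∞}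
    (hV₀ : V₀ ≠ ∞) (hvol : ∀ t ∈ Icc 0 Tstar, volume (Ω t) ≤ V₀) :
    Integrable (fun p => {p | thetaExt hT ϑ p < 0}.indicator (thetaDeriv hT ϑ) p)
      ((volume.restrict (Ioo 0 Tstar)).prod (volume : Measure (Rd d))) := by
  obtain ⟨K, hK⟩ := hcal.exists_abs_thetaDeriv_le hT
  have hm : MeasurableSet {p : ℝ × Rd d | thetaExt hT ϑ p < 0} :=
    (isOpen_lt (hcal.continuous_thetaExt hT) continuous_const).measurableSet
  refine IntegrableOn.integrable_indicator ?_ hm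
  refine Measure.integrableOn_of_bounded (M := K) ?_
    (measurable_thetaDeriv hT ϑ).aestronglyMeasurable (ae_of_all _ hK)
  rw [Measure.prod_apply hm]
  refine ne_of_lt (lt_of_le_of_lt (b := ∫⁻ _t in Ioo 0 Tstar, V₀) ?_ ?_)
  · refine setLIntegral_mono' measurableSet_Ioo fun t ht => ?_
    refine le_trans (measure_mono fun x hx => ?_) (hvol t (Ioo_subset_Icc_self ht))
    exact (hcal.thetaExt_neg_iff hT hΩ (Ioo_subset_Icc_self ht) x).1 hx
  · rw [setLIntegral_const, Real.volume_Ioo]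
    exact ENNReal.mul_lt_top hV₀.lt_top ENNReal.ofReal_lt_top

theorem indicator_thetaDeriv (hcal : IsCalibration Tstar Ω ξ B ϑ lamStar)
    (hT : 0 < Tstar) (hΩ : ∀ t ∈ Icc 0 Tstar, BoundsClosedSurface (Ω t)) {t : ℝ}
    (ht : t ∈ Icc 0 Tstar) (x : Rd d) :
    {p | thetaExt hT ϑ p < 0}.indicator (thetaDeriv hT ϑ) (t, x)
      = charFn (Ω t) x * thetaDeriv hT ϑ (t, x) := by
  have h := hcal.thetaExt_neg_iff hT hΩ ht x
  by_cases hx : x ∈ Ω t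
  · rw [indicator_of_mem (show (t, x) ∈ {p | thetaExt hT ϑ p < 0} from h.2 hx), charFn,
      indicator_of_mem hx, Pi.one_apply, one_mul]
  · rw [indicator_of_notMem (show (t, x) ∉ {p | thetaExt hT ϑ p < 0} from fun hlt => hx (h.1 hlt)),
      charFn, indicator_of_notMem hx, zero_mul]

/-- The evolution of the weighted volume of the calibrated domains; no boundary term appears because
`ϑ` vanishes on the surfaces. -/
theorem integral_charFn_mul_theta (hcal : IsCalibration Tstar Ω ξ B ϑ lamStar)
    (hT : 0 < Tstar) (hΩ : ∀ t ∈ Icc 0 Tstar, BoundsClosedSurface (Ω t)) {V₀ : ℝ≥0∞}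
    (hV₀ : V₀ ≠ ∞) (hvol : ∀ t ∈ Icc 0 Tstar, volume (Ω t) ≤ V₀) {T : ℝ} (hTI : T ∈ Ioo 0 Tstar) :
    (∫ x, charFn (Ω T) x * ϑ T x) - ∫ x, charFn (Ω 0) x * ϑ 0 x
      = ∫ t in Ioo 0 T, ∫ x, charFn (Ω t) x * thetaDeriv hT ϑ (t, x) := by
  obtain ⟨L, hL⟩ := hcal.exists_lipschitzWith_thetaExt hT
  obtain ⟨M, hM⟩ := hcal.theta_bdd
  obtain ⟨Kt, hKt⟩ := hcal.theta_lip
  have h0 : (0:ℝ) ∈ Icc 0 Tstar := ⟨le_rfl, hT.le⟩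
  have hTc : T ∈ Icc 0 Tstar := Ioo_subset_Icc_self hTI
  set G : ℝ × Rd d → ℝ := fun p => {p | thetaExt hT ϑ p < 0}.indicator (thetaDeriv hT ϑ) p with hG
  have hGi : Integrable G ((volume.restrict (Ioo 0 T)).prod (volume : Measure (Rd d))) := by
    refine (hcal.integrable_prod_charFn_mul_thetaDeriv hT hΩ hV₀ hvol).mono_measure ?_
    exact Measure.prod_mono (Measure.restrict_mono (Ioo_subset_Ioo_right hTI.2.le) le_rfl) le_rfl
  have hint : ∀ t ∈ Icc 0 Tstar, Integrable fun x => charFn (Ω t) x * ϑ t x := fun t ht =>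
    (integrable_charFn (hΩ t ht).isOpen (ne_top_of_le_ne_top hV₀ (hvol t ht))).mul_bdd (c := M)
      (lipschitzWith_theta hKt ht).continuous.aestronglyMeasurable (ae_of_all _ (hM t ht))
  have hR : ∫ t in Ioo 0 T, ∫ x, charFn (Ω t) x * thetaDeriv hT ϑ (t, x)
      = ∫ t in Ioo 0 T, ∫ x, G (t, x) :=
    setIntegral_congr_fun measurableSet_Ioo fun t ht => integral_congr_ae (ae_of_all _ fun x =>
      (hcal.indicator_thetaDeriv hT hΩ ⟨ht.1.le, (ht.2.trans hTI.2).le⟩ x).symm)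
  rw [hR, integral_integral_swap hGi, ← integral_sub (hint T hTc) (hint 0 h0)]
  refine integral_congr_ae ?_
  have hd := hcal.ae_differentiableAt_thetaExt hT
  rw [Measure.volume_eq_prod] at hd
  have hswap : ∀ᵐ x : Rd d, ∀ᵐ s : ℝ, DifferentiableAt ℝ (thetaExt hT ϑ) (s, x) := by
    have h1 := (Measure.measurePreserving_swap (μ := (volume : Measure (Rd d)))
      (ν := (volume : Measure ℝ))).quasiMeasurePreserving.ae hd
    exact Measure.ae_ae_of_ae_prod h1
  filter_upwards [hswap] with x hx
  have hc : LipschitzWith L fun s => thetaExt hT ϑ (s, x) := LipschitzWith.of_dist_le_mul fun s t => by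
    simpa [Prod.dist_eq] using hL.dist_le_mul (s, x) (t, x)
  have hml : LipschitzWith L fun s => min (thetaExt hT ϑ (s, x)) 0 := by
    exact hc.min_const 0
  have hftc := (hml.lipschitzOnWith (s := uIcc 0 T)).absolutelyContinuousOnInterval.integral_deriv_eq_sub
  rw [hcal.charFn_mul_theta hT hΩ hTc, hcal.charFn_mul_theta hT hΩ h0, ← hftc,
    intervalIntegral.integral_of_le hTI.1.le, integral_Ioc_eq_integral_Ioo]
  refine integral_congr_ae (ae_restrict_of_ae ?_)
  filter_upwards [hx] with s hs
  rw [deriv_min_zero hc.continuous, (hasDerivAt_slice hs).deriv]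
  simp only [hG, indicator_apply, mem_ofPred_eq, thetaDeriv]

/-- If the initial volume error is finite, the calibrated domains have uniformly bounded volume:
away from the surfaces, which stay in a fixed ball, the domains do not change. -/
theorem exists_volume_le (hcal : IsCalibration Tstar Ω ξ B ϑ lamStar)
    (hT : 0 < Tstar) (hΩ : ∀ t ∈ Icc 0 Tstar, BoundsClosedSurface (Ω t)) {χ : ℝ → Rd d → ℝ}
    (hχ : Integrable (χ 0)) (hv : ∀ x, χ 0 x = 0 ∨ χ 0 x = 1) (hF : volError χ Ω ϑ 0 ≠ ∞) :
    ∃ V₀ : ℝ≥0∞, V₀ ≠ ∞ ∧ ∀ t ∈ Icc 0 Tstar, volume (Ω t) ≤ V₀ := by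
  obtain ⟨R, hR⟩ := hcal.xi_compact
  obtain ⟨c, hc, hcoer⟩ := hcal.theta_coercive
  obtain ⟨Kt, hKt⟩ := hcal.theta_lip
  have h0 : (0:ℝ) ∈ Icc 0 Tstar := ⟨le_rfl, hT.le⟩
  have hfr : ∀ t ∈ Icc 0 Tstar, ∀ y ∈ frontier (Ω t), ‖y‖ ≤ R := fun t ht y hy => by
    by_contra hcon
    have h1 := (hcal.xi_normal t ht y hy).norm_eq_one
    rw [hR t ht y (not_le.1 hcon)] at h1
    simp at h1
  have hsub : ∀ t ∈ Icc 0 Tstar, Ω t ⊆ Ω 0 ∪ Metric.closedBall 0 R := by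
    intro t ht x hx
    by_contra hcon
    rw [mem_union, not_or, mem_closedBall_zero_iff, not_le] at hcon
    -- outside of the ball `ϑ` has no zeros, hence does not change its sign in time
    have hne : ∀ s ∈ Icc 0 Tstar, thetaExt hT ϑ (s, x) ≠ 0 := fun s hs h => by
      rw [thetaExt_eq hT hs] at h
      have h2 := hcoer s hs x
      rw [h, abs_zero] at h2
      have h3 : 0 < Metric.infDist x (frontier (Ω s)) := by
        rw [← isClosed_frontier.notMem_iff_infDist_pos (hΩ s hs).nonempty]
        exact fun hmem => (hfr s hs x hmem).not_gt hcon.2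
      exact absurd h2 (not_le.2 (lt_min h3 hc))
    have h1 : thetaExt hT ϑ (t, x) < 0 := (hcal.thetaExt_neg_iff hT hΩ ht x).2 hx
    have h2 : 0 ≤ thetaExt hT ϑ (0, x) := not_lt.1 fun h =>
      hcon.1 ((hcal.thetaExt_neg_iff hT hΩ h0 x).1 h)
    have hcont : ContinuousOn (fun s => thetaExt hT ϑ (s, x)) (Icc 0 t) :=
      ((hcal.continuous_thetaExt hT).comp (by fun_prop)).continuousOn
    obtain ⟨s, hs, hs0⟩ := intermediate_value_Icc' ht.1 hcont ⟨h1.le, h2⟩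
    exact hne s ⟨hs.1, hs.2.trans ht.2⟩ hs0
  -- far away, a point of `Ω 0` contributes to the volume of `χ 0` or to the initial volume error
  set m : ℝ := min 1 c with hm
  have hm0 : 0 < m := lt_min one_pos hc
  have hfar : Ω 0 \ Metric.closedBall 0 (R + 1) ⊆ {x | (1:ℝ) ≤ ‖χ 0 x‖} ∪
      {x | ENNReal.ofReal m ≤ ENNReal.ofReal (|χ 0 x - charFn (Ω 0) x| * |ϑ 0 x|)} := by
    rintro x ⟨hx, hxR⟩
    rcases hv x with h | h
    · right
      rw [mem_ofPred_eq, h, charFn, indicator_of_mem hx, Pi.one_apply, zero_sub, abs_neg, abs_one,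
        one_mul]
      refine ENNReal.ofReal_le_ofReal (le_trans (min_le_min_right c ?_) (hcoer 0 h0 x))
      refine (Metric.le_infDist (hΩ 0 h0).nonempty).2 fun y hy => ?_
      rw [mem_closedBall_zero_iff, not_le] at hxR
      rw [dist_eq_norm]
      linarith [norm_sub_norm_le x y, hfr 0 h0 y hy]
    · left
      simp [h]
  have hA : volume {x | (1:ℝ) ≤ ‖χ 0 x‖} < ∞ := hχ.measure_norm_ge_lt_top one_pos
  have hae : AEMeasurable fun x => ENNReal.ofReal (|χ 0 x - charFn (Ω 0) x| * |ϑ 0 x|) := by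
    have h1 : Measurable (charFn (Ω 0)) := measurable_one.indicator (hΩ 0 h0).isOpen.measurableSet
    have h2 : Measurable (ϑ 0) := (lipschitzWith_theta hKt h0).continuous.measurable
    have h3 : AEMeasurable (fun x => |χ 0 x - charFn (Ω 0) x|) :=
      measurable_abs.comp_aemeasurable (hχ.1.aemeasurable.sub h1.aemeasurable)
    have h4 : AEMeasurable (fun x => |ϑ 0 x|) := (measurable_abs.comp h2).aemeasurable
    exact (h3.mul h4).ennreal_ofReal
  have hB : volume {x | ENNReal.ofReal m
      ≤ ENNReal.ofReal (|χ 0 x - charFn (Ω 0) x| * |ϑ 0 x|)} < ∞ := by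
    refine lt_of_le_of_lt (meas_ge_le_lintegral_div hae (by simpa using hm0)
      ENNReal.ofReal_ne_top) ?_
    exact ENNReal.div_lt_top hF (by simpa using hm0)
  have hΩ0 : volume (Ω 0) ≠ ∞ := by
    have h1 : Ω 0 ⊆ ({x | (1:ℝ) ≤ ‖χ 0 x‖} ∪
      {x | ENNReal.ofReal m ≤ ENNReal.ofReal (|χ 0 x - charFn (Ω 0) x| * |ϑ 0 x|)})
        ∪ Metric.closedBall 0 (R + 1) := fun x hx => by
      by_cases hxR : x ∈ Metric.closedBall 0 (R + 1)
      · exact Or.inr hxR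
      · exact Or.inl (hfar ⟨hx, hxR⟩)
    refine ne_top_of_le_ne_top ?_ (measure_mono h1)
    exact (measure_union_lt_top (measure_union_lt_top hA hB) measure_closedBall_lt_top).ne
  refine ⟨volume (Ω 0) + volume (Metric.closedBall (0 : Rd d) R),
    ENNReal.add_ne_top.2 ⟨hΩ0, measure_closedBall_lt_top.ne⟩, fun t ht => ?_⟩
  exact (measure_mono (hsub t ht)).trans (measure_union_le _ _)

end IsCalibration

namespace IsDistributionalSolution

variable {Tstar : ℝ} {Ω : ℝ → Set (Rd d)} {ξ B : ℝ → Rd d → Rd d} {ϑ : ℝ → Rd d → ℝ}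
  {lamStar : ℝ → ℝ} {χ V : ℝ → Rd d → ℝ} {lam Clam : ℝ → ℝ}

/-- The evolution of `∫ ν · ξ`: the velocity equation tested with `∇ · ξ`. -/
theorem velocity_xi (hs : IsDistributionalSolution Tstar χ V lam Clam) (hT : 0 < Tstar)
    (hcal : IsCalibration Tstar Ω ξ B ϑ lamStar) :
    IntegrableOn (fun t => ∫ x, inner ℝ (extNormal (χ t) x) (IsCalibration.timeDeriv Tstar ξ t x)
        ∂(gradMeasure (χ t))) (Ioo 0 Tstar) ∧
    IntegrableOn (fun t => ∫ x, divergence (ξ t) x * V t x ∂(gradMeasure (χ t)))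
      (Ioo 0 Tstar) ∧
    ∀ᵐ T ∂(volume.restrict (Ioo 0 Tstar)),
      (∫ x, inner ℝ (extNormal (χ T) x) (ξ T x) ∂(gradMeasure (χ T)))
          - ∫ x, inner ℝ (extNormal (χ 0) x) (ξ 0 x) ∂(gradMeasure (χ 0))
        = (∫ t in Ioo 0 T, ∫ x, inner ℝ (extNormal (χ t) x) (IsCalibration.timeDeriv Tstar ξ t x)
            ∂(gradMeasure (χ t)))
          + ∫ t in Ioo 0 T, ∫ x, divergence (ξ t) x * V t x ∂(gradMeasure (χ t)) := by
  obtain ⟨X, K, hXL, hXc, hXeq, hXd⟩ := hcal.exists_xiExt hT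
  obtain ⟨h1, h2, h3⟩ := hs.velocity_normal hT hXL hXc hXd
  have hslice : ∀ t ∈ Icc 0 Tstar, (fun y => X (t, y)) = ξ t := fun t ht => funext (hXeq t ht)
  have hder : ∀ t ∈ Ioo 0 Tstar, ∀ x,
      fderiv ℝ X (t, x) (1, 0) = IsCalibration.timeDeriv Tstar ξ t x := fun t ht x => by
    have h4 := (hasDerivAt_slice ((hXd t ht x).differentiableAt one_ne_zero)).hasDerivWithinAt
      (s := Icc 0 Tstar)
    have h5 : HasDerivWithinAt (fun s => ξ s x) (fderiv ℝ X (t, x) (1, 0)) (Icc 0 Tstar) t :=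
      h4.congr (fun s hs => (hXeq s hs x).symm) (hXeq t (Ioo_subset_Icc_self ht) x).symm
    exact (h5.derivWithin (uniqueDiffOn_Icc hT t (Ioo_subset_Icc_self ht))).symm
  refine ⟨h1.congr_fun (fun t ht => ?_) measurableSet_Ioo,
    h2.congr_fun (fun t ht => ?_) measurableSet_Ioo, ?_⟩
  · simp only [hder t ht]
  · simp only [hslice t (Ioo_subset_Icc_self ht)]
  · filter_upwards [h3, ae_restrict_mem measurableSet_Ioo] with T hTe hTI
    simp only [hXeq T (Ioo_subset_Icc_self hTI), hXeq 0 ⟨le_rfl, hT.le⟩] at hTe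
    rw [hTe]
    congr 1
    · refine setIntegral_congr_fun measurableSet_Ioo fun t ht => ?_
      simp only [hder t ⟨ht.1, ht.2.trans hTI.2⟩]
    · refine setIntegral_congr_fun measurableSet_Ioo fun t ht => ?_
      simp only [hslice t ⟨ht.1.le, (ht.2.trans hTI.2).le⟩]

end IsDistributionalSolution

end

/-! ### A Gronwall inequality with integrable coefficient -/

/-- If `G` is nonnegative and `G s - G r ≤ G s * (A s - A r)` for `r ≤ s`, then `G` is multiplied by
at most `(1 - δ)⁻¹` while `A` increases by `δ`. -/
theorem gronwall_step {G A : ℝ → ℝ} {T δ : ℝ} (hA : ContinuousOn A (Icc 0 T))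
    (hA0 : A 0 = 0) (hG0 : ∀ s ∈ Icc 0 T, 0 ≤ G s) (hδ : 0 ≤ δ) (hδ1 : δ ≤ 1)
    (hstep : ∀ s ∈ Icc 0 T, ∀ r ∈ Icc 0 s, G s - G r ≤ G s * (A s - A r)) (k : ℕ) :
    ∀ s ∈ Icc 0 T, A s ≤ k * δ → G s * (1 - δ) ^ k ≤ G 0 := by
  induction k with
  | zero =>
    intro s hs hAs
    have h1 := hstep s hs 0 ⟨le_rfl, hs.1⟩
    have h2 : G s * (A s - A 0) ≤ 0 := by
      rw [hA0, sub_zero]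
      exact mul_nonpos_of_nonneg_of_nonpos (hG0 s hs) (by simpa using hAs)
    simp only [pow_zero, mul_one]
    linarith
  | succ k ih =>
    intro s hs hAs
    by_cases hk : A s ≤ k * δ
    · refine le_trans (mul_le_mul_of_nonneg_left ?_ (hG0 s hs)) (ih s hs hk)
      exact pow_le_pow_of_le_one (by linarith) (by linarith) (Nat.le_succ k)
    · have hcont : ContinuousOn A (Icc 0 s) := hA.mono (Icc_subset_Icc_right hs.2)
      have hkδ : (0:ℝ) ≤ k * δ := by positivity
      obtain ⟨r, hr, hAr⟩ := intermediate_value_Icc hs.1 hcont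
        (show (k * δ : ℝ) ∈ Icc (A 0) (A s) from ⟨by rwa [hA0], (not_le.1 hk).le⟩)
      have hrT : r ∈ Icc 0 T := ⟨hr.1, hr.2.trans hs.2⟩
      have h1 := hstep s hs r hr
      have h2 : A s - A r ≤ δ := by
        rw [hAr]
        push_cast at hAs
        linarith
      have h3 := mul_le_mul_of_nonneg_left h2 (hG0 s hs)
      have h4 : G s * (1 - δ) ≤ G r := by linarith
      have h5 : 0 ≤ (1 - δ) ^ k := pow_nonneg (by linarith) k
      calc G s * (1 - δ) ^ (k + 1) = G s * (1 - δ) * (1 - δ) ^ k := by ring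
        _ ≤ G r * (1 - δ) ^ k := mul_le_mul_of_nonneg_right h4 h5
        _ ≤ G 0 := ih r hrT hAr.le

/-- The bound of `gronwall_step` with `δ = A T / n` in the limit `n → ∞`. No differentiability or
monotonicity is needed. -/
theorem gronwall_of_step {G A : ℝ → ℝ} {T : ℝ} (hT : 0 ≤ T) (hA : ContinuousOn A (Icc 0 T))
    (hA0 : A 0 = 0) (hAT : 0 ≤ A T) (hG0 : ∀ s ∈ Icc 0 T, 0 ≤ G s)
    (hstep : ∀ s ∈ Icc 0 T, ∀ r ∈ Icc 0 s, G s - G r ≤ G s * (A s - A r)) :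
    G T ≤ G 0 * Real.exp (A T) := by
  have hlim : Tendsto (fun n : ℕ => G T * (1 + -A T / n) ^ n) atTop
      (𝓝 (G T * Real.exp (-A T))) :=
    (Real.tendsto_one_add_div_pow_exp (-A T)).const_mul _
  have hle : G T * Real.exp (-A T) ≤ G 0 := by
    refine le_of_tendsto hlim ?_
    obtain ⟨N, hN⟩ := exists_nat_ge (A T)
    filter_upwards [eventually_ge_atTop (max N 1)] with n hn
    have hn1 : (1:ℝ) ≤ n := by exact_mod_cast (le_max_right N 1).trans hn
    have hnN : A T ≤ n := hN.trans (by exact_mod_cast (le_max_left N 1).trans hn)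
    have h := gronwall_step hA hA0 hG0 (δ := A T / n) (by positivity)
      ((div_le_one (by linarith)).2 hnN) hstep n T ⟨hT, le_rfl⟩
      (by rw [mul_div_cancel₀]; linarith)
    rwa [neg_div, ← sub_eq_add_neg]
  rw [Real.exp_neg, ← div_eq_mul_inv, div_le_iff₀ (Real.exp_pos _)] at hle
  exact hle

theorem integral_Ioo_eq_interval {f : ℝ → ℝ} {s : ℝ} (hs : 0 ≤ s) :
    ∫ t in Ioo 0 s, f t = ∫ t in (0)..s, f t := by
  rw [intervalIntegral.integral_of_le hs, integral_Ioc_eq_integral_Ioo]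

/-- Gronwall's inequality for a bounded function that satisfies the integral inequality at almost
every time. -/
theorem ae_le_mul_exp_of_integral_le {Tstar : ℝ} {e a : ℝ → ℝ} {e₀ M : ℝ} (he₀ : 0 ≤ e₀)
    (hem : AEStronglyMeasurable e (volume.restrict (Ioo 0 Tstar)))
    (he : ∀ᵐ t ∂(volume.restrict (Ioo 0 Tstar)), 0 ≤ e t ∧ e t ≤ M) (ha : ∀ t, 0 ≤ a t)
    (hai : ∀ T ∈ Ioo 0 Tstar, IntegrableOn a (Ioo 0 T))
    (hle : ∀ᵐ T ∂(volume.restrict (Ioo 0 Tstar)), e T ≤ e₀ + ∫ t in Ioo 0 T, a t * e t) :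
    ∀ᵐ T ∂(volume.restrict (Ioo 0 Tstar)), e T ≤ e₀ * Real.exp (∫ t in Ioo 0 T, a t) := by
  filter_upwards [hle, ae_restrict_mem measurableSet_Ioo] with T hTle hTI
  have hsub : Ioo 0 T ⊆ Ioo 0 Tstar := Ioo_subset_Ioo_right hTI.2.le
  have hres : ∀ {P : ℝ → Prop}, (∀ᵐ t ∂(volume.restrict (Ioo 0 Tstar)), P t) →
      ∀ᵐ t ∂(volume.restrict (Ioo 0 T)), P t := fun h =>
    ae_restrict_of_ae_restrict_of_subset hsub h
  have haT := hai T hTI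
  have haeT : IntegrableOn (fun t => a t * e t) (Ioo 0 T) := by
    refine Integrable.mul_bdd (c := M) haT (hem.mono_measure (Measure.restrict_mono hsub le_rfl)) ?_
    filter_upwards [hres he] with t ht
    rw [Real.norm_eq_abs, abs_of_nonneg ht.1]
    exact ht.2
  have hII : ∀ {f : ℝ → ℝ}, IntegrableOn f (Ioo 0 T) → ∀ r ∈ Icc 0 T, ∀ s ∈ Icc 0 T,
      IntervalIntegrable f volume r s := fun hf r hr s hs => by
    have h1 : IntervalIntegrable _ volume 0 T :=
      (intervalIntegrable_iff_integrableOn_Ioo_of_le hTI.1.le).2 hf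
    refine h1.mono_set ?_
    rw [uIcc_of_le hTI.1.le]
    exact uIcc_subset_Icc hr hs
  set G : ℝ → ℝ := fun s => e₀ + ∫ t in (0)..s, a t * e t with hG
  set A : ℝ → ℝ := fun s => ∫ t in (0)..s, a t with hAdef
  have h0 : (0:ℝ) ∈ Icc 0 T := ⟨le_rfl, hTI.1.le⟩
  have hTT : T ∈ Icc 0 T := ⟨hTI.1.le, le_rfl⟩
  have hres' : ∀ {P : ℝ → Prop}, (∀ᵐ t ∂(volume.restrict (Ioo 0 Tstar)), P t) →
      ∀ r ∈ Icc 0 T, ∀ s ∈ Icc 0 T, ∀ᵐ t ∂(volume.restrict (Ioo r s)), P t := fun h r hr s hs =>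
    ae_restrict_of_ae_restrict_of_subset (Ioo_subset_Ioo hr.1 hs.2) (hres h)
  have hmono : ∀ r ∈ Icc 0 T, ∀ s ∈ Icc 0 T, r ≤ s → 0 ≤ ∫ t in r..s, a t * e t := by
    intro r hr s hs hrs
    rw [intervalIntegral.integral_of_le hrs, integral_Ioc_eq_integral_Ioo]
    refine integral_nonneg_of_ae ?_
    filter_upwards [hres' he r hr s hs] with t ht
    exact mul_nonneg (ha t) ht.1
  have hGsub : ∀ r ∈ Icc 0 T, ∀ s ∈ Icc 0 T, G s - G r = ∫ t in r..s, a t * e t := by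
    intro r hr s hs
    simp only [hG, add_sub_add_left_eq_sub]
    exact intervalIntegral.integral_interval_sub_left (hII haeT 0 h0 s hs) (hII haeT 0 h0 r hr)
  have key : G T ≤ G 0 * Real.exp (A T) := by
    refine gronwall_of_step hTI.1.le ?_ (by simp [hAdef]) ?_ ?_ ?_
    · have := intervalIntegral.continuousOn_primitive_interval' (hII haT 0 h0 T hTT) left_mem_uIcc
      rwa [uIcc_of_le hTI.1.le] at this
    · exact intervalIntegral.integral_nonneg hTI.1.le fun t _ => ha t
    · intro s hs
      exact add_nonneg he₀ (hmono 0 h0 s hs hs.1)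
    · intro s hs r hr
      have hrT : r ∈ Icc 0 T := ⟨hr.1, hr.2.trans hs.2⟩
      rw [hGsub r hrT s hs]
      have hAsub : A s - A r = ∫ t in r..s, a t :=
        intervalIntegral.integral_interval_sub_left (hII haT 0 h0 s hs) (hII haT 0 h0 r hrT)
      rw [hAsub, ← intervalIntegral.integral_const_mul]
      rw [intervalIntegral.integral_of_le hr.2, intervalIntegral.integral_of_le hr.2,
        integral_Ioc_eq_integral_Ioo, integral_Ioc_eq_integral_Ioo]
      have i1 := (intervalIntegrable_iff_integrableOn_Ioo_of_le hr.2).1 (hII haeT r hrT s hs)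
      have i2 := (intervalIntegrable_iff_integrableOn_Ioo_of_le hr.2).1 (hII haT r hrT s hs)
      refine integral_mono_ae i1 (i2.const_mul _) ?_
      filter_upwards [hres' hle r hrT s hs, ae_restrict_mem measurableSet_Ioo] with t ht htI
      have htT : t ∈ Icc 0 T := ⟨hr.1.trans htI.1.le, htI.2.le.trans hs.2⟩
      have h2 : e t ≤ G s := by
        have h3 := hmono t htT s hs htI.2.le
        rw [← hGsub t htT s hs] at h3
        have h4 : e t ≤ G t := by
          rw [hG]
          simp only
          rw [← integral_Ioo_eq_interval htT.1]
          exact ht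
        linarith
      rw [mul_comm (G s)]
      exact mul_le_mul_of_nonneg_left h2 (ha t)
  have hG0 : G 0 = e₀ := by simp [hG]
  rw [hG0] at key
  rw [integral_Ioo_eq_interval hTI.1.le] at hTle ⊢
  exact hTle.trans key

/-- Cauchy–Schwarz on a bounded interval. -/
theorem integral_abs_le_sqrt_mul {f : ℝ → ℝ} {T c : ℝ} (hT : 0 < T) (hc : 0 ≤ c)
    (hf : AEMeasurable f (volume.restrict (Ioo 0 T)))
    (h : ∫⁻ t in Ioo 0 T, ENNReal.ofReal (f t ^ 2) ≤ ENNReal.ofReal (c ^ 2)) :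
    IntegrableOn f (Ioo 0 T) ∧ ∫ t in Ioo 0 T, |f t| ≤ √T * c := by
  have h2 : IntegrableOn (fun t => f t ^ 2) (Ioo 0 T) := by
    refine ⟨(hf.pow_const 2).aestronglyMeasurable, ?_⟩
    rw [hasFiniteIntegral_iff_ofReal (ae_of_all _ fun t => sq_nonneg _)]
    exact h.trans_lt ENNReal.ofReal_lt_top
  have hmem : MemLp f 2 (volume.restrict (Ioo 0 T)) :=
    (memLp_two_iff_integrable_sq hf.aestronglyMeasurable).2 h2
  have h1 : IntegrableOn f (Ioo 0 T) := hmem.integrable one_le_two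
  refine ⟨h1, ?_⟩
  have hsq : ∫ t in Ioo 0 T, f t ^ 2 ≤ c ^ 2 := by
    rw [← ofReal_integral_eq_lintegral_ofReal h2 (ae_of_all _ fun t => sq_nonneg _)] at h
    exact (ENNReal.ofReal_le_ofReal_iff (sq_nonneg c)).1 h
  set I := ∫ t in Ioo 0 T, |f t| with hI
  -- nonnegativity of the variance of `|f|`
  have hvar : 0 ≤ ∫ t in Ioo 0 T, (f t ^ 2 - 2 * (I / T) * |f t| + (I / T) ^ 2) := by
    refine integral_nonneg fun t => ?_
    have : f t ^ 2 - 2 * (I / T) * |f t| + (I / T) ^ 2 = (|f t| - I / T) ^ 2 := by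
      rw [← sq_abs (f t)]; ring
    simp only [Pi.zero_apply]
    rw [this]
    positivity
  have i3 : IntegrableOn (fun t => 2 * (I / T) * |f t|) (Ioo 0 T) := h1.abs.const_mul _
  have i4 : IntegrableOn (fun t => f t ^ 2 - 2 * (I / T) * |f t|) (Ioo 0 T) := h2.sub i3
  rw [integral_add i4 (integrable_const _), integral_sub h2 i3, integral_const_mul, integral_const,
    ← hI] at hvar
  simp only [measureReal_restrict_apply_univ, Real.volume_real_Ioo_of_le hT.le, sub_zero,
    smul_eq_mul] at hvar
  have h5 : I ^ 2 ≤ T * c ^ 2 := by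
    have e1 : 2 * (I / T) * I = 2 * (I ^ 2 / T) := by ring
    have e2 : T * (I / T) ^ 2 = I ^ 2 / T := by field_simp
    rw [e1, e2] at hvar
    rw [← div_le_iff₀' hT]
    linarith
  refine (le_abs_self I).trans (abs_le_of_sq_le_sq ?_ (by positivity))
  rw [mul_pow, Real.sq_sqrt hT.le]
  exact h5

/-! ### The relative entropy inequality and uniqueness -/

section

variable {d : ℕ}

/-- The relative entropy as a real number. -/
def entropyReal (χ : ℝ → Rd d → ℝ) (ξ : ℝ → Rd d → Rd d) (t : ℝ) : ℝ :=
  ∫ x, (1 - inner ℝ (extNormal (χ t) x) (ξ t x)) ∂(gradMeasure (χ t))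

/-- The volume error as a real number. -/
def volErrorReal (χ : ℝ → Rd d → ℝ) (Ω : ℝ → Set (Rd d)) (ϑ : ℝ → Rd d → ℝ) (t : ℝ) : ℝ :=
  ∫ x, |χ t x - charFn (Ω t) x| * |ϑ t x|

theorem IsBV.integrable_inner {u : Rd d → ℝ} (h : IsBV u) {X : Rd d → Rd d} (hX : Continuous X)
    {M : ℝ} (hM : ∀ x, ‖X x‖ ≤ M) :
    Integrable (fun x => inner ℝ (extNormal u x) (X x)) (gradMeasure u) :=
  h.isPolarGradient.integrable_inner hX.aestronglyMeasurable hM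

variable {Tstar : ℝ} {Ω : ℝ → Set (Rd d)} {ξ B : ℝ → Rd d → Rd d} {ϑ : ℝ → Rd d → ℝ}
  {lamStar : ℝ → ℝ} {χ V : ℝ → Rd d → ℝ} {lam Clam : ℝ → ℝ}

theorem ae_one_sub_inner_nonneg {u : Rd d → ℝ} (hu : IsBV u) {X : Rd d → Rd d}
    (hX : ∀ x, ‖X x‖ ≤ 1) : ∀ᵐ x ∂(gradMeasure u), 0 ≤ 1 - inner ℝ (extNormal u x) (X x) := by
  filter_upwards [hu.isPolarGradient.norm_eq_one] with x hx
  exact le_trans (by linarith [hX x]) (one_sub_norm_le_of_unit hx)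

theorem entropyReal_nonneg {t : ℝ} (hu : IsBV (χ t)) (hX : ∀ x, ‖ξ t x‖ ≤ 1) :
    0 ≤ entropyReal χ ξ t := integral_nonneg_of_ae (ae_one_sub_inner_nonneg hu hX)

theorem volErrorReal_nonneg (χ : ℝ → Rd d → ℝ) (Ω : ℝ → Set (Rd d)) (ϑ : ℝ → Rd d → ℝ) (t : ℝ) :
    0 ≤ volErrorReal χ Ω ϑ t := integral_nonneg fun _ => by positivity

theorem relEntropy_eq_ofReal {t : ℝ} (hu : IsBV (χ t)) (hξc : Continuous (ξ t))
    (hX : ∀ x, ‖ξ t x‖ ≤ 1) : relEntropy χ ξ t = ENNReal.ofReal (entropyReal χ ξ t) := by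
  have := hu.isFiniteMeasure
  exact (ofReal_integral_eq_lintegral_ofReal
    ((integrable_const 1).sub (hu.integrable_inner hξc hX)) (ae_one_sub_inner_nonneg hu hX)).symm

theorem entropyReal_eq {t : ℝ} (hu : IsBV (χ t)) (hξc : Continuous (ξ t))
    (hX : ∀ x, ‖ξ t x‖ ≤ 1) : entropyReal χ ξ t = (gradMeasure (χ t)).real univ
      - ∫ x, inner ℝ (extNormal (χ t) x) (ξ t x) ∂(gradMeasure (χ t)) := by
  have := hu.isFiniteMeasure
  rw [entropyReal, integral_sub (integrable_const _) (hu.integrable_inner hξc hX)]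
  simp

namespace IsCalibration

theorem continuous_theta (hcal : IsCalibration Tstar Ω ξ B ϑ lamStar) {t : ℝ}
    (ht : t ∈ Icc 0 Tstar) : Continuous (ϑ t) := by
  obtain ⟨K, hK⟩ := hcal.theta_lip
  exact (lipschitzWith_theta hK ht).continuous

theorem integrable_volError (hcal : IsCalibration Tstar Ω ξ B ϑ lamStar) {t : ℝ}
    (ht : t ∈ Icc 0 Tstar) (hχ : Integrable (χ t)) (hw : Integrable (charFn (Ω t))) :
    Integrable fun x => |χ t x - charFn (Ω t) x| * |ϑ t x| := by
  obtain ⟨M, hM⟩ := hcal.theta_bdd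
  exact (hχ.sub hw).abs.mul_bdd (c := M) ((hcal.continuous_theta ht).abs.aestronglyMeasurable)
    (ae_of_all _ fun x => by simpa using hM t ht x)

theorem volError_eq_ofReal (hcal : IsCalibration Tstar Ω ξ B ϑ lamStar) {t : ℝ}
    (ht : t ∈ Icc 0 Tstar) (hχ : Integrable (χ t)) (hw : Integrable (charFn (Ω t))) :
    volError χ Ω ϑ t = ENNReal.ofReal (volErrorReal χ Ω ϑ t) :=
  (ofReal_integral_eq_lintegral_ofReal (hcal.integrable_volError ht hχ hw)
    (ae_of_all _ fun _ => by positivity)).symm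

/-- As `ϑ` has the sign of the exterior of the calibrated domain, the volume error is linear
in `χ`. -/
theorem volErrorReal_eq (hcal : IsCalibration Tstar Ω ξ B ϑ lamStar)
    (hΩ : ∀ t ∈ Icc 0 Tstar, BoundsClosedSurface (Ω t)) {t : ℝ}
    (ht : t ∈ Icc 0 Tstar) (hv : ∀ x, χ t x = 0 ∨ χ t x = 1) (hχ : Integrable (χ t))
    (hw : Integrable (charFn (Ω t))) :
    volErrorReal χ Ω ϑ t = (∫ x, ϑ t x * χ t x) - ∫ x, charFn (Ω t) x * ϑ t x := by
  obtain ⟨M, hM⟩ := hcal.theta_bdd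
  have hc := hcal.continuous_theta ht
  rw [volErrorReal, ← integral_sub
    (hχ.bdd_mul (c := M) hc.aestronglyMeasurable (ae_of_all _ (hM t ht)))
    (hw.mul_bdd (c := M) hc.aestronglyMeasurable (ae_of_all _ (hM t ht)))]
  refine integral_congr_ae (ae_of_all _ fun x => ?_)
  have h := (hΩ t ht).theta_neg_iff hc (hcal.theta_neg t ht) (hcal.theta_pos t ht) x
  simp only
  by_cases hx : x ∈ Ω t
  · rw [abs_of_neg (h.2 hx), charFn, indicator_of_mem hx, Pi.one_apply]
    rcases hv x with h1 | h1 <;> rw [h1] <;> norm_num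
  · rw [abs_of_nonneg (not_lt.1 fun hlt => hx (h.1 hlt)), charFn, indicator_of_notMem hx]
    rcases hv x with h1 | h1 <;> rw [h1] <;> norm_num

end IsCalibration

namespace IsDistributionalSolution

theorem integrableOn_integral_sq (hs : IsDistributionalSolution Tstar χ V lam Clam)
    (hT : 0 < Tstar) :
    IntegrableOn (fun t => ∫ x, V t x ^ 2 ∂(gradMeasure (χ t))) (Ioo 0 Tstar) :=
  hs.integrable_integral_perimeter (f := fun p => V p.1 p.2 ^ 2) ((memLp_two_iff_integrable_sq
    hs.V_measurable.aestronglyMeasurable).1 (hs.memLp_two hT))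

theorem energy_le (hs : IsDistributionalSolution Tstar χ V lam Clam) (hT : 0 < Tstar) :
    ∀ᵐ T ∂(volume.restrict (Ioo 0 Tstar)),
      (gradMeasure (χ T)).real univ + ∫ t in Ioo 0 T, ∫ x, V t x ^ 2 ∂(gradMeasure (χ t))
        ≤ (gradMeasure (χ 0)).real univ := by
  have hfin0 := hs.bv_zero.isFiniteMeasure
  filter_upwards [hs.dissipation, hs.bv, ae_restrict_mem measurableSet_Ioo] with T hd hbv hTI
  have hfin := hbv.isFiniteMeasure
  have hsub : Ioo 0 T ⊆ Ioo 0 Tstar := Ioo_subset_Ioo_right hTI.2.le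
  have hint : IntegrableOn (fun t => ∫ x, V t x ^ 2 ∂(gradMeasure (χ t))) (Ioo 0 T) :=
    (hs.integrableOn_integral_sq hT).mono_set hsub
  have hnn : ∀ t, 0 ≤ ∫ x, V t x ^ 2 ∂(gradMeasure (χ t)) := fun t =>
    integral_nonneg fun x => sq_nonneg _
  have heq : ∫⁻ t in Ioo 0 T, ∫⁻ x, ENNReal.ofReal (V t x ^ 2) ∂(gradMeasure (χ t))
      = ENNReal.ofReal (∫ t in Ioo 0 T, ∫ x, V t x ^ 2 ∂(gradMeasure (χ t))) := by
    rw [ofReal_integral_eq_lintegral_ofReal hint (ae_of_all _ hnn)]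
    refine lintegral_congr_ae ?_
    filter_upwards [ae_restrict_of_ae_restrict_of_subset hsub (hs.ae_memLp_two hT)] with t ht
    exact (ofReal_integral_eq_lintegral_ofReal ((memLp_two_iff_integrable_sq ht.1).1 ht)
      (ae_of_all _ fun x => sq_nonneg _)).symm
  rw [heq] at hd
  have h1 := ENNReal.toReal_mono (measure_ne_top _ _) hd
  rwa [ENNReal.toReal_add (measure_ne_top _ _) ENNReal.ofReal_ne_top,
    ENNReal.toReal_ofReal (integral_nonneg hnn)] at h1

/-- The rate of change of relative entropy and volume error: their sum differs from the perimeter by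
a primitive of `q`, and the sum of `q` and the dissipation is controlled by the errors. -/
theorem exists_rate (hs : IsDistributionalSolution Tstar χ V lam Clam) (hT : 0 < Tstar)
    (hcal : IsCalibration Tstar Ω ξ B ϑ lamStar)
    (hΩ : ∀ t ∈ Icc 0 Tstar, BoundsClosedSurface (Ω t)) {V₀ : ℝ≥0∞} (hV₀ : V₀ ≠ ∞)
    (hvol : ∀ t ∈ Icc 0 Tstar, volume (Ω t) ≤ V₀) {f : ℝ → Rd d → ℝ} {K : ℝ}
    (hb : CalibrationBounds Tstar ξ B ϑ lamStar f K) :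
    ∃ q : ℝ → ℝ, IntegrableOn q (Ioo 0 Tstar) ∧
      (∀ᵐ T ∂(volume.restrict (Ioo 0 Tstar)), entropyReal χ ξ T + volErrorReal χ Ω ϑ T
        = (gradMeasure (χ T)).real univ + (entropyReal χ ξ 0 + volErrorReal χ Ω ϑ 0
          - (gradMeasure (χ 0)).real univ) + ∫ t in Ioo 0 T, q t) ∧
      (∀ᵐ t ∂(volume.restrict (Ioo 0 Tstar)), -(∫ x, V t x ^ 2 ∂(gradMeasure (χ t))) + q t
        ≤ (1 + 13 * K + 3 * K ^ 2) * (1 + |lam t|)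
          * (entropyReal χ ξ t + volErrorReal χ Ω ϑ t)) := by
  have h0 : (0:ℝ) ∈ Icc 0 Tstar := ⟨le_rfl, hT.le⟩
  have hK : 0 ≤ K := (norm_nonneg _).trans (hb.norm_B 0 h0 0)
  obtain ⟨n, hn⟩ := (hΩ 0 h0).exists_eq_add_one
  obtain ⟨L, hL⟩ := hcal.exists_lipschitzWith_thetaExt hT
  obtain ⟨Kt, hKt⟩ := hcal.theta_lip
  obtain ⟨MD, hMD⟩ := hcal.exists_abs_thetaDeriv_le hT
  have hw : ∀ t ∈ Icc 0 Tstar, Integrable (charFn (Ω t)) := fun t ht =>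
    IsCalibration.integrable_charFn (hΩ t ht).isOpen (ne_top_of_le_ne_top hV₀ (hvol t ht))
  have hΘK : ∀ p, |IsCalibration.thetaExt hT ϑ p| ≤ K := fun p =>
    hb.abs_theta _ (Subtype.mem _) _
  obtain ⟨iN, iD, hvelξ⟩ := hs.velocity_xi hT hcal
  have hvelϑ := hs.hasWeakVelocity_lipschitz hT hL hΘK
  have iχD := hs.integrable_chi_mul (IsCalibration.measurable_thetaDeriv hT ϑ).aestronglyMeasurable
    (ae_of_all _ hMD)
  have iwD := hcal.integrable_prod_charFn_mul_thetaDeriv hT hΩ hV₀ hvol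
  have iΘV := hs.integrable_mul_V hT hL.continuous.measurable hΘK
  set N : ℝ → ℝ := fun t => ∫ x, inner ℝ (extNormal (χ t) x)
    (IsCalibration.timeDeriv Tstar ξ t x) ∂(gradMeasure (χ t)) with hN
  set D : ℝ → ℝ := fun t => ∫ x, divergence (ξ t) x * V t x ∂(gradMeasure (χ t)) with hD
  set P₁ : ℝ → ℝ := fun t => ∫ x, χ t x * IsCalibration.thetaDeriv hT ϑ (t, x) with hP₁
  set P₂ : ℝ → ℝ := fun t => ∫ x, charFn (Ω t) x * IsCalibration.thetaDeriv hT ϑ (t, x) with hP₂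
  set Q : ℝ → ℝ := fun t => ∫ x, IsCalibration.thetaExt hT ϑ (t, x) * V t x ∂(gradMeasure (χ t))
    with hQ
  have iP₁ : IntegrableOn P₁ (Ioo 0 Tstar) := iχD.integral_prod_left
  have iP₂ : IntegrableOn P₂ (Ioo 0 Tstar) := by
    refine IntegrableOn.congr_fun (f := fun t => ∫ x, {p | IsCalibration.thetaExt hT ϑ p < 0}.indicator
      (IsCalibration.thetaDeriv hT ϑ) (t, x)) iwD.integral_prod_left (fun t ht => ?_)
      measurableSet_Ioo
    exact integral_congr_ae (ae_of_all _ fun x =>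
      hcal.indicator_thetaDeriv hT hΩ (Ioo_subset_Icc_self ht) x)
  have iQ : IntegrableOn Q (Ioo 0 Tstar) := hs.integrable_integral_perimeter iΘV
  refine ⟨fun t => -N t - D t + (P₁ t - P₂ t) + Q t,
    ((iN.neg.sub iD).add (iP₁.sub iP₂)).add iQ, ?_, ?_⟩
  · filter_upwards [hvelξ, hvelϑ, hs.bv, ae_restrict_mem measurableSet_Ioo] with T h1 h2 hbv hTI
    have hTc := Ioo_subset_Icc_self hTI
    have hsub : Ioo 0 T ⊆ Ioo 0 Tstar := Ioo_subset_Ioo_right hTI.2.le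
    have h3 := hcal.integral_charFn_mul_theta hT hΩ hV₀ hvol hTI
    have jN := iN.mono_set hsub
    have jD := iD.mono_set hsub
    have jP₁ := iP₁.mono_set hsub
    have jP₂ := iP₂.mono_set hsub
    have jQ := iQ.mono_set hsub
    have hsum : ∫ t in Ioo 0 T, (-N t - D t + (P₁ t - P₂ t) + Q t)
        = -(∫ t in Ioo 0 T, N t) - (∫ t in Ioo 0 T, D t)
          + ((∫ t in Ioo 0 T, P₁ t) - ∫ t in Ioo 0 T, P₂ t) + ∫ t in Ioo 0 T, Q t := by
      have j1 : IntegrableOn (fun t => -N t) (Ioo 0 T) := jN.neg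
      have j2 : IntegrableOn (fun t => -N t - D t) (Ioo 0 T) := j1.sub jD
      have j3 : IntegrableOn (fun t => P₁ t - P₂ t) (Ioo 0 T) := jP₁.sub jP₂
      have j4 : IntegrableOn (fun t => -N t - D t + (P₁ t - P₂ t)) (Ioo 0 T) := j2.add j3
      rw [integral_add j4 jQ, integral_add j2 j3, integral_sub j1 jD, integral_sub jP₁ jP₂,
        integral_neg]
    have e1 := entropyReal_eq hbv (hcal.contDiff_xi hTc).continuous
      (fun x => hcal.norm_xi_le_one hTc x)
    have e2 := entropyReal_eq hs.bv_zero (hcal.contDiff_xi h0).continuous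
      (fun x => hcal.norm_xi_le_one h0 x)
    have e3 := hcal.volErrorReal_eq hΩ hTc (hs.values T ⟨hTI.1.le, hTI.2⟩) hbv.1 (hw T hTc)
    have e4 := hcal.volErrorReal_eq hΩ h0 (hs.values 0 ⟨le_rfl, hT⟩) hs.bv_zero.1 (hw 0 h0)
    simp only [IsCalibration.thetaExt_eq hT hTc, IsCalibration.thetaExt_eq hT h0] at h2
    have h2' : (∫ x, ϑ T x * χ T x) - ∫ x, ϑ 0 x * χ 0 x
        = (∫ t in Ioo 0 T, P₁ t) + ∫ t in Ioo 0 T, Q t := h2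
    rw [hsum, e1, e2, e3, e4]
    linarith
  · filter_upwards [hs.bv, hs.ae_memLp_two hT, hs.integral_V_eq_zero hT, hs.ae_hasWeakCurvature hT,
      hb.transport_theta, hcal.ae_thetaDeriv_eq hT, ae_restrict_mem measurableSet_Ioo]
      with t hbv hV2 hV0 hcurv htr hDeq htI
    have htc := Ioo_subset_Icc_self htI
    have hp := hbv.isPolarGradient
    have hB := hcal.B_C1 t htc
    have hξ := hcal.contDiff_xi htc
    have hσ := isPolarGradient_charFn hn (hΩ t htc).isOpen (hΩ t htc).isCompact hξ.continuous
      (hcal.xi_normal t htc)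
    have hϑL := IsCalibration.lipschitzWith_theta hKt htc
    have E1 := hp.entropy_dissipation hξ (hcal.hasCompactSupport_xi htc) hB
      (hcal.continuous_timeDeriv hT htc) hV2 hV0
      (hcurv _ hB ⟨K, fun x => ⟨hb.norm_B t htc x, hb.norm_fderiv_B t htc x⟩⟩)
      (fun x => hcal.norm_xi_le_one htc x) (hb.norm_fderiv_xi t htc) (hb.norm_B t htc)
      (hb.norm_fderiv_B t htc) (hb.norm_timeDeriv t htc) (hb.abs_f t htc) (hb.abs_div_B t htc)
      (hb.transport_xi t htc) (hb.transport_norm_xi t htc) (hb.evolution t htc)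
    have E2 := hp.volError_growth hσ hbv.1 (hw t htc) hB (M := max K MD)
      (D := fun x => IsCalibration.thetaDeriv hT ϑ (t, x)) hV2 hξ.continuous
      (fun x => hcal.norm_xi_le_one htc x) (hb.norm_B t htc) (hb.norm_fderiv_B t htc)
      (hb.abs_div_B t htc) hϑL (fun x => (hb.abs_theta t htc x).trans (le_max_left _ _))
      (by
        filter_upwards [ae_restrict_mem isClosed_frontier.measurableSet] with y hy
        exact (hΩ t htc).theta_eq_zero hϑL.continuous (hcal.theta_neg t htc)
          (hcal.theta_pos t htc) hy)
      ((IsCalibration.measurable_thetaDeriv hT ϑ).comp measurable_prodMk_left)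
      (fun x => (hMD _).trans (le_max_right _ _)) (hb.theta_sq t htc)
      (by
        filter_upwards [htr, hDeq] with x h1 h2
        rw [h2]
        exact h1)
    have E3 := hp.abs_flux_le hbv.1 (hw t htc) hB (hb.norm_B t htc) (hb.norm_fderiv_B t htc)
      (hb.abs_div_B t htc) hϑL.continuous (hb.abs_theta t htc) (hb.div_B t htc)
      (hcal.integral_div_B_eq_zero hn htc (hΩ t htc) (hw t htc))
    have eP : P₁ t - P₂ t
        = ∫ x, (χ t x - charFn (Ω t) x) * IsCalibration.thetaDeriv hT ϑ (t, x) := by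
      have hm : AEStronglyMeasurable (fun x => IsCalibration.thetaDeriv hT ϑ (t, x)) volume :=
        ((IsCalibration.measurable_thetaDeriv hT ϑ).comp measurable_prodMk_left).aestronglyMeasurable
      rw [hP₁, hP₂]
      simp only
      rw [← integral_sub (hbv.1.mul_bdd (c := MD) hm (ae_of_all _ fun x => hMD _))
        ((hw t htc).mul_bdd (c := MD) hm (ae_of_all _ fun x => hMD _))]
      simp_rw [sub_mul]
    have eQ : Q t = ∫ x, ϑ t x * V t x ∂(gradMeasure (χ t)) := by
      rw [hQ]
      simp only [IsCalibration.thetaExt_eq hT htc]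
    rw [← eP, ← eQ] at E2
    have hE := entropyReal_nonneg hbv (fun x => hcal.norm_xi_le_one htc x)
    have hF := volErrorReal_nonneg χ Ω ϑ t
    rw [entropyReal] at hE ⊢
    rw [volErrorReal] at hF ⊢
    -- `E1` gains half of the square of `V - ν · B`, which `E2` consumes
    set E := ∫ x, (1 - inner ℝ (extNormal (χ t) x) (ξ t x)) ∂(gradMeasure (χ t))
    set F := ∫ x, |χ t x - charFn (Ω t) x| * |ϑ t x|
    set b := ∫ x, inner ℝ (extNormal (χ t) x) (B t x) ∂(gradMeasure (χ t))
    set l := |lam t|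
    have hl : 0 ≤ l := abs_nonneg _
    have hlb : (lamStar t - lam t) * b ≤ (K + l) * (K * F) := by
      refine (le_abs_self _).trans ?_
      rw [abs_mul]
      exact mul_le_mul ((abs_sub _ _).trans (add_le_add (hb.abs_lamStar t htc) le_rfl)) E3
        (abs_nonneg _) (by positivity)
    -- what remains of the bound when `E1`, `E2` and `hlb` have been subtracted
    have hE' : 0 ≤ (2.5 * K + K ^ 2 + (1 + 13 * K + 3 * K ^ 2) * l) * E := by positivity
    have hF' : 0 ≤ (1 + 11 * K + 2 * K ^ 2 + (1 + 12 * K + 3 * K ^ 2) * l) * F := by positivity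
    simp only [hN, hD] at *
    linarith

/-- The error estimate in terms of the integral of the Lagrange multiplier. -/
theorem ae_error_le (hs : IsDistributionalSolution Tstar χ V lam Clam) (hT : 0 < Tstar)
    (hcal : IsCalibration Tstar Ω ξ B ϑ lamStar)
    (hΩ : ∀ t ∈ Icc 0 Tstar, BoundsClosedSurface (Ω t)) {V₀ : ℝ≥0∞} (hV₀ : V₀ ≠ ∞)
    (hvol : ∀ t ∈ Icc 0 Tstar, volume (Ω t) ≤ V₀) {f : ℝ → Rd d → ℝ} {K : ℝ}
    (hb : CalibrationBounds Tstar ξ B ϑ lamStar f K) :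
    ∀ᵐ T ∂(volume.restrict (Ioo 0 Tstar)), entropyReal χ ξ T + volErrorReal χ Ω ϑ T
      ≤ (entropyReal χ ξ 0 + volErrorReal χ Ω ϑ 0)
        * Real.exp (∫ t in Ioo 0 T, (1 + 13 * K + 3 * K ^ 2) * (1 + |lam t|)) := by
  have h0 : (0:ℝ) ∈ Icc 0 Tstar := ⟨le_rfl, hT.le⟩
  have hK : 0 ≤ K := (norm_nonneg _).trans (hb.norm_B 0 h0 0)
  have hfin0 := hs.bv_zero.isFiniteMeasure
  have hκ := hs.isFiniteKernel
  obtain ⟨q, hq, heq, hrate⟩ := hs.exists_rate hT hcal hΩ hV₀ hvol hb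
  set e : ℝ → ℝ := fun t => entropyReal χ ξ t + volErrorReal χ Ω ϑ t with he
  set a : ℝ → ℝ := fun t => (1 + 13 * K + 3 * K ^ 2) * (1 + |lam t|) with ha
  set A₀ : ℝ := entropyReal χ ξ 0 + volErrorReal χ Ω ϑ 0 - (gradMeasure (χ 0)).real univ with hA₀
  have ha0 : ∀ t, 0 ≤ a t := fun t => by positivity
  have hnn : ∀ᵐ t ∂(volume.restrict (Ioo 0 Tstar)), 0 ≤ e t := by
    filter_upwards [hs.bv, ae_restrict_mem measurableSet_Ioo] with t ht htI
    exact add_nonneg (entropyReal_nonneg ht fun x =>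
      hcal.norm_xi_le_one (Ioo_subset_Icc_self htI) x) (volErrorReal_nonneg _ _ _ _)
  have hlami : ∀ T ∈ Ioo 0 Tstar, IntegrableOn lam (Ioo 0 T) := fun T hTI =>
    (integral_abs_le_sqrt_mul hTI.1 (hs.Clam_nonneg T hTI) (hs.lam_measurable.mono_measure
      (Measure.restrict_mono (Ioo_subset_Ioo_right hTI.2.le) le_rfl)) (hs.lam_sq T hTI)).1
  have hai : ∀ T ∈ Ioo 0 Tstar, IntegrableOn a (Ioo 0 T) := fun T hTI =>
    ((integrable_const (1:ℝ)).add (hlami T hTI).abs).const_mul _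
  -- the perimeter is a measurable function of time, and the remainder is a primitive
  have hem : AEStronglyMeasurable e (volume.restrict (Ioo 0 Tstar)) := by
    have hqi : Integrable ((Ioo 0 Tstar).indicator q) := hq.integrable_indicator measurableSet_Ioo
    have hcont : Continuous fun T => ∫ t in (0)..T, (Ioo 0 Tstar).indicator q t :=
      intervalIntegral.continuous_primitive (fun a b => hqi.intervalIntegrable) 0
    have hm : Measurable fun T => (hs.kernel T).real univ :=
      (hs.kernel.measurable_coe MeasurableSet.univ).ennreal_toReal
    refine ((hm.add_const A₀).add hcont.measurable).aestronglyMeasurable.congr ?_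
    filter_upwards [heq, hs.kernel_ae_eq, ae_restrict_mem measurableSet_Ioo] with T h1 h2 hTI
    simp only [he, Pi.add_apply]
    rw [h1, h2, ← integral_Ioo_eq_interval hTI.1.le, setIntegral_indicator measurableSet_Ioo,
      inter_eq_left.2 (Ioo_subset_Ioo_right hTI.2.le)]
  have hbd : ∀ᵐ t ∂(volume.restrict (Ioo 0 Tstar)), 0 ≤ e t ∧
      e t ≤ (gradMeasure (χ 0)).real univ + A₀ + ∫ t in Ioo 0 Tstar, |q t| := by
    filter_upwards [hnn, heq, hs.gradMeasure_univ_le, ae_restrict_mem measurableSet_Ioo]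
      with T h1 h2 h3 hTI
    refine ⟨h1, ?_⟩
    simp only [he]
    rw [h2]
    have hsub : Ioo 0 T ⊆ Ioo 0 Tstar := Ioo_subset_Ioo_right hTI.2.le
    have h4 : ∫ t in Ioo 0 T, q t ≤ ∫ t in Ioo 0 Tstar, |q t| :=
      (le_abs_self _).trans (abs_integral_le_integral_abs.trans
        (setIntegral_mono_set hq.abs (ae_of_all _ fun t => abs_nonneg _) hsub.eventuallyLE))
    have h5 : (gradMeasure (χ T)).real univ ≤ (gradMeasure (χ 0)).real univ :=
      ENNReal.toReal_mono (measure_ne_top _ _) h3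
    linarith
  refine ae_le_mul_exp_of_integral_le (add_nonneg (entropyReal_nonneg hs.bv_zero fun x =>
    hcal.norm_xi_le_one h0 x) (volErrorReal_nonneg _ _ _ _)) hem hbd ha0 hai ?_
  filter_upwards [heq, hs.energy_le hT, ae_restrict_mem measurableSet_Ioo] with T h1 h2 hTI
  have hsub : Ioo 0 T ⊆ Ioo 0 Tstar := Ioo_subset_Ioo_right hTI.2.le
  have jV := (hs.integrableOn_integral_sq hT).mono_set hsub
  have jq := hq.mono_set hsub
  have jae : IntegrableOn (fun t => a t * e t) (Ioo 0 T) := by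
    refine Integrable.mul_bdd (c := (gradMeasure (χ 0)).real univ + A₀ + ∫ t in Ioo 0 Tstar, |q t|)
      (hai T hTI) (hem.mono_measure (Measure.restrict_mono hsub le_rfl)) ?_
    filter_upwards [ae_restrict_of_ae_restrict_of_subset hsub hbd] with t ht
    rw [Real.norm_eq_abs, abs_of_nonneg ht.1]
    exact ht.2
  have jneg : IntegrableOn (fun t => -∫ x, V t x ^ 2 ∂(gradMeasure (χ t))) (Ioo 0 T) := jV.neg
  have h3 : ∫ t in Ioo 0 T, (-(∫ x, V t x ^ 2 ∂(gradMeasure (χ t))) + q t)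
      ≤ ∫ t in Ioo 0 T, a t * e t :=
    integral_mono_ae (jneg.add jq) jae (ae_restrict_of_ae_restrict_of_subset hsub hrate)
  rw [integral_add jneg jq, integral_neg] at h3
  rw [h1]
  linarith

/-- The exponent in Gronwall's inequality, estimated by the `L²` norm of the Lagrange multiplier on
a possibly larger interval. -/
theorem integral_coeff_le (hs : IsDistributionalSolution Tstar χ V lam Clam) {c t T : ℝ}
    (hc : 0 ≤ c) (ht : 0 < t) (htT : t ≤ T) (hT : T < Tstar) :
    ∫ s in Ioo 0 t, c * (1 + |lam s|) ≤ c * (1 + √Tstar) * √T * (1 + Clam T) := by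
  have hTI : T ∈ Ioo 0 Tstar := ⟨ht.trans_le htT, hT⟩
  have hC := hs.Clam_nonneg T hTI
  obtain ⟨hi, hle⟩ := integral_abs_le_sqrt_mul hTI.1 hC (hs.lam_measurable.mono_measure
    (Measure.restrict_mono (Ioo_subset_Ioo_right hT.le) le_rfl)) (hs.lam_sq T hTI)
  have hsub : Ioo 0 t ⊆ Ioo 0 T := Ioo_subset_Ioo_right htT
  have h1 : ∫ s in Ioo 0 t, |lam s| ≤ √T * Clam T :=
    (setIntegral_mono_set hi.abs (ae_of_all _ fun t => abs_nonneg _) hsub.eventuallyLE).trans hle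
  have h2 : ∫ s in Ioo 0 t, c * (1 + |lam s|) = c * (t + ∫ s in Ioo 0 t, |lam s|) := by
    have hia : IntegrableOn (fun s => |lam s|) (Ioo 0 t) := (hi.mono_set hsub).abs
    rw [integral_const_mul, integral_add (integrable_const _) hia, integral_const]
    simp [Real.volume_real_Ioo_of_le ht.le]
  have h3 : T = √T * √T := (Real.mul_self_sqrt hTI.1.le).symm
  have h4 : √T ≤ √Tstar := Real.sqrt_le_sqrt hT.le
  have h5 : t ≤ √T * √Tstar := by
    calc t ≤ √T * √T := by rw [← h3]; exact htT
      _ ≤ √T * √Tstar := mul_le_mul_of_nonneg_left h4 (Real.sqrt_nonneg T)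
  rw [h2, mul_assoc, mul_assoc]
  refine mul_le_mul_of_nonneg_left ?_ hc
  have h6 : 0 ≤ √T := Real.sqrt_nonneg T
  have h7 : 0 ≤ √Tstar * (√T * Clam T) := by positivity
  linarith

/-- Either the initial error is infinite, or the errors are finite and Gronwall's inequality
applies. -/
theorem ae_relEntropy_add_volError_le (hs : IsDistributionalSolution Tstar χ V lam Clam)
    (hT : 0 < Tstar) (hcal : IsCalibration Tstar Ω ξ B ϑ lamStar)
    (hΩ : ∀ t ∈ Icc 0 Tstar, BoundsClosedSurface (Ω t)) {f : ℝ → Rd d → ℝ} {K : ℝ}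
    (hb : CalibrationBounds Tstar ξ B ϑ lamStar f K) :
    ∀ᵐ t ∂(volume.restrict (Ioo 0 Tstar)), ∀ T ∈ Ico t Tstar,
      relEntropy χ ξ t + volError χ Ω ϑ t
        ≤ ENNReal.ofReal (Real.exp ((1 + 13 * K + 3 * K ^ 2) * (1 + √Tstar) * √T * (1 + Clam T)))
          * (relEntropy χ ξ 0 + volError χ Ω ϑ 0) := by
  have h0 : (0:ℝ) ∈ Icc 0 Tstar := ⟨le_rfl, hT.le⟩
  have hK : 0 ≤ K := (norm_nonneg _).trans (hb.norm_B 0 h0 0)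
  by_cases hF : volError χ Ω ϑ 0 = ∞
  · refine ae_of_all _ fun t T _ => ?_
    rw [hF, add_top, ENNReal.mul_top (by simpa using Real.exp_pos _)]
    exact le_top
  obtain ⟨V₀, hV₀, hvol⟩ := hcal.exists_volume_le hT hΩ hs.bv_zero.1
    (hs.values 0 ⟨le_rfl, hT⟩) hF
  have hw : ∀ t ∈ Icc 0 Tstar, Integrable (charFn (Ω t)) := fun t ht =>
    IsCalibration.integrable_charFn (hΩ t ht).isOpen (ne_top_of_le_ne_top hV₀ (hvol t ht))
  have herr : ∀ t ∈ Icc 0 Tstar, IsBV (χ t) → relEntropy χ ξ t + volError χ Ω ϑ t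
      = ENNReal.ofReal (entropyReal χ ξ t + volErrorReal χ Ω ϑ t) := fun t ht hbv => by
    rw [relEntropy_eq_ofReal hbv (hcal.contDiff_xi ht).continuous
      (fun x => hcal.norm_xi_le_one ht x), hcal.volError_eq_ofReal ht hbv.1 (hw t ht),
      ENNReal.ofReal_add (entropyReal_nonneg hbv fun x => hcal.norm_xi_le_one ht x)
        (volErrorReal_nonneg _ _ _ _)]
  filter_upwards [hs.ae_error_le hT hcal hΩ hV₀ hvol hb, hs.bv,
    ae_restrict_mem measurableSet_Ioo] with t ht hbv htI T hTI
  rw [herr t (Ioo_subset_Icc_self htI) hbv, herr 0 h0 hs.bv_zero,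
    ← ENNReal.ofReal_mul (Real.exp_pos _).le]
  refine ENNReal.ofReal_le_ofReal (ht.trans ?_)
  rw [mul_comm]
  refine mul_le_mul_of_nonneg_right (Real.exp_le_exp.2 ?_)
    (add_nonneg (entropyReal_nonneg hs.bv_zero fun x => hcal.norm_xi_le_one h0 x)
      (volErrorReal_nonneg _ _ _ _))
  exact hs.integral_coeff_le (by positivity) htI.1 hTI.1 hTI.2

/-- A solution that starts from the calibrated domain has vanishing initial relative entropy, by
uniqueness of the polar decomposition of the gradient. -/
theorem relEntropy_zero_eq_zero (hs : IsDistributionalSolution Tstar χ V lam Clam)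
    (hT : 0 < Tstar) (hcal : IsCalibration Tstar Ω ξ B ϑ lamStar)
    (hΩ : ∀ t ∈ Icc 0 Tstar, BoundsClosedSurface (Ω t))
    (h : ∀ᵐ x : Rd d, χ 0 x = charFn (Ω 0) x) : relEntropy χ ξ 0 = 0 := by
  have h0 : (0:ℝ) ∈ Icc 0 Tstar := ⟨le_rfl, hT.le⟩
  obtain ⟨n, hn⟩ := (hΩ 0 h0).exists_eq_add_one
  have hσ := isPolarGradient_charFn hn (hΩ 0 h0).isOpen (hΩ 0 h0).isCompact
    (hcal.contDiff_xi h0).continuous (hcal.xi_normal 0 h0)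
  have hp := hs.bv_zero.isPolarGradient
  obtain ⟨-, hν⟩ := hp.unique (hσ.congr (by filter_upwards [h] with x hx using hx.symm))
  rw [relEntropy]
  refine (lintegral_congr_ae ?_).trans lintegral_zero
  filter_upwards [hν, hp.norm_eq_one] with x hx hx1
  rw [← hx, real_inner_self_eq_norm_sq, hx1]
  simp

theorem volError_zero_eq_zero (h : ∀ᵐ x : Rd d, χ 0 x = charFn (Ω 0) x) :
    volError χ Ω ϑ 0 = 0 := by
  rw [volError]
  refine (lintegral_congr_ae ?_).trans lintegral_zero
  filter_upwards [h] with x hx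
  simp [hx]

/-- The volume error vanishes only if `χ` is the characteristic function of the calibrated domain,
because `ϑ` vanishes only on its boundary, which is a null set. -/
theorem ae_eq_charFn_of_volError_eq_zero (hs : IsDistributionalSolution Tstar χ V lam Clam)
    (hT : 0 < Tstar) (hcal : IsCalibration Tstar Ω ξ B ϑ lamStar)
    (hΩ : ∀ t ∈ Icc 0 Tstar, BoundsClosedSurface (Ω t))
    (h : ∀ᵐ t ∂(volume.restrict (Ioo 0 Tstar)), volError χ Ω ϑ t = 0) :
    ∀ᵐ p : ℝ × Rd d ∂(volume.restrict (Ioo 0 Tstar ×ˢ univ)),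
      χ p.1 p.2 = charFn (Ω p.1) p.2 := by
  obtain ⟨n, hn⟩ := (hΩ 0 ⟨le_rfl, hT.le⟩).exists_eq_add_one
  have hsec : ∀ᵐ t ∂(volume.restrict (Ioo 0 Tstar)), ∀ᵐ x, χ t x = charFn (Ω t) x := by
    filter_upwards [h, hs.bv, ae_restrict_mem measurableSet_Ioo] with t ht hbv htI
    have htc := Ioo_subset_Icc_self htI
    have hc := hcal.continuous_theta htc
    have hm : AEMeasurable fun x => ENNReal.ofReal (|χ t x - charFn (Ω t) x| * |ϑ t x|) := by
      have h1 : Measurable (charFn (Ω t)) := measurable_one.indicator (hΩ t htc).isOpen.measurableSet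
      have h3 : AEMeasurable (fun x => |χ t x - charFn (Ω t) x|) :=
        measurable_abs.comp_aemeasurable (hbv.1.1.aemeasurable.sub h1.aemeasurable)
      have h4 : AEMeasurable (fun x => |ϑ t x|) := (measurable_abs.comp hc.measurable).aemeasurable
      exact (h3.mul h4).ennreal_ofReal
    rw [volError, lintegral_eq_zero_iff' hm] at ht
    have hnull : ∀ᵐ x : Rd d, x ∉ frontier (Ω t) := measure_eq_zero_iff_ae_notMem.1
      (volume_frontier_eq_zero hn (hΩ t htc).isOpen (hΩ t htc).isCompact (hcal.xi_normal t htc))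
    filter_upwards [ht, hnull] with x hx hxf
    have hϑ : 0 < |ϑ t x| := by
      rw [abs_pos]
      by_cases hxΩ : x ∈ Ω t
      · exact (hcal.theta_neg t htc x hxΩ).ne
      · refine (hcal.theta_pos t htc x fun hcl => hxf ?_).ne'
        rw [(hΩ t htc).isOpen.frontier_eq]
        exact ⟨hcl, hxΩ⟩
    have h5 : |χ t x - charFn (Ω t) x| * |ϑ t x| ≤ 0 := ENNReal.ofReal_eq_zero.1 hx
    have h6 : |χ t x - charFn (Ω t) x| ≤ 0 := by
      by_contra hcon
      exact absurd h5 (not_le.2 (mul_pos (not_le.1 hcon) hϑ))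
    exact sub_eq_zero.1 (abs_nonpos_iff.1 h6)
  -- joint measurability, in order to pass from almost every time to space-time
  obtain ⟨g, hg, hχg⟩ := hs.aemeasurable
  set W : ℝ × Rd d → ℝ := {p | IsCalibration.thetaExt hT ϑ p < 0}.indicator 1 with hW
  have hWm : Measurable W := measurable_one.indicator
    (isOpen_lt (hcal.continuous_thetaExt hT) continuous_const).measurableSet
  have hWeq : ∀ t ∈ Ioo 0 Tstar, ∀ x, W (t, x) = charFn (Ω t) x := fun t ht x => by
    have h1 := hcal.thetaExt_neg_iff hT hΩ (Ioo_subset_Icc_self ht) x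
    have h2 : (t, x) ∈ {p : ℝ × Rd d | IsCalibration.thetaExt hT ϑ p < 0} ↔ x ∈ Ω t := h1
    by_cases hx : x ∈ Ω t
    · rw [hW, charFn, indicator_of_mem hx, indicator_of_mem (h2.2 hx)]
      rfl
    · rw [hW, charFn, indicator_of_notMem hx, indicator_of_notMem (fun hlt => hx (h2.1 hlt))]
  have hvol : (volume : Measure (ℝ × Rd d)).restrict (Ioo 0 Tstar ×ˢ univ)
      = (volume.restrict (Ioo 0 Tstar)).prod (volume : Measure (Rd d)) := by
    rw [Measure.volume_eq_prod, ← Measure.prod_restrict, Measure.restrict_univ]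
  have hgW : ∀ᵐ p ∂(volume.restrict (Ioo 0 Tstar)).prod (volume : Measure (Rd d)), g p = W p := by
    refine (Measure.measure_prod_null (measurableSet_eq_fun hg hWm).compl).2 ?_
    rw [hvol] at hχg
    filter_upwards [Measure.ae_ae_of_ae_prod hχg, hsec, ae_restrict_mem measurableSet_Ioo]
      with t h1 h2 htI
    refine ae_iff.1 ?_
    filter_upwards [h1, h2] with x h3 h4
    show g (t, x) = W (t, x)
    rw [hWeq t htI, ← h4]
    exact h3.symm
  filter_upwards [hχg, (hvol ▸ hgW :), ae_restrict_mem (measurableSet_Ioo.prod MeasurableSet.univ)]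
    with p h1 h2 hp
  have h3 := hWeq p.1 hp.1 p.2
  rw [← h3, ← h2]
  exact h1

end IsDistributionalSolution

end

end VPMCF

end

theorem mainTheorem2 {d : ℕ} {Tstar : ℝ} (hT : 0 < Tstar)
    (Ω : ℝ → Set (VPMCF.Rd d)) (hΩ : ∀ t ∈ Icc 0 Tstar, VPMCF.BoundsClosedSurface (Ω t))
    (ξ B : ℝ → VPMCF.Rd d → VPMCF.Rd d) (ϑ : ℝ → VPMCF.Rd d → ℝ) (lamStar : ℝ → ℝ)
    (hcal : VPMCF.IsCalibration Tstar Ω ξ B ϑ lamStar) :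
    ∃ C : ℝ, 0 < C ∧
      ∀ (χ V : ℝ → VPMCF.Rd d → ℝ) (lam Clam : ℝ → ℝ),
        VPMCF.IsDistributionalSolution Tstar χ V lam Clam →
        (∀ᵐ t ∂(volume.restrict (Ioo 0 Tstar)),
          VPMCF.relEntropy χ ξ t + VPMCF.volError χ Ω ϑ t
            ≤ ENNReal.ofReal (Real.exp (C * √t * (1 + Clam t)))
              * (VPMCF.relEntropy χ ξ 0 + VPMCF.volError χ Ω ϑ 0)) ∧
        (∀ T ∈ Ioo 0 Tstar, ∀ᵐ t ∂(volume.restrict (Ioo 0 T)),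
          VPMCF.relEntropy χ ξ t + VPMCF.volError χ Ω ϑ t
            ≤ ENNReal.ofReal (Real.exp (C * √T * (1 + Clam T)))
              * (VPMCF.relEntropy χ ξ 0 + VPMCF.volError χ Ω ϑ 0)) ∧
        ((∀ᵐ x : VPMCF.Rd d, χ 0 x = VPMCF.charFn (Ω 0) x) →
          ∀ᵐ p : ℝ × VPMCF.Rd d ∂(volume.restrict (Ioo 0 Tstar ×ˢ univ)),
            χ p.1 p.2 = VPMCF.charFn (Ω p.1) p.2) := by
  obtain ⟨f, K, hb⟩ := hcal.exists_bounds hT hΩ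
  have hK : 0 ≤ K := (norm_nonneg _).trans (hb.norm_B 0 ⟨le_rfl, hT.le⟩ 0)
  -- the Gronwall coefficient is `(1 + 13 K + 3 K²)(1 + |λ|)`, and `t ≤ √t √Tstar`
  refine ⟨(1 + 13 * K + 3 * K ^ 2) * (1 + √Tstar), by positivity, fun χ V lam Clam hs => ?_⟩
  have hmain := hs.ae_relEntropy_add_volError_le hT hcal hΩ hb
  refine ⟨?_, fun T hTI => ?_, fun h => ?_⟩
  · filter_upwards [hmain, ae_restrict_mem measurableSet_Ioo] with t ht htI
    exact ht t ⟨le_rfl, htI.2⟩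
  · filter_upwards [ae_restrict_of_ae_restrict_of_subset (Ioo_subset_Ioo_right hTI.2.le) hmain,
      ae_restrict_mem measurableSet_Ioo] with t ht htI
    exact ht T ⟨htI.2.le, hTI.2⟩
  · refine hs.ae_eq_charFn_of_volError_eq_zero hT hcal hΩ ?_
    filter_upwards [hmain, ae_restrict_mem measurableSet_Ioo] with t ht htI
    have h1 := ht t ⟨le_rfl, htI.2⟩
    rw [hs.relEntropy_zero_eq_zero hT hcal hΩ h,
      VPMCF.IsDistributionalSolution.volError_zero_eq_zero h, add_zero, mul_zero] at h1
    exact (add_eq_zero.1 (nonpos_iff_eq_zero.1 h1)).2
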